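/- Let $\omega_1\le\omega_2\le\dots$ be positive numbers with $\omega_k\to\infty$, and let $a>0$ be such that each of the intervals $$I_1=[0,a),\qquad I_k=\left[a(k-1)^{\omega_{k-1}},\,a k^{\omega_k}\right)\quad(k\ge 2)$$ contains at least one integer (this holds for all large enough $a$). Choose $n_k$, $k=1,2,\dots$, independently, $n_k$ being uniformly distributed on the integers in $I_k$, and let $\mu_\omega$ be the distribution of the random sequence $(n_k)_{k\ge1}$. Then for $\mu_\omega$-almost every sequence $(n_k)_{k\ge 1}$ the following holds for every measurable $f:\mathbb R\to\mathbb R$ such that $f(x+1)=f(x)$ for all $x$, $\int_0^1 f(x)\,dx=0$ and $f$ has bounded variation on $[0,1]$, and for every permutation $\sigma$ of the positive integers, with $\|f\|=\left(\int_0^1 f(x)^2dx\right)^{1/2}$. (i) On $[0,1]$ with Lebesgue measure, $N^{-1/2}\sum_{k=1}^N f(n_{\sigma(k)}x)$ converges in distribution to the normal law $\mathcal N(0,\|f\|^2)$ as $N\to\infty$ (the point mass at $0$ if $\|f\|=0$). (ii) If there are $\alpha>0$ and $k_0$ with $\omega_k\ge(\log k)^\alpha$ for all $k\ge k_0$, then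 $$\limsup_{N\to\infty}\frac{\sum_{k=1}^N f(n_{\sigma(k)}x)}{(2N\log\log N)^{1/2}}=\|f\|\qquad\text{for almost every }x.$$ -/

import Mathlib

open MeasureTheory ProbabilityTheory Filter Topology

namespace RandomLacunary

noncomputable section

/-- The condition on `f`: measurable, `f (x + 1) = f x`, `∫₀¹ f = 0` and bounded variation over a
period. -/
structure Admissible (f : ℝ → ℝ) : Prop where
  measurable : Measurable f
  periodic : Function.Periodic f 1
  integral_eq_zero : ∫ x in (0 : ℝ)..1, f x = 0
  boundedVariation : BoundedVariationOn f (Set.Icc 0 1)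

/-- The norm `‖f‖` of `f` in `L²(0, 1)`. -/
def l2Norm (f : ℝ → ℝ) : ℝ := √(∫ x in (0 : ℝ)..1, f x ^ 2)

/-- The right endpoint `a k ^ ω_k` of the `k`-th interval; for `k = 0` it is `0`, the left endpoint
of the first interval (there is no `ω_0`). -/
def endpoint (a : ℝ) (ω : ℕ → ℝ) (k : ℕ) : ℝ := if k = 0 then 0 else a * (k : ℝ) ^ ω k

/-- The integers in the interval `I_k = [a (k - 1) ^ ω_{k - 1}, a k ^ ω_k)`, for `k ≥ 1`. -/
def blockIntegers (a : ℝ) (ω : ℕ → ℝ) (k : ℕ) : Set ℤ :=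
  {m : ℤ | (m : ℝ) ∈ Set.Ico (endpoint a ω (k - 1)) (endpoint a ω k)}

/-- The law `μ_ω` of the random sequence `n_1, n_2, …`, where the `n_k` are independent and `n_k` is
uniformly distributed on the integers of `I_k`. The coordinate with index `i : ℕ` is `n_{i + 1}`. -/
def randomSeqLaw (a : ℝ) (ω : ℕ → ℝ) : Measure (ℕ → ℤ) :=
  Measure.infinitePi fun i => uniformOn (blockIntegers a ω (i + 1))

lemma blockIntegers_finite (a : ℝ) (ω : ℕ → ℝ) (k : ℕ) : (blockIntegers a ω k).Finite := by
  refine (Set.finite_Ico ⌈endpoint a ω (k - 1)⌉ ⌈endpoint a ω k⌉).subset fun m hm => ?_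
  exact ⟨Int.ceil_le.2 hm.1, Int.lt_ceil.2 hm.2⟩

/-- The law is a genuine probability measure as soon as every `I_k` contains an integer. -/
lemma isProbabilityMeasure_randomSeqLaw {a : ℝ} {ω : ℕ → ℝ}
    (h : ∀ k, 1 ≤ k → (blockIntegers a ω k).Nonempty) :
    IsProbabilityMeasure (randomSeqLaw a ω) := by
  have (i : ℕ) : IsProbabilityMeasure (uniformOn (blockIntegers a ω (i + 1))) :=
    isProbabilityMeasure_uniformOn (blockIntegers_finite a ω _) (h _ (by omega))
  unfold randomSeqLaw
  infer_instance

/-- The partial sum of the first `N` terms of `(f (n_k x))`. -/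
def partialSum (f : ℝ → ℝ) (n : ℕ → ℤ) (N : ℕ) (x : ℝ) : ℝ :=
  ∑ i ∈ Finset.range N, f ((n i : ℝ) * x)

/-- The central limit theorem for `(f (n_k x))`: on `[0, 1]` with Lebesgue measure, the normalized
sums `N ^ (-1/2) ∑_{k ≤ N} f (n_k x)` converge in distribution to `N(0, ‖f‖²)`. -/
def SatisfiesCLT (f : ℝ → ℝ) (n : ℕ → ℤ) : Prop :=
  TendstoInDistribution
    (fun (N : ℕ) (x : unitInterval) => partialSum f n N (x : ℝ) / √(N : ℝ)) atTop
    (id : ℝ → ℝ) (fun _ => (volume : Measure unitInterval))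
    (gaussianReal 0 (l2Norm f ^ 2).toNNReal)

/-- The law of the iterated logarithm for `(f (n_k x))`; the upper limit is taken in the extended
reals. -/
def SatisfiesLIL (f : ℝ → ℝ) (n : ℕ → ℤ) : Prop :=
  ∀ᵐ x : ℝ, limsup (fun N : ℕ =>
    ((partialSum f n N x / √(2 * N * Real.log (Real.log N)) : ℝ) : EReal)) atTop
      = ((l2Norm f : ℝ) : EReal)

end

end RandomLacunary

/-! Everything rests on one almost sure arithmetic property of the sequence, `NoRelations`. A
relation `∑ h_j n_{g_j} = 0` whose total coefficient at the top index `k` is nonzero determines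
`n_k` from the earlier terms, so it has probability at most `1 / |I_k|`, and `I_k` contains at least
about `k ^ (ω_k - 1)` integers. There are only `k ^ (w² + O(w))` relations of length at most `w`
with coefficients at most `k ^ w`. With `w` about `√ω_k / 2` the probabilities are summable, and
Borel–Cantelli excludes all such relations for large `k` (`ae_noRelations`). The property mentions
neither `f` nor the order of the terms, so a single null set serves all `f` and all permutations.

Without relations, distinct dilates behave like independent variables. If `p` is a trigonometric
polynomial of small degree, expanding powers into characters shows that the moments of `∑ c_i p(n_i
x)` up to order `W` equal those of the same sum of independent copies of `p`
(`IsDissociated.integral_pow_eq`). A function of bounded variation is replaced by a Fejér mean,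
which is polynomially close in `L¹`; at scale `R` the degree `R ^ 32` makes the total error over `R
^ 8` terms negligible. Terms of index at most `R` escape the arithmetic control, but a permutation
has at most `R + 1` of them, negligible against `√N` when `N ≥ R ^ 4`. This reduction is
`exists_scale`.

For the central limit theorem, equality of moments up to order `W R → ∞` makes the characteristic
functions agree with those of the independent model up to a Taylor remainder tending to zero, and
the independent model is nearly Gaussian.

For the law of the iterated logarithm at `N ≈ 2 ^ j`, tails of size `j ^ (-1-ε)` are needed, hence
moments of order about `log j`. The growth of `ω` provides order at least a power of `j`. The upper
bound combines Chebyshev's inequality at the optimal moment, dyadic chaining and Borel–Cantelli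
(`ae_eventually_abs_partialSum_le`). For the lower bound, the characteristic functions are matched
so closely that `4 J` sums over geometric blocks are nearly independent in pairs; a second moment
argument with a trigonometric bump shows that some block is large with probability tending to one
(`exists_tendsto_measureReal_failureSet`). The terms before that block are controlled by the upper
bound (`ae_frequently_le_partialSum`). -/

namespace RandomLacunary

noncomputable section

/-! ### Characters on the unit interval. -/

/-- Lebesgue measure on the unit interval, as a measure on `ℝ`. -/
abbrev unitMeasure : Measure ℝ := volume.restrict (Set.Ioc 0 1)

instance : IsProbabilityMeasure unitMeasure := ⟨by simp⟩

lemma integral_unitMeasure {E : Type*} [NormedAddCommGroup E] [NormedSpace ℝ E] (g : ℝ → E) :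
    ∫ x, g x ∂unitMeasure = ∫ x in (0 : ℝ)..1, g x :=
  (intervalIntegral.integral_of_le zero_le_one).symm

/-- The standard character `exp (2πiy)`. -/
def ez (y : ℝ) : ℂ := Complex.exp ((2 * Real.pi * y : ℝ) * Complex.I)

@[simp] lemma norm_ez (y : ℝ) : ‖ez y‖ = 1 := Complex.norm_exp_ofReal_mul_I _

lemma ez_add (x y : ℝ) : ez (x + y) = ez x * ez y := by
  rw [ez, ez, ez, ← Complex.exp_add]; congr 1; push_cast; ring

@[simp] lemma ez_zero : ez 0 = 1 := by simp [ez]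

lemma ez_intCast (n : ℤ) : ez n = 1 := by
  rw [ez, Complex.exp_eq_one_iff]; exact ⟨n, by push_cast; ring⟩

lemma ez_neg (y : ℝ) : ez (-y) = (starRingEnd ℂ) (ez y) := by
  rw [ez, ez, ← Complex.exp_conj]; congr 1
  rw [map_mul, Complex.conj_ofReal, Complex.conj_I]; push_cast; ring

@[fun_prop] lemma continuous_ez : Continuous ez := by unfold ez; fun_prop

@[fun_prop] lemma measurable_ez : Measurable ez := continuous_ez.measurable

lemma ez_sum {α : Type*} (s : Finset α) (y : α → ℝ) : ez (∑ i ∈ s, y i) = ∏ i ∈ s, ez (y i) := by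
  classical
  induction s using Finset.induction_on with
  | empty => simp
  | insert a s ha ih => rw [Finset.sum_insert ha, Finset.prod_insert ha, ez_add, ih]

lemma ez_nat_mul (k : ℕ) (y : ℝ) : ez (k * y) = ez y ^ k := by
  rw [ez, ez, ← Complex.exp_nat_mul]; congr 1; push_cast; ring

lemma ez_int_mul_periodic (h : ℤ) : Function.Periodic (fun x => ez (h * x)) 1 := fun x => by
  simp only [mul_add, ez_add, mul_one, ez_intCast]

lemma integral_ez (h : ℤ) : ∫ x, ez (h * x) ∂unitMeasure = if h = 0 then 1 else 0 := by
  rw [integral_unitMeasure]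
  split_ifs with hh
  · simp [hh]
  · have hc : (2 * Real.pi * h * Complex.I : ℂ) ≠ 0 := by
      simp [Real.pi_ne_zero, hh]
    have h1 := integral_exp_mul_complex (a := 0) (b := 1) hc
    have h2 : Complex.exp (2 * Real.pi * h * Complex.I * (1 : ℝ)) = 1 := by
      rw [Complex.exp_eq_one_iff]; exact ⟨h, by push_cast; ring⟩
    rw [h2] at h1
    have h3 : (fun x : ℝ => ez (h * x)) =
        fun x : ℝ => Complex.exp (2 * Real.pi * h * Complex.I * x) := by
      funext x; rw [ez]; congr 1; push_cast; ring
    rw [h3, h1]; simp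

lemma integrable_of_abs_le {α : Type*} {m : MeasurableSpace α} {μ : Measure α} [IsFiniteMeasure μ]
    {g : α → ℝ} (hg : Measurable g) {B : ℝ} (hB : ∀ x, |g x| ≤ B) : Integrable g μ :=
  Integrable.of_bound hg.aestronglyMeasurable B (ae_of_all _ hB)

/-- Multiplication by a nonzero integer preserves the integral of a `1`-periodic function. -/
lemma integral_comp_int_mul {g : ℝ → ℝ} (hp : Function.Periodic g 1) (hg : Measurable g) {B : ℝ}
    (hB : ∀ x, |g x| ≤ B) {n : ℤ} (hn : n ≠ 0) :
    ∫ x, g (n * x) ∂unitMeasure = ∫ x, g x ∂unitMeasure := by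
  have hn' : (n : ℝ) ≠ 0 := by exact_mod_cast hn
  rw [integral_unitMeasure, integral_unitMeasure, intervalIntegral.integral_comp_mul_left _ hn']
  have := hp.intervalIntegral_add_zsmul_eq n 0
  simp only [zero_add, zsmul_eq_mul, mul_one] at this
  rw [mul_zero, mul_one, this fun a b => ⟨integrable_of_abs_le hg hB, integrable_of_abs_le hg hB⟩,
    smul_eq_mul, ← mul_assoc, inv_mul_cancel₀ hn', one_mul]

/-! ### The Fejér kernel -/

/-- The Dirichlet kernel `∑_{k < H} exp (2πiky)`. -/
def dirichlet (H : ℕ) (y : ℝ) : ℂ := ∑ k ∈ Finset.range H, ez (k * y)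

/-- The Fejér kernel. -/
def fejer (H : ℕ) (y : ℝ) : ℝ := ‖dirichlet H y‖ ^ 2 / H

lemma fejer_nonneg (H : ℕ) (y : ℝ) : 0 ≤ fejer H y := by unfold fejer; positivity

@[fun_prop] lemma continuous_dirichlet (H : ℕ) : Continuous (dirichlet H) := by
  unfold dirichlet; fun_prop

@[fun_prop] lemma continuous_fejer (H : ℕ) : Continuous (fejer H) := by
  unfold fejer; fun_prop

lemma fejer_le (H : ℕ) (y : ℝ) : fejer H y ≤ H := by
  have h1 : ‖dirichlet H y‖ ≤ H := by
    refine (norm_sum_le _ _).trans ?_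
    simp
  unfold fejer
  rcases Nat.eq_zero_or_pos H with rfl | hH
  · simp
  · have : (0 : ℝ) < H := by exact_mod_cast hH
    rw [div_le_iff₀ this]
    nlinarith [norm_nonneg (dirichlet H y)]

lemma fejer_eq_sum (H : ℕ) (y : ℝ) : (fejer H y : ℂ) =
    ∑ k ∈ Finset.range H ×ˢ Finset.range H, (H : ℂ)⁻¹ * ez (((k.1 : ℤ) - (k.2 : ℤ) : ℤ) * y) := by
  have h1 : ((‖dirichlet H y‖ ^ 2 : ℝ) : ℂ) = dirichlet H y * (starRingEnd ℂ) (dirichlet H y) := by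
    rw [Complex.mul_conj, Complex.normSq_eq_norm_sq]
  have h2 : (fejer H y : ℂ) = (H : ℂ)⁻¹ * ((‖dirichlet H y‖ ^ 2 : ℝ) : ℂ) := by
    unfold fejer; push_cast; ring
  rw [h2, h1, dirichlet, map_sum, Finset.sum_mul_sum, ← Finset.sum_product', Finset.mul_sum]
  refine Finset.sum_congr rfl fun k _ => ?_
  rw [← ez_neg, ← ez_add]
  congr 2; push_cast; ring

lemma integral_fejer {H : ℕ} (hH : H ≠ 0) : ∫ y, fejer H y ∂unitMeasure = 1 := by
  have hH' : (H : ℂ) ≠ 0 := by exact_mod_cast hH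
  have : ((∫ y, fejer H y ∂unitMeasure : ℝ) : ℂ) = 1 := by
    rw [← integral_complex_ofReal]
    simp_rw [fejer_eq_sum]
    rw [integral_finsetSum]
    · simp_rw [integral_const_mul, integral_ez]
      rw [Finset.sum_product]
      have : ∀ k ∈ Finset.range H, (∑ l ∈ Finset.range H, (H : ℂ)⁻¹ *
          (if (k : ℤ) - (l : ℤ) = 0 then (1 : ℂ) else 0)) = (H : ℂ)⁻¹ := by
        intro k hk
        rw [Finset.sum_eq_single k]
        · simp
        · intro l _ hl
          rw [if_neg (by omega), mul_zero]
        · exact fun h => absurd hk h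
      rw [Finset.sum_congr rfl this]
      simp [hH']
    · intro k _
      refine Integrable.of_bound (by fun_prop) (‖(H : ℂ)⁻¹‖) (ae_of_all _ fun y => ?_)
      simp
  exact_mod_cast this

/-- The factor `1 - ez y` telescopes the geometric sum in `dirichlet`, so the integrand is `|1 - ez
(H y)|² / H`, whose mean is `2 / H`. -/
lemma integral_fejer_mul_norm_sq {H : ℕ} (hH : H ≠ 0) :
    ∫ y, fejer H y * ‖1 - ez y‖ ^ 2 ∂unitMeasure = 2 / H := by
  have h1 : ∀ y, fejer H y * ‖1 - ez y‖ ^ 2 = (H : ℝ)⁻¹ * (2 - 2 * (ez (H * y)).re) := by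
    intro y
    have h2 : dirichlet H y * (1 - ez y) = 1 - ez (H * y) := by
      rw [dirichlet, ez_nat_mul, ← geom_sum_mul_neg]
      simp_rw [ez_nat_mul]
    have h3 : ‖dirichlet H y‖ ^ 2 * ‖1 - ez y‖ ^ 2 = 2 - 2 * (ez (H * y)).re := by
      rw [← mul_pow, ← norm_mul, h2, ← Complex.normSq_eq_norm_sq, Complex.normSq_sub]
      simp [Complex.normSq_eq_norm_sq]; ring
    rw [fejer, ← h3]; ring
  simp_rw [h1]
  have h4 : ∫ y, (ez (H * y)).re ∂unitMeasure = 0 := by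
    have h5 := integral_ez (H : ℤ)
    rw [if_neg (by exact_mod_cast hH)] at h5
    have h6 : Integrable (fun x : ℝ => ez (((H : ℤ) : ℝ) * x)) unitMeasure :=
      Integrable.of_bound (by fun_prop) 1 (ae_of_all _ fun y => by simp)
    have := integral_re h6
    rw [h5] at this
    simpa using this
  rw [integral_const_mul, integral_sub, integral_const_mul, h4]
  · simp; ring
  · simp
  · refine Integrable.of_bound (by fun_prop) 2 (ae_of_all _ fun y => ?_)
    have := Complex.abs_re_le_norm (ez (H * y))
    rw [norm_ez] at this
    rw [norm_mul]; simpa using this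

/-- Cauchy–Schwarz between the total mass `1` and the second moment `2 / H`, in the pointwise form
`t ≤ 1 / (2√H) + √H t² / 2`. -/
lemma integral_fejer_mul_norm_le {H : ℕ} (hH : H ≠ 0) :
    ∫ y, fejer H y * ‖1 - ez y‖ ∂unitMeasure ≤ 2 / √H := by
  have hH' : (0 : ℝ) < √H := Real.sqrt_pos.2 (by positivity)
  have key : ∀ y, fejer H y * ‖1 - ez y‖ ≤
      (√H)⁻¹ / 2 * fejer H y + √H / 2 * (fejer H y * ‖1 - ez y‖ ^ 2) := by
    intro y
    have h1 : ‖1 - ez y‖ ≤ (√H)⁻¹ / 2 + √H / 2 * ‖1 - ez y‖ ^ 2 := by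
      have h2 : 0 ≤ √H / 2 * (‖1 - ez y‖ - (√H)⁻¹) ^ 2 := by positivity
      have h3 : √H / 2 * (‖1 - ez y‖ - (√H)⁻¹) ^ 2 =
        (√H)⁻¹ / 2 + √H / 2 * ‖1 - ez y‖ ^ 2 - ‖1 - ez y‖ := by field_simp; ring
      linarith
    calc _ ≤ _ := mul_le_mul_of_nonneg_left h1 (fejer_nonneg H y)
      _ = _ := by ring
  have b1 : ∀ y, ‖1 - ez y‖ ≤ 2 := fun y => (norm_sub_le _ _).trans (by simp; norm_num)
  have i1 : Integrable (fejer H) unitMeasure :=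
    Integrable.of_bound (by fun_prop) H (ae_of_all _ fun y => by
      rw [Real.norm_of_nonneg (fejer_nonneg _ _)]; exact fejer_le _ _)
  have i2 : Integrable (fun y => fejer H y * ‖1 - ez y‖ ^ 2) unitMeasure :=
    Integrable.of_bound (by fun_prop) (H * 2 ^ 2) (ae_of_all _ fun y => by
      rw [Real.norm_of_nonneg (mul_nonneg (fejer_nonneg _ _) (by positivity))]
      exact mul_le_mul (fejer_le _ _) (pow_le_pow_left₀ (norm_nonneg _) (b1 y) 2) (by positivity)
        (by positivity))
  have i3 : Integrable (fun y => fejer H y * ‖1 - ez y‖) unitMeasure :=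
    Integrable.of_bound (by fun_prop) (H * 2) (ae_of_all _ fun y => by
      rw [Real.norm_of_nonneg (mul_nonneg (fejer_nonneg _ _) (by positivity))]
      exact mul_le_mul (fejer_le _ _) (b1 y) (by positivity) (by positivity))
  calc _ ≤ ∫ y, ((√H)⁻¹ / 2 * fejer H y + √H / 2 * (fejer H y * ‖1 - ez y‖ ^ 2)) ∂unitMeasure :=
        integral_mono i3 ((i1.const_mul _).add (i2.const_mul _)) key
    _ = (√H)⁻¹ / 2 + √H / 2 * (2 / H) := by
        rw [integral_add (i1.const_mul _) (i2.const_mul _), integral_const_mul, integral_const_mul,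
          integral_fejer hH, integral_fejer_mul_norm_sq hH, mul_one]
    _ ≤ _ := by
        have : (H : ℝ) = √H * √H := (Real.mul_self_sqrt (by positivity)).symm
        have h5 : √(H : ℝ) / 2 * (2 / H) = (√H)⁻¹ := by
          rw [div_mul_div_comm, mul_comm 2 (H : ℝ), mul_div_mul_right _ _ two_ne_zero]
          nth_rewrite 2 [this]
          field_simp
        rw [h5, div_eq_mul_inv 2]
        have : 0 < (√(H : ℝ))⁻¹ := by positivity
        linarith

/-- Jordan's inequality on each half of the period. It converts a modulus of continuity linear in
the distance to the integers into the chord length integrated against the Fejér kernel above. -/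
lemma four_mul_le_norm_one_sub_ez {y : ℝ} (h0 : 0 ≤ y) (h1 : y ≤ 1) :
    4 * min y (1 - y) ≤ ‖1 - ez y‖ := by
  have h2 : ‖1 - ez y‖ = 2 * Real.sin (Real.pi * y) := by
    rw [norm_sub_rev, ez, mul_comm, Complex.norm_exp_I_mul_ofReal_sub_one, Real.norm_eq_abs,
      abs_of_nonneg]
    · congr 2; ring
    · refine mul_nonneg zero_le_two (Real.sin_nonneg_of_nonneg_of_le_pi ?_ ?_)
      · have := Real.pi_pos; positivity
      · have := Real.pi_pos; nlinarith
  rw [h2]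
  have hpi := Real.pi_pos
  rcases le_total y (1 / 2) with h | h
  · have := Real.mul_le_sin (x := Real.pi * y) (by positivity) (by nlinarith)
    have h3 : 2 / Real.pi * (Real.pi * y) = 2 * y := by field_simp
    have := min_le_left y (1 - y)
    linarith
  · have := Real.mul_le_sin (x := Real.pi * (1 - y)) (by nlinarith) (by nlinarith)
    have h3 : 2 / Real.pi * (Real.pi * (1 - y)) = 2 * (1 - y) := by field_simp
    have h4 : Real.sin (Real.pi * (1 - y)) = Real.sin (Real.pi * y) := by
      rw [mul_sub, mul_one, Real.sin_pi_sub]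
    have := min_le_right y (1 - y)
    linarith

/-! ### Functions of bounded variation -/

/-- Boundedness comes from the Jordan decomposition into monotone functions. The normalisation `1 ≤
B` lets powers of `B` be compared later. -/
lemma Admissible.exists_bound {f : ℝ → ℝ} (hf : Admissible f) : ∃ B, 1 ≤ B ∧ ∀ x, |f x| ≤ B := by
  obtain ⟨p, q, hp, hq, hpq⟩ :=
    (hf.boundedVariation.locallyBoundedVariationOn).exists_monotoneOn_sub_monotoneOn
  have key : ∀ x ∈ Set.Icc (0 : ℝ) 1, |f x| ≤ |p 0| + |p 1| + |q 0| + |q 1| + 1 := by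
    intro x hx
    have a1 := hp (Set.left_mem_Icc.2 zero_le_one) hx hx.1
    have a2 := hp hx (Set.right_mem_Icc.2 zero_le_one) hx.2
    have a3 := hq (Set.left_mem_Icc.2 zero_le_one) hx hx.1
    have a4 := hq hx (Set.right_mem_Icc.2 zero_le_one) hx.2
    have e : f x = p x - q x := by rw [hpq]; rfl
    rw [e]
    have := neg_abs_le (p 0); have := le_abs_self (p 1); have := neg_abs_le (q 0)
    have := le_abs_self (q 1); have := abs_nonneg (p 0); have := abs_nonneg (p 1)
    have := abs_nonneg (q 0); have := abs_nonneg (q 1)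
    exact abs_le.2 ⟨by linarith, by linarith⟩
  refine ⟨|p 0| + |p 1| + |q 0| + |q 1| + 1, ?_, fun x => ?_⟩
  · have := abs_nonneg (p 0); have := abs_nonneg (p 1)
    have := abs_nonneg (q 0); have := abs_nonneg (q 1); linarith
  · have h1 := key (Int.fract x) ⟨Int.fract_nonneg _, (Int.fract_lt_one _).le⟩
    have h2 : f (Int.fract x) = f x := by
      have := hf.periodic.sub_int_mul_eq (x := x) ⌊x⌋
      rw [mul_one] at this; exact this
    rwa [h2] at h1

/-- The integral telescopes to `∫_{1-y}^1 p - ∫_0^y p`, and monotonicity bounds the two ends by `y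
p(1)` and `y p(0)`. -/
lemma integral_shift_sub_le {p : ℝ → ℝ} (hp : MonotoneOn p (Set.Icc 0 1)) {y : ℝ} (h0 : 0 ≤ y)
    (h1 : y ≤ 1) : ∫ x in (0 : ℝ)..(1 - y), (p (x + y) - p x) ≤ y * (p 1 - p 0) := by
  have int : ∀ a b : ℝ, 0 ≤ a → a ≤ 1 → 0 ≤ b → b ≤ 1 → IntervalIntegrable p volume a b :=
    fun a b h1 h2 h3 h4 => MonotoneOn.intervalIntegrable (hp.mono (by
      intro x hx
      exact ⟨(le_min h1 h3).trans hx.1, hx.2.trans (max_le h2 h4)⟩))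
  rw [intervalIntegral.integral_sub, intervalIntegral.integral_comp_add_right, zero_add,
    sub_add_cancel]
  · have e1 : (∫ x in y..1, p x) = (∫ x in (0:ℝ)..1, p x) - ∫ x in (0:ℝ)..y, p x := by
      rw [intervalIntegral.integral_interval_sub_left] <;> apply int <;> linarith
    have e2 : (∫ x in (0:ℝ)..1, p x) - ∫ x in (0:ℝ)..(1 - y), p x = ∫ x in (1 - y)..1, p x := by
      rw [intervalIntegral.integral_interval_sub_left] <;> apply int <;> linarith
    have e3 : ∫ x in (1 - y)..1, p x ≤ ∫ x in (1 - y)..1, p 1 := by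
      apply intervalIntegral.integral_mono_on (by linarith) (by apply int <;> linarith) (by simp)
      intro x hx
      exact hp ⟨by linarith [hx.1], hx.2⟩ ⟨zero_le_one, le_rfl⟩ hx.2
    have e4 : ∫ x in (0:ℝ)..y, p 0 ≤ ∫ x in (0:ℝ)..y, p x := by
      apply intervalIntegral.integral_mono_on (by linarith) (by simp) (by apply int <;> linarith)
      intro x hx
      exact hp ⟨le_rfl, zero_le_one⟩ ⟨hx.1, by linarith [hx.2]⟩ hx.1
    simp at e3 e4
    linarith
  · have := (int y 1 h0 h1 zero_le_one le_rfl).comp_add_right y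
    simpa using this
  · apply int <;> linarith

/-- The `L¹` modulus of continuity of a periodic function of bounded variation is linear. -/
lemma Admissible.exists_modulus {f : ℝ → ℝ} (hf : Admissible f) : ∃ C, 0 ≤ C ∧ ∀ y, 0 ≤ y → y ≤ 1 →
    ∫ x, |f (x + y) - f x| ∂unitMeasure ≤ C * min y (1 - y) := by
  obtain ⟨B, hB1, hB⟩ := hf.exists_bound
  obtain ⟨p, q, hp, hq, hpq⟩ :=
    (hf.boundedVariation.locallyBoundedVariationOn).exists_monotoneOn_sub_monotoneOn
  have hmeas := hf.measurable
  have bd : ∀ x y, |f x - f y| ≤ 2 * B := fun x y => (abs_sub _ _).trans (by linarith [hB x, hB y])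
  have ii : ∀ y a b : ℝ, IntervalIntegrable (fun x => |f (x + y) - f x|) volume a b := fun y a b =>
    ⟨integrable_of_abs_le (by fun_prop) (B := 2 * B) fun x => by rw [abs_abs]; exact bd _ _,
     integrable_of_abs_le (by fun_prop) (B := 2 * B) fun x => by rw [abs_abs]; exact bd _ _⟩
  have hp01 := hp (Set.left_mem_Icc.2 zero_le_one) (Set.right_mem_Icc.2 zero_le_one) zero_le_one
  have hq01 := hq (Set.left_mem_Icc.2 zero_le_one) (Set.right_mem_Icc.2 zero_le_one) zero_le_one
  set C := (p 1 - p 0) + (q 1 - q 0) + 2 * B with hC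
  have main : ∀ y, 0 ≤ y → y ≤ 1 → ∫ x, |f (x + y) - f x| ∂unitMeasure ≤ C * y := by
    intro y h0 h1
    rw [integral_unitMeasure, ← intervalIntegral.integral_add_adjacent_intervals (b := 1 - y)
      (ii _ _ _) (ii _ _ _)]
    have s1 : ∫ x in (0:ℝ)..(1 - y), |f (x + y) - f x| ≤
        ∫ x in (0:ℝ)..(1 - y), ((p (x + y) - p x) + (q (x + y) - q x)) := by
      have hint : ∀ r : ℝ → ℝ, MonotoneOn r (Set.Icc 0 1) →
          IntervalIntegrable (fun x => r (x + y) - r x) volume 0 (1 - y) := by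
        intro r hr
        have i1 : IntervalIntegrable r volume y 1 := MonotoneOn.intervalIntegrable (hr.mono (by
          rw [Set.uIcc_of_le h1]; exact Set.Icc_subset_Icc_left h0))
        have i2 : IntervalIntegrable r volume 0 (1 - y) := MonotoneOn.intervalIntegrable (hr.mono
          (by rw [Set.uIcc_of_le (by linarith)]; exact Set.Icc_subset_Icc_right (by linarith)))
        have := i1.comp_add_right y
        exact (by simpa using this : IntervalIntegrable (fun x => r (x + y)) volume 0 (1 - y)).sub i2
      apply intervalIntegral.integral_mono_on (by linarith) (ii _ _ _) ((hint p hp).add (hint q hq))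
      intro x hx
      have m1 : x ∈ Set.Icc (0:ℝ) 1 := ⟨hx.1, by linarith [hx.2]⟩
      have m2 : x + y ∈ Set.Icc (0:ℝ) 1 := ⟨by linarith [hx.1], by linarith [hx.2]⟩
      have a1 := hp m1 m2 (by linarith)
      have a2 := hq m1 m2 (by linarith)
      have e : f (x + y) - f x = (p (x + y) - p x) - (q (x + y) - q x) := by
        rw [hpq]; simp; ring
      rw [e]
      exact abs_le.2 ⟨by linarith, by linarith⟩
    have s2 : ∫ x in (0:ℝ)..(1 - y), ((p (x + y) - p x) + (q (x + y) - q x)) ≤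
        y * (p 1 - p 0) + y * (q 1 - q 0) := by
      rw [intervalIntegral.integral_add]
      · exact add_le_add (integral_shift_sub_le hp h0 h1) (integral_shift_sub_le hq h0 h1)
      all_goals
        refine IntervalIntegrable.sub ?_ ?_
        · have i1 : ∀ r : ℝ → ℝ, MonotoneOn r (Set.Icc 0 1) →
            IntervalIntegrable (fun x => r (x + y)) volume 0 (1 - y) := by
            intro r hr
            have i1 : IntervalIntegrable r volume y 1 := MonotoneOn.intervalIntegrable (hr.mono (by
              rw [Set.uIcc_of_le h1]; exact Set.Icc_subset_Icc_left h0))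
            have := i1.comp_add_right y
            simpa using this
          first | exact i1 p hp | exact i1 q hq
        · have i1 : ∀ r : ℝ → ℝ, MonotoneOn r (Set.Icc 0 1) →
            IntervalIntegrable r volume 0 (1 - y) := by
            intro r hr
            exact MonotoneOn.intervalIntegrable (hr.mono
              (by rw [Set.uIcc_of_le (by linarith)]; exact Set.Icc_subset_Icc_right (by linarith)))
          first | exact i1 p hp | exact i1 q hq
    -- On this last piece `x + y` leaves the period, where the monotone decomposition says nothing;
    -- its length `y` makes the trivial bound sufficient.
    have s3 : ∫ x in (1 - y)..1, |f (x + y) - f x| ≤ ∫ x in (1 - y)..1, 2 * B :=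
      intervalIntegral.integral_mono_on (by linarith) (ii _ _ _) (by simp) fun x _ => bd _ _
    simp at s3
    have : C * y = y * (p 1 - p 0) + y * (q 1 - q 0) + y * (2 * B) := by rw [hC]; ring
    linarith
  refine ⟨C, by linarith, fun y h0 h1 => ?_⟩
  rcases le_total y (1 - y) with h | h
  · rw [min_eq_left h]; exact main y h0 h1
  · rw [min_eq_right h]
    -- Modulo the period, translation by `1 - y` inverts translation by `y`, so both have the same
    -- `L¹` modulus.
    refine le_trans (le_of_eq ?_) (main (1 - y) (by linarith) (by linarith))
    rw [integral_unitMeasure, integral_unitMeasure]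
    have hper : Function.Periodic (fun x => |f (x + (1 - y)) - f x|) 1 := fun x => by
      have e1 := hf.periodic x
      have e2 := hf.periodic (x + (1 - y))
      have e3 : x + 1 + (1 - y) = x + (1 - y) + 1 := by ring
      simp only [e3, e1, e2]
    have h5 := hper.intervalIntegral_add_eq y 0
    rw [zero_add] at h5
    rw [← h5]
    have h6 := intervalIntegral.integral_comp_add_right (a := 0) (b := 1)
      (fun x => |f (x + (1 - y)) - f x|) y
    rw [zero_add, add_comm 1 y] at h6
    rw [← h6]
    refine intervalIntegral.integral_congr fun x _ => ?_
    have e1 := hf.periodic x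
    have e3 : x + y + (1 - y) = x + 1 := by ring
    simp only [e3, e1]
    rw [abs_sub_comm]

/-! ### Approximation by trigonometric polynomials. -/

/-- A real function is a trigonometric polynomial of degree at most `H`. -/
def IsTrigPoly (H : ℕ) (p : ℝ → ℝ) : Prop :=
  ∃ (s : Finset (ℕ × ℕ)) (h : ℕ × ℕ → ℤ) (w : ℕ × ℕ → ℂ), (∀ k ∈ s, |h k| ≤ H) ∧
    ∀ x, (p x : ℂ) = ∑ k ∈ s, w k * ez (h k * x)

/-- After the substitution `u = x + y`, the variable `x` occurs only in the characters of the
kernel. The double sum of `fejer_eq_sum` is left uncollected, with repeated frequencies, which is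
why `IsTrigPoly` is indexed by pairs. -/
lemma Admissible.fejer_isTrigPoly {f : ℝ → ℝ} (hf : Admissible f) (H : ℕ) :
    IsTrigPoly H (fun x => ∫ y, fejer H y * f (x + y) ∂unitMeasure) := by
  obtain ⟨B, hB1, hB⟩ := hf.exists_bound
  have hmeas := hf.measurable
  refine ⟨Finset.range H ×ˢ Finset.range H, fun k => (k.2 : ℤ) - (k.1 : ℤ), fun k =>
    (H : ℂ)⁻¹ * ∫ u, ez (((k.1 : ℤ) - (k.2 : ℤ) : ℤ) * u) * f u ∂unitMeasure, ?_, fun x => ?_⟩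
  · intro k hk
    simp only [Finset.mem_product, Finset.mem_range] at hk
    show |(k.2 : ℤ) - (k.1 : ℤ)| ≤ (H : ℤ)
    rw [abs_le]; omega
  · have hper : Function.Periodic (fun u => (fejer H (u - x) * f u : ℝ)) 1 := fun u => by
      have e1 := hf.periodic u
      have e2 : fejer H (u + 1 - x) = fejer H (u - x) := by
        have : ((fejer H (u + 1 - x) : ℝ) : ℂ) = fejer H (u - x) := by
          rw [fejer_eq_sum, fejer_eq_sum]
          refine Finset.sum_congr rfl fun k _ => ?_
          have := ez_int_mul_periodic ((k.1 : ℤ) - (k.2 : ℤ)) (u - x)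
          simp only at this
          rw [← this]; congr 3; ring
        exact_mod_cast this
      simp only [e1, e2]
    have h1 : ∫ y, fejer H y * f (x + y) ∂unitMeasure =
        ∫ u, fejer H (u - x) * f u ∂unitMeasure := by
      rw [integral_unitMeasure, integral_unitMeasure]
      have h5 := hper.intervalIntegral_add_eq x 0
      rw [zero_add] at h5
      rw [← h5]
      have h6 := intervalIntegral.integral_comp_add_right (a := 0) (b := 1)
        (fun u => fejer H (u - x) * f u) x
      rw [zero_add, add_comm 1 x] at h6
      rw [← h6]
      refine intervalIntegral.integral_congr fun y _ => ?_
      simp only [add_sub_cancel_right, add_comm x y]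
    simp only [h1]
    rw [← integral_complex_ofReal]
    simp only [Complex.ofReal_mul, fejer_eq_sum, Finset.sum_mul]
    rw [integral_finsetSum]
    · refine Finset.sum_congr rfl fun k _ => ?_
      rw [mul_assoc, ← integral_mul_const, ← integral_const_mul]
      refine integral_congr_ae (ae_of_all _ fun u => ?_)
      have : ez (((k.1 : ℤ) - (k.2 : ℤ) : ℤ) * (u - x)) =
        ez (((k.1 : ℤ) - (k.2 : ℤ) : ℤ) * u) * ez (((k.2 : ℤ) - (k.1 : ℤ) : ℤ) * x) := by
        rw [← ez_add]; congr 1; push_cast; ring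
      simp only [this]; ring
    · intro k _
      refine Integrable.of_bound (by fun_prop) (‖(H : ℂ)⁻¹‖ * B) (ae_of_all _ fun u => ?_)
      rw [norm_mul, norm_mul, norm_ez, mul_one, Complex.norm_real]
      exact mul_le_mul_of_nonneg_left (hB u) (norm_nonneg _)

/-- Fejér means: bounded trigonometric polynomials approximating `f` in `L¹` at a polynomial
rate. -/
theorem Admissible.exists_trigPoly {f : ℝ → ℝ} (hf : Admissible f) {B : ℝ} (hB : ∀ x, |f x| ≤ B) :
    ∃ C, 0 ≤ C ∧ ∀ H : ℕ, H ≠ 0 → ∃ p : ℝ → ℝ, IsTrigPoly H p ∧ Measurable p ∧ (∀ x, |p x| ≤ B) ∧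
      Function.Periodic p 1 ∧
      ∫ x, p x ∂unitMeasure = 0 ∧ ∫ x, |f x - p x| ∂unitMeasure ≤ C / √H := by
  obtain ⟨C, hC0, hC⟩ := hf.exists_modulus
  have hmeas := hf.measurable
  refine ⟨C, hC0, fun H hH => ?_⟩
  set p := (fun x => ∫ y, fejer H y * f (x + y) ∂unitMeasure) with hp
  have htp : IsTrigPoly H p := hf.fejer_isTrigPoly H
  have hpm : Measurable p := by
    have : StronglyMeasurable (Function.uncurry fun x y => fejer H y * f (x + y)) := by
      apply Measurable.stronglyMeasurable
      unfold Function.uncurry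
      fun_prop
    exact (this.integral_prod_right (ν := unitMeasure)).measurable
  have hB0 : 0 ≤ B := (abs_nonneg _).trans (hB 0)
  have i1 : Integrable (fejer H) unitMeasure :=
    Integrable.of_bound (by fun_prop) H (ae_of_all _ fun y => by
      rw [Real.norm_of_nonneg (fejer_nonneg _ _)]; exact fejer_le _ _)
  have i2 : ∀ x, Integrable (fun y => fejer H y * f (x + y)) unitMeasure := fun x =>
    integrable_of_abs_le (by fun_prop) (B := H * B) fun y => by
      rw [abs_mul, abs_of_nonneg (fejer_nonneg _ _)]
      exact mul_le_mul (fejer_le _ _) (hB _) (abs_nonneg _) (by positivity)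
  have hfsh : ∀ y, ∫ x, f (x + y) ∂unitMeasure = 0 := fun y => by
    rw [integral_unitMeasure, intervalIntegral.integral_comp_add_right, zero_add, add_comm 1 y,
      hf.periodic.intervalIntegral_add_eq y 0, zero_add]
    exact hf.integral_eq_zero
  refine ⟨p, htp, hpm, fun x => ?_, ?_, ?_, ?_⟩
  · calc |p x| ≤ ∫ y, |fejer H y * f (x + y)| ∂unitMeasure := abs_integral_le_integral_abs
      _ ≤ ∫ y, fejer H y * B ∂unitMeasure := by
        refine integral_mono (i2 x).abs (i1.mul_const _) fun y => ?_
        simp only [abs_mul, abs_of_nonneg (fejer_nonneg H y)]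
        exact mul_le_mul_of_nonneg_left (hB _) (fejer_nonneg _ _)
      _ = B := by rw [integral_mul_const, integral_fejer hH, one_mul]
  · intro x
    simp only [hp]
    refine integral_congr_ae (ae_of_all _ fun y => ?_)
    have := hf.periodic (x + y)
    simp only [← this]
    congr 2; ring
  · simp only [hp]
    rw [integral_integral_swap]
    · simp_rw [integral_const_mul, hfsh]; simp
    · refine integrable_of_abs_le (B := H * B) (by unfold Function.uncurry; fun_prop) fun z => ?_
      simp only [Function.uncurry, abs_mul, abs_of_nonneg (fejer_nonneg H z.2)]
      exact mul_le_mul (fejer_le _ _) (hB _) (abs_nonneg _) (by positivity)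
  · have bd : ∀ x y, |f x - f y| ≤ 2 * B := fun x y =>
      (abs_sub _ _).trans (by linarith [hB x, hB y])
    have i3 : ∀ x, Integrable (fun y => fejer H y * |f (x + y) - f x|) unitMeasure := fun x =>
      integrable_of_abs_le (by fun_prop) (B := H * (2 * B)) fun y => by
        rw [abs_mul, abs_abs, abs_of_nonneg (fejer_nonneg _ _)]
        exact mul_le_mul (fejer_le _ _) (bd _ _) (abs_nonneg _) (by positivity)
    have i4 : Integrable (Function.uncurry fun x y => fejer H y * |f (x + y) - f x|)
        (unitMeasure.prod unitMeasure) := by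
      refine integrable_of_abs_le (B := H * (2 * B)) (by unfold Function.uncurry; fun_prop)
        fun z => ?_
      simp only [Function.uncurry, abs_mul, abs_abs, abs_of_nonneg (fejer_nonneg H z.2)]
      exact mul_le_mul (fejer_le _ _) (bd _ _) (abs_nonneg _) (by positivity)
    have h1 : ∀ x, |f x - p x| ≤ ∫ y, fejer H y * |f (x + y) - f x| ∂unitMeasure := by
      intro x
      have e : p x - f x = ∫ y, fejer H y * (f (x + y) - f x) ∂unitMeasure := by
        simp_rw [mul_sub]
        rw [integral_sub (i2 x) (i1.mul_const _), integral_mul_const, integral_fejer hH, one_mul]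
      rw [abs_sub_comm, e]
      refine abs_integral_le_integral_abs.trans (le_of_eq ?_)
      refine integral_congr_ae (ae_of_all _ fun y => ?_)
      simp only [abs_mul, abs_of_nonneg (fejer_nonneg H y)]
    calc ∫ x, |f x - p x| ∂unitMeasure
        ≤ ∫ x, ∫ y, fejer H y * |f (x + y) - f x| ∂unitMeasure ∂unitMeasure := by
          refine integral_mono_of_nonneg (ae_of_all _ fun x => abs_nonneg _) ?_ (ae_of_all _ h1)
          exact i4.integral_prod_left
      _ = ∫ y, fejer H y * ∫ x, |f (x + y) - f x| ∂unitMeasure ∂unitMeasure := by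
          rw [integral_integral_swap i4]
          simp_rw [integral_const_mul]
      -- The `L¹` modulus of `f` at `y` is at most `C min(y, 1 - y)`, hence at most `C / 4` times
      -- the chord `|1 - ez y|`.
      _ ≤ ∫ y, C / 4 * (fejer H y * ‖1 - ez y‖) ∂unitMeasure := by
          refine integral_mono_of_nonneg (ae_of_all _ fun y => mul_nonneg (fejer_nonneg _ _)
            (integral_nonneg fun x => abs_nonneg _)) ?_ ?_
          · refine Integrable.const_mul (integrable_of_abs_le (by fun_prop) (B := H * 2)
              fun y => ?_) _
            rw [abs_mul, abs_norm, abs_of_nonneg (fejer_nonneg _ _)]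
            exact mul_le_mul (fejer_le _ _) ((norm_sub_le _ _).trans (by simp; norm_num))
              (norm_nonneg _) (by positivity)
          · refine (ae_restrict_iff' measurableSet_Ioc).2 (ae_of_all _ fun y hy => ?_)
            have := hC y hy.1.le hy.2
            have h4 := four_mul_le_norm_one_sub_ez hy.1.le hy.2
            have : ∫ x, |f (x + y) - f x| ∂unitMeasure ≤ C / 4 * ‖1 - ez y‖ := by
              nlinarith
            calc _ ≤ _ := mul_le_mul_of_nonneg_left this (fejer_nonneg _ _)
              _ = _ := by ring
      _ = C / 4 * ∫ y, fejer H y * ‖1 - ez y‖ ∂unitMeasure := integral_const_mul _ _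
      _ ≤ C / 4 * (2 / √H) := mul_le_mul_of_nonneg_left (integral_fejer_mul_norm_le hH)
          (by positivity)
      _ ≤ _ := by
          have : 0 ≤ C / √H := by positivity
          have e : C / 4 * (2 / √H) = C / √H / 2 := by ring
          linarith

/-! ### Dissociated integers and moments. -/

/-- There are no nontrivial linear relations of length at most `m` with coefficients at most `H`
between the integers `n i`. -/
def IsDissociated {ι : Type*} [DecidableEq ι] (n : ι → ℤ) (m H : ℕ) : Prop :=
  ∀ r ≤ m, ∀ (g : Fin r → ι) (h : Fin r → ℤ), (∀ j, |h j| ≤ H) → ∑ j, h j * n (g j) = 0 →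
    ∀ i, ∑ j with g j = i, h j = 0

/-- The product of copies of the unit interval. -/
abbrev iidMeasure (ι : Type*) [Fintype ι] : Measure (ι → ℝ) := Measure.pi fun _ => unitMeasure

lemma integral_prod_ez {ι : Type*} (n : ι → ℤ) {r : ℕ} (g : Fin r → ι) (h : Fin r → ℤ) :
    ∫ x, ∏ j, ez (h j * (n (g j) * x)) ∂unitMeasure =
      if ∑ j, h j * n (g j) = 0 then 1 else 0 := by
  rw [← integral_ez]
  refine integral_congr_ae (ae_of_all _ fun x => ?_)
  simp only
  rw [← ez_sum]; congr 1; push_cast; rw [Finset.sum_mul]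
  exact Finset.sum_congr rfl fun j _ => by ring

/-- Independence splits the mean over coordinates, and each coordinate demands that its own total
frequency vanish. For dilates of one variable only the combined frequency has to vanish;
dissociation is what makes the two conditions equivalent. -/
lemma integral_prod_ez_iid {ι : Type*} [Fintype ι] [DecidableEq ι] {r : ℕ} (g : Fin r → ι) (h : Fin r → ℤ) :
    ∫ u, ∏ j, ez (h j * u (g j)) ∂iidMeasure ι =
      if ∀ i, ∑ j with g j = i, h j = 0 then 1 else 0 := by
  have h1 : ∀ u : ι → ℝ, ∏ j, ez (h j * u (g j)) =
      ∏ i, ez ((∑ j with g j = i, h j : ℤ) * u i) := by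
    intro u
    rw [← ez_sum, ← ez_sum]; congr 1
    rw [← Finset.sum_fiberwise (s := Finset.univ) (g := g)]
    refine Finset.sum_congr rfl fun i _ => ?_
    push_cast; rw [Finset.sum_mul]
    refine Finset.sum_congr rfl fun j hj => ?_
    rw [(Finset.mem_filter.1 hj).2]
  simp_rw [h1]
  rw [integral_fintype_prod_eq_prod (μ := fun _ : ι => unitMeasure)
    (f := fun i v => ez ((∑ j with g j = i, h j : ℤ) * v))]
  simp_rw [integral_ez]
  rw [Finset.prod_ite_zero]
  simp

lemma complex_pow_expand {ι : Type*} [Fintype ι] {s : Finset (ℕ × ℕ)} {h : ℕ × ℕ → ℤ} {w : ℕ × ℕ → ℂ} {p : ℝ → ℝ}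
    (hp : ∀ x, (p x : ℂ) = ∑ k ∈ s, w k * ez (h k * x)) (c : ι → ℝ) (r : ℕ) (y : ι → ℝ) :
    (((∑ i, c i * p (y i)) ^ r : ℝ) : ℂ) =
      ∑ a ∈ Fintype.piFinset fun _ : Fin r => (Finset.univ : Finset ι) ×ˢ s,
        (∏ j, (c (a j).1 * w (a j).2)) * ∏ j, ez (h (a j).2 * y (a j).1) := by
  have h1 : ((∑ i, c i * p (y i) : ℝ) : ℂ) = ∑ a ∈ (Finset.univ : Finset ι) ×ˢ s,
      (c a.1 * w a.2) * ez (h a.2 * y a.1) := by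
    push_cast
    rw [Finset.sum_product]
    refine Finset.sum_congr rfl fun i _ => ?_
    rw [hp, Finset.mul_sum]
    exact Finset.sum_congr rfl fun k _ => by ring
  rw [Complex.ofReal_pow, h1]
  have h2 := Finset.prod_univ_sum (fun _ : Fin r => (Finset.univ : Finset ι) ×ˢ s)
    (fun _ a => ((c a.1 : ℂ) * w a.2) * ez (h a.2 * y a.1))
  rw [Finset.prod_const, Finset.card_univ, Fintype.card_fin] at h2
  rw [h2]
  exact Finset.sum_congr rfl fun a _ => Finset.prod_mul_distrib

/-- Under dissociativity, the moments of weighted sums of dilates agree with those of independent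
copies. -/
theorem IsDissociated.integral_pow_eq {ι : Type*} [Fintype ι] [DecidableEq ι] {n : ι → ℤ} {m H : ℕ} (hn : IsDissociated n m H)
    {p : ℝ → ℝ} (hp : IsTrigPoly H p) (c : ι → ℝ) {r : ℕ} (hr : r ≤ m) :
    ∫ x, (∑ i, c i * p (n i * x)) ^ r ∂unitMeasure =
      ∫ u, (∑ i, c i * p (u i)) ^ r ∂iidMeasure ι := by
  obtain ⟨s, h, w, hs, hw⟩ := hp
  have key : ((∫ x, (∑ i, c i * p (n i * x)) ^ r ∂unitMeasure : ℝ) : ℂ) =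
      ((∫ u, (∑ i, c i * p (u i)) ^ r ∂iidMeasure ι : ℝ) : ℂ) := by
    rw [← integral_complex_ofReal, ← integral_complex_ofReal]
    simp_rw [complex_pow_expand hw]
    rw [integral_finsetSum, integral_finsetSum]
    · refine Finset.sum_congr rfl fun a ha => ?_
      rw [integral_const_mul, integral_const_mul]
      have e1 := integral_prod_ez n (fun j => (a j).1) (fun j => h (a j).2)
      have e2 := integral_prod_ez_iid (fun j => (a j).1) (fun j => h (a j).2)
      rw [e1, e2]
      congr 1
      -- Dissociation is needed for the forward implication only; the converse groups the terms by
      -- index.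
      have : (∑ j, h (a j).2 * n (a j).1 = 0) ↔
          ∀ i, ∑ j with (a j).1 = i, h (a j).2 = 0 := by
        constructor
        · intro h0
          refine hn r hr (fun j => (a j).1) (fun j => h (a j).2) (fun j => hs _ ?_) h0
          have := Fintype.mem_piFinset.1 ha j
          exact (Finset.mem_product.1 this).2
        · intro h0
          rw [← Finset.sum_fiberwise (s := Finset.univ) (g := fun j => (a j).1)]
          refine Finset.sum_eq_zero fun i _ => ?_
          have : ∑ j with (a j).1 = i, h (a j).2 * n (a j).1 =
              ∑ j with (a j).1 = i, h (a j).2 * n i :=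
            Finset.sum_congr rfl fun j hj => by rw [(Finset.mem_filter.1 hj).2]
          rw [this, ← Finset.sum_mul, h0 i, zero_mul]
      simp only [this]
    · intro a _
      have hmeas : Measurable fun u : ι → ℝ => ∏ j, ez (h (a j).2 * u (a j).1) :=
        Finset.measurable_fun_prod _ fun j _ => by fun_prop
      refine Integrable.const_mul (Integrable.of_bound hmeas.aestronglyMeasurable 1
        (ae_of_all _ fun u => ?_)) _
      rw [norm_prod]; simp
    · intro a _
      refine Integrable.const_mul (Integrable.of_bound (by fun_prop) 1 (ae_of_all _ fun u => ?_)) _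
      rw [norm_prod]; simp
  exact_mod_cast key

/-! ### Elementary inequalities for the exponential function -/

open Complex in
-- Induction on the order: the derivative of one Taylor remainder is `I` times the preceding
-- remainder, so integrating the bound raises the order by one.
lemma norm_exp_I_sub_sum_le_of_nonneg (m : ℕ) : ∀ u : ℝ, 0 ≤ u →
    ‖cexp (u * I) - ∑ j ∈ Finset.range m, (u * I) ^ j / (j.factorial : ℂ)‖ ≤
      u ^ m / m.factorial := by
  induction m with
  | zero => intro u _; simp [Complex.norm_exp_ofReal_mul_I]
  | succ m ih =>
    intro u hu
    have hd : ∀ x : ℝ, HasDerivAt (fun x : ℝ => cexp (x * I) -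
        ∑ j ∈ Finset.range (m + 1), (x * I) ^ j / (j.factorial : ℂ))
        (I * (cexp (x * I) - ∑ j ∈ Finset.range m, (x * I) ^ j / (j.factorial : ℂ))) x := by
      intro x
      have hx : HasDerivAt (fun x : ℝ => (x : ℂ) * I) I x := by
        simpa using (Complex.ofRealCLM.hasDerivAt (x := x)).mul_const I
      have h1 : HasDerivAt (fun x : ℝ => cexp (x * I)) (cexp (x * I) * I) x := hx.cexp
      have h2 : HasDerivAt (fun x : ℝ => ∑ j ∈ Finset.range (m + 1),
          ((x : ℂ) * I) ^ j / (j.factorial : ℂ))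
          (∑ j ∈ Finset.range (m + 1), (j * ((x : ℂ) * I) ^ (j - 1) * I) / (j.factorial : ℂ)) x :=
        HasDerivAt.fun_sum fun j _ => (hx.fun_pow j).div_const _
      convert! h1.sub h2 using 1
      rw [Finset.sum_range_succ', mul_sub, mul_comm I]
      congr 1
      simp only [Nat.cast_zero, zero_mul, zero_div, add_zero, Finset.mul_sum]
      refine Finset.sum_congr rfl fun j _ => ?_
      rw [Nat.factorial_succ, Nat.add_sub_cancel]
      have h3 : (j.factorial : ℂ) ≠ 0 := by exact_mod_cast j.factorial_ne_zero
      have h4 : ((j : ℂ) + 1) ≠ 0 := by exact_mod_cast j.succ_ne_zero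
      push_cast
      field_simp
    have hB : ∀ x : ℝ, HasDerivAt (fun x : ℝ => x ^ (m + 1) / ((m + 1).factorial : ℝ))
        (x ^ m / m.factorial) x := by
      intro x
      have h1 := ((hasDerivAt_id x).fun_pow (m + 1)).div_const ((m + 1).factorial : ℝ)
      convert! h1 using 1
      rw [Nat.factorial_succ]
      have h3 : (m.factorial : ℝ) ≠ 0 := by exact_mod_cast m.factorial_ne_zero
      have h4 : ((m : ℝ) + 1) ≠ 0 := by exact_mod_cast m.succ_ne_zero
      push_cast; simp; field_simp
    refine image_norm_le_of_norm_deriv_right_le_deriv_boundary (a := 0) (b := u)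
      (fun x _ => (hd x).continuousAt.continuousWithinAt)
      (fun x _ => (hd x).hasDerivWithinAt) ?_ hB ?_ ⟨hu, le_rfl⟩
    · rw [Finset.sum_range_succ']; simp
    · intro x hx
      rw [norm_mul, Complex.norm_I, one_mul]
      exact ih x hx.1

open Complex in
lemma norm_exp_I_sub_sum_le (m : ℕ) (u : ℝ) :
    ‖cexp (u * I) - ∑ j ∈ Finset.range m, (u * I) ^ j / (j.factorial : ℂ)‖ ≤
      |u| ^ m / m.factorial := by
  rcases le_total 0 u with hu | hu
  · rw [abs_of_nonneg hu]; exact norm_exp_I_sub_sum_le_of_nonneg m u hu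
  · have h := norm_exp_I_sub_sum_le_of_nonneg m (-u) (by linarith)
    rw [abs_of_nonpos hu]
    rw [← Complex.norm_conj] at h
    refine le_trans (le_of_eq ?_) h
    congr 1
    simp only [map_sub, map_sum, map_div₀, map_pow, map_mul, ← Complex.exp_conj, Complex.conj_ofReal,
      Complex.conj_I, Complex.conj_natCast]
    simp

/-- One term of a series of nonnegative terms. It converts exponential moments of both signs into
even moments. -/
lemma pow_le_factorial_mul_cosh (r : ℕ) (u : ℝ) : u ^ (2 * r) ≤ (2 * r).factorial * Real.cosh u := by
  have h := (Real.hasSum_cosh u)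
  have h1 : u ^ (2 * r) / ((2 * r).factorial : ℝ) ≤ Real.cosh u := by
    refine le_hasSum h r fun j _ => ?_
    have : 0 ≤ u ^ (2 * j) := (even_two_mul j).pow_nonneg u
    positivity
  rw [div_le_iff₀ (by positivity)] at h1
  linarith

lemma abs_exp_neg_sub_le {x : ℝ} (hx : 0 ≤ x) : |Real.exp (-x) - (1 - x)| ≤ x ^ 2 := by
  have h1 := Real.add_one_le_exp (-x)
  rw [abs_of_nonneg (by linarith)]
  have h2 := Real.add_one_le_exp x
  have h3 : Real.exp (-x) ≤ 1 / (x + 1) := by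
    rw [Real.exp_neg, ← one_div]
    exact one_div_le_one_div_of_le (by linarith) h2
  have h4 : 1 / (x + 1) - (1 - x) ≤ x ^ 2 := by
    rw [div_sub' (by linarith), div_le_iff₀ (by linarith)]
    nlinarith [pow_nonneg hx 3]
  linarith

lemma exp_le_quadratic {u : ℝ} (hu : |u| ≤ 1) : Real.exp u ≤ 1 + u + u ^ 2 / 2 + |u| ^ 3 := by
  have h := Real.exp_bound hu (n := 3) (by norm_num)
  have h1 := (abs_le.1 h).2
  simp [Finset.sum_range_succ, Nat.factorial] at h1
  have : 0 ≤ |u| ^ 3 := by positivity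
  linarith

lemma norm_prod_sub_prod_le {ι : Type*} (s : Finset ι) (a b : ι → ℂ) (ha : ∀ i ∈ s, ‖a i‖ ≤ 1)
    (hb : ∀ i ∈ s, ‖b i‖ ≤ 1) : ‖∏ i ∈ s, a i - ∏ i ∈ s, b i‖ ≤ ∑ i ∈ s, ‖a i - b i‖ := by
  classical
  induction s using Finset.induction_on with
  | empty => simp
  | insert i s hi ih =>
    rw [Finset.prod_insert hi, Finset.prod_insert hi, Finset.sum_insert hi]
    have e : a i * ∏ j ∈ s, a j - b i * ∏ j ∈ s, b j =
        (a i - b i) * ∏ j ∈ s, a j + b i * (∏ j ∈ s, a j - ∏ j ∈ s, b j) := by ring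
    rw [e]
    have h1 : ‖∏ j ∈ s, a j‖ ≤ 1 := by
      rw [norm_prod]
      exact Finset.prod_le_one (fun _ _ => norm_nonneg _)
        fun j hj => ha j (Finset.mem_insert_of_mem hj)
    have h2 := ih (fun j hj => ha j (Finset.mem_insert_of_mem hj))
      (fun j hj => hb j (Finset.mem_insert_of_mem hj))
    have h3 := hb i (Finset.mem_insert_self _ _)
    refine (norm_add_le _ _).trans ?_
    rw [norm_mul, norm_mul]
    have h4 := norm_nonneg (a i - b i)
    have h5 := norm_nonneg (∏ j ∈ s, a j - ∏ j ∈ s, b j)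
    have h6 := norm_nonneg (b i)
    nlinarith

/-- Taylor expansion of the characteristic function of a bounded random variable. -/
lemma norm_integral_exp_sub_sum_le {α : Type*} [MeasurableSpace α] (μ : Measure α)
    [IsProbabilityMeasure μ] {X : α → ℝ} (hX : Measurable X) {K : ℝ} (hXb : ∀ a, |X a| ≤ K)
    (r : ℕ) :
    ‖∫ a, Complex.exp (X a * Complex.I) ∂μ -
      ∑ j ∈ Finset.range (2 * r), Complex.I ^ j / (j.factorial : ℂ) * ((∫ a, X a ^ j ∂μ : ℝ) : ℂ)‖
    ≤ (∫ a, X a ^ (2 * r) ∂μ) / (2 * r).factorial := by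
  have ipow : ∀ j, Integrable (fun a => X a ^ j) μ := fun j =>
    integrable_of_abs_le (by fun_prop) (B := K ^ j) fun u => by
      rw [abs_pow]; exact pow_le_pow_left₀ (abs_nonneg _) (hXb u) _
  have e1 : ∑ j ∈ Finset.range (2 * r), Complex.I ^ j / (j.factorial : ℂ) *
      ((∫ a, X a ^ j ∂μ : ℝ) : ℂ) = ∫ a, ∑ j ∈ Finset.range (2 * r), (X a * Complex.I) ^ j / (j.factorial : ℂ) ∂μ := by
    rw [integral_finsetSum]
    · refine Finset.sum_congr rfl fun j _ => ?_
      rw [← integral_complex_ofReal, ← integral_const_mul]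
      refine integral_congr_ae (ae_of_all _ fun a => ?_)
      simp only; push_cast; ring
    · intro j _
      have := ((ipow j).ofReal (𝕜 := ℂ)).const_mul (Complex.I ^ j / (j.factorial : ℂ))
      refine this.congr (ae_of_all _ fun a => ?_)
      simp only [Complex.coe_algebraMap]; push_cast; ring
  have iT : Integrable (fun a => ∑ j ∈ Finset.range (2 * r),
      (X a * Complex.I) ^ j / (j.factorial : ℂ)) μ := by
    refine integrable_finsetSum _ fun j _ => ?_
    have := ((ipow j).ofReal (𝕜 := ℂ)).const_mul (Complex.I ^ j / (j.factorial : ℂ))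
    refine this.congr (ae_of_all _ fun a => ?_)
    simp only [Complex.coe_algebraMap]; push_cast; ring
  have iE : Integrable (fun a => Complex.exp (X a * Complex.I)) μ :=
    Integrable.of_bound (by fun_prop) 1 (ae_of_all _ fun a => by
      rw [Complex.norm_exp_ofReal_mul_I])
  rw [e1, ← integral_sub iE iT, ← integral_div]
  refine norm_integral_le_of_norm_le ((ipow _).div_const _) (ae_of_all _ fun a => ?_)
  have := norm_exp_I_sub_sum_le (2 * r) (X a)
  rwa [(even_two_mul r).pow_abs] at this

/-! ### Weighted sums whose moments match those of independent copies -/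

/-- Weighted sums of the dilates `p (n i x)` have the same moments of order at most `m` as weighted
sums of independent copies of `p`, a centred function with bound `B` and variance `v`. -/
structure MomentsMatch {ι : Type*} [Fintype ι] (n : ι → ℤ) (p : ℝ → ℝ) (m : ℕ) (B v : ℝ) : Prop where
  measurable : Measurable p
  one_le : 1 ≤ B
  abs_le : ∀ x, |p x| ≤ B
  integral_eq_zero : ∫ x, p x ∂unitMeasure = 0
  integral_sq : ∫ x, p x ^ 2 ∂unitMeasure = v
  integral_pow : ∀ r ≤ m, ∀ c : ι → ℝ, ∫ x, (∑ i, c i * p (n i * x)) ^ r ∂unitMeasure =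
    ∫ u, (∑ i, c i * p (u i)) ^ r ∂iidMeasure ι

namespace MomentsMatch

variable {ι : Type*} [Fintype ι] {n : ι → ℤ} {p : ℝ → ℝ} {m : ℕ} {B v : ℝ}

lemma variance_nonneg (h : MomentsMatch n p m B v) : 0 ≤ v := by
  rw [← h.integral_sq]; exact integral_nonneg fun x => sq_nonneg _

lemma variance_le (h : MomentsMatch n p m B v) : v ≤ B ^ 2 := by
  rw [← h.integral_sq]
  have hm := h.measurable
  have := integral_mono (μ := unitMeasure) (f := fun x => p x ^ 2) (g := fun _ => B ^ 2)
    (integrable_of_abs_le (by fun_prop) (B := B ^ 2) fun x => by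
      rw [abs_pow]; exact pow_le_pow_left₀ (abs_nonneg _) (h.abs_le x) 2) (by simp)
    fun x => by simpa using sq_le_sq' (_root_.abs_le.1 (h.abs_le x)).1 (_root_.abs_le.1 (h.abs_le x)).2
  simpa using this

/-- Hoeffding's lemma: the crude variance proxy `B ^ 2`, valid for every `t`. -/
lemma integral_exp_le (h : MomentsMatch n p m B v) (t : ℝ) :
    ∫ x, Real.exp (t * p x) ∂unitMeasure ≤ Real.exp (t ^ 2 * B ^ 2 / 2) := by
  have hB : 0 ≤ B := zero_le_one.trans h.one_le
  have h1 := (hasSubgaussianMGF_of_mem_Icc_of_integral_eq_zero (μ := unitMeasure) (a := -B) (b := B)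
    h.measurable.aemeasurable (ae_of_all _ fun x => _root_.abs_le.1 (h.abs_le x))
    h.integral_eq_zero).mgf_le t
  rw [mgf] at h1
  refine h1.trans (Real.exp_le_exp.2 (le_of_eq ?_))
  have : ((‖B - -B‖₊ : NNReal) : ℝ) = 2 * B := by
    rw [coe_nnnorm, Real.norm_eq_abs, abs_of_nonneg (by linarith)]; ring
  push_cast
  rw [coe_nnnorm] at this
  rw [this]; ring

/-- The linear term of the expansion vanishes because `p` is centred. Keeping the true variance `v`
in place of `B ^ 2` is what yields the exact constant in the law of the iterated logarithm, at the
price of small `t`. -/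
lemma integral_exp_le' (h : MomentsMatch n p m B v) {t : ℝ} (ht : |t| * B ≤ 1) :
    ∫ x, Real.exp (t * p x) ∂unitMeasure ≤ Real.exp (t ^ 2 * v / 2 + |t| ^ 3 * B ^ 3) := by
  have hm := h.measurable
  have hb : ∀ x, |t * p x| ≤ |t| * B := fun x => by
    rw [abs_mul]; exact mul_le_mul_of_nonneg_left (h.abs_le x) (abs_nonneg _)
  have key : ∀ x, Real.exp (t * p x) ≤ 1 + t * p x + t ^ 2 / 2 * p x ^ 2 + |t| ^ 3 * B ^ 3 := by
    intro x
    have h1 := exp_le_quadratic ((hb x).trans ht)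
    have h2 : |t * p x| ^ 3 ≤ |t| ^ 3 * B ^ 3 := by
      rw [← mul_pow]; exact pow_le_pow_left₀ (abs_nonneg _) (hb x) 3
    have h3 : (t * p x) ^ 2 / 2 = t ^ 2 / 2 * p x ^ 2 := by ring
    linarith
  have i1 : Integrable p unitMeasure := integrable_of_abs_le hm h.abs_le
  have i2 : Integrable (fun x => p x ^ 2) unitMeasure :=
    integrable_of_abs_le (by fun_prop) (B := B ^ 2) fun x => by
      rw [abs_pow]; exact pow_le_pow_left₀ (abs_nonneg _) (h.abs_le x) 2
  have i3 : Integrable (fun x => Real.exp (t * p x)) unitMeasure :=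
    integrable_of_abs_le (by fun_prop) (B := Real.exp (|t| * B)) fun x => by
      rw [abs_of_pos (Real.exp_pos _)]
      exact Real.exp_le_exp.2 ((le_abs_self _).trans (hb x))
  have j1 : Integrable (fun x => 1 + t * p x) unitMeasure :=
    (integrable_const (1 : ℝ)).add (i1.const_mul t)
  have j2 : Integrable (fun x => 1 + t * p x + t ^ 2 / 2 * p x ^ 2) unitMeasure :=
    j1.add (i2.const_mul (t ^ 2 / 2))
  have h4 := integral_mono i3 (j2.add (integrable_const (|t| ^ 3 * B ^ 3))) key
  have h5 : ∫ x, (1 + t * p x + t ^ 2 / 2 * p x ^ 2 + |t| ^ 3 * B ^ 3) ∂unitMeasure =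
      1 + (t ^ 2 * v / 2 + |t| ^ 3 * B ^ 3) := by
    rw [integral_add j2 (integrable_const _), integral_add j1 (i2.const_mul (t ^ 2 / 2)),
      integral_add (integrable_const (1 : ℝ)) (i1.const_mul t), integral_const_mul,
      integral_const_mul, h.integral_eq_zero, h.integral_sq]
    simp; ring
  have h6 := Real.add_one_le_exp (t ^ 2 * v / 2 + |t| ^ 3 * B ^ 3)
  refine h4.trans (le_of_eq_of_le h5 (by linarith))

lemma integral_exp_sum (_h : MomentsMatch n p m B v) (c : ι → ℝ) (s : ℝ) :
    ∫ u, Real.exp (s * ∑ i, c i * p (u i)) ∂iidMeasure ι =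
      ∏ i, ∫ x, Real.exp (s * c i * p x) ∂unitMeasure := by
  rw [← integral_fintype_prod_eq_prod (μ := fun _ : ι => unitMeasure)
    (f := fun i x => Real.exp (s * c i * p x))]
  refine integral_congr_ae (ae_of_all _ fun u => ?_)
  simp only [← Real.exp_sum, Finset.mul_sum, mul_assoc]

lemma measurable_sum (h : MomentsMatch n p m B v) (c : ι → ℝ) :
    Measurable fun u : ι → ℝ => ∑ i, c i * p (u i) := by
  have := h.measurable
  exact Finset.measurable_fun_sum _ fun i _ => by fun_prop

lemma measurable_sum_dilate (h : MomentsMatch n p m B v) (c : ι → ℝ) :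
    Measurable fun x : ℝ => ∑ i, c i * p (n i * x) := by
  have := h.measurable
  exact Finset.measurable_fun_sum _ fun i _ => by fun_prop

lemma abs_sum_le (h : MomentsMatch n p m B v) (c : ι → ℝ) (u : ι → ℝ) :
    |∑ i, c i * p (u i)| ≤ (∑ i, |c i|) * B := by
  refine (Finset.abs_sum_le_sum_abs _ _).trans ?_
  rw [Finset.sum_mul]
  refine Finset.sum_le_sum fun i _ => ?_
  rw [abs_mul]
  exact mul_le_mul_of_nonneg_left (h.abs_le _) (abs_nonneg _)

/-- Moments are controlled by any bound for the moment generating function of the independent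
model. -/
lemma integral_pow_le_of_mgf (h : MomentsMatch n p m B v) (c : ι → ℝ) {r : ℕ} (hr : 2 * r ≤ m)
    {s E : ℝ} (hs : 0 < s)
    (h1 : ∫ u, Real.exp (s * ∑ i, c i * p (u i)) ∂iidMeasure ι ≤ E)
    (h2 : ∫ u, Real.exp (-s * ∑ i, c i * p (u i)) ∂iidMeasure ι ≤ E) :
    ∫ x, (∑ i, c i * p (n i * x)) ^ (2 * r) ∂unitMeasure ≤ (2 * r).factorial / s ^ (2 * r) * E := by
  rw [h.integral_pow _ hr]
  have hm := h.measurable_sum c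
  have hb := h.abs_sum_le c
  have ie : ∀ t : ℝ, Integrable (fun u => Real.exp (t * ∑ i, c i * p (u i))) (iidMeasure ι) :=
    fun t => integrable_of_abs_le (by fun_prop) (B := Real.exp (|t| * ((∑ i, |c i|) * B))) fun u => by
      rw [abs_of_pos (Real.exp_pos _)]
      refine Real.exp_le_exp.2 ((le_abs_self _).trans ?_)
      rw [abs_mul]; exact mul_le_mul_of_nonneg_left (hb u) (abs_nonneg _)
  have key : ∀ u : ι → ℝ, (∑ i, c i * p (u i)) ^ (2 * r) ≤ (2 * r).factorial / s ^ (2 * r) *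
      ((Real.exp (s * ∑ i, c i * p (u i)) + Real.exp (-s * ∑ i, c i * p (u i))) / 2) := by
    intro u
    have h3 := pow_le_factorial_mul_cosh r (s * ∑ i, c i * p (u i))
    rw [Real.cosh_eq, mul_pow, ← neg_mul] at h3
    rw [div_mul_eq_mul_div, le_div_iff₀ (by positivity)]
    linarith
  have ia : Integrable (fun u => Real.exp (s * ∑ i, c i * p (u i)) +
      Real.exp (-s * ∑ i, c i * p (u i))) (iidMeasure ι) := (ie s).add (ie (-s))
  refine (integral_mono ?_ ((ia.div_const 2).const_mul _) key).trans ?_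
  · refine integrable_of_abs_le (by fun_prop) (B := ((∑ i, |c i|) * B) ^ (2 * r)) fun u => ?_
    rw [abs_pow]; exact pow_le_pow_left₀ (abs_nonneg _) (hb u) _
  · rw [integral_const_mul, integral_div, integral_add (ie _) (ie _)]
    refine mul_le_mul_of_nonneg_left ?_ (by positivity)
    linarith

lemma integral_pow_le (h : MomentsMatch n p m B v) (c : ι → ℝ) {r : ℕ} (hr : 2 * r ≤ m)
    {s : ℝ} (hs : 0 < s) : ∫ x, (∑ i, c i * p (n i * x)) ^ (2 * r) ∂unitMeasure ≤
      (2 * r).factorial / s ^ (2 * r) * Real.exp (s ^ 2 * B ^ 2 * (∑ i, c i ^ 2) / 2) := by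
  have key : ∀ t : ℝ, t ^ 2 = s ^ 2 → ∫ u, Real.exp (t * ∑ i, c i * p (u i)) ∂iidMeasure ι ≤
      Real.exp (s ^ 2 * B ^ 2 * (∑ i, c i ^ 2) / 2) := by
    intro t ht
    rw [h.integral_exp_sum]
    have : s ^ 2 * B ^ 2 * (∑ i, c i ^ 2) / 2 = ∑ i, (t * c i) ^ 2 * B ^ 2 / 2 := by
      rw [← Finset.sum_div, Finset.mul_sum]; congr 1
      exact Finset.sum_congr rfl fun i _ => by rw [mul_pow, ht]; ring
    rw [this, Real.exp_sum]
    exact Finset.prod_le_prod (fun i _ => integral_nonneg fun x => (Real.exp_pos _).le)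
      fun i _ => h.integral_exp_le _
  exact h.integral_pow_le_of_mgf c hr hs (key s rfl) (key (-s) (by ring))

/-- Sharp form of the moment bound, for weights bounded by `1` in absolute value. -/
lemma integral_pow_le_sharp (h : MomentsMatch n p m B v) (c : ι → ℝ) (hc : ∀ i, |c i| ≤ 1)
    {r : ℕ} (hr : 2 * r ≤ m) {s : ℝ} (hs : 0 < s) (hsB : s * B ≤ 1) :
    ∫ x, (∑ i, c i * p (n i * x)) ^ (2 * r) ∂unitMeasure ≤
      (2 * r).factorial / s ^ (2 * r) *
        Real.exp ((∑ i, c i ^ 2) * (s ^ 2 * v / 2 + s ^ 3 * B ^ 3)) := by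
  have hB : 0 ≤ B := zero_le_one.trans h.one_le
  have key : ∀ t : ℝ, |t| = s → ∫ u, Real.exp (t * ∑ i, c i * p (u i)) ∂iidMeasure ι ≤
      Real.exp ((∑ i, c i ^ 2) * (s ^ 2 * v / 2 + s ^ 3 * B ^ 3)) := by
    intro t ht
    rw [h.integral_exp_sum]
    rw [Finset.sum_mul, Real.exp_sum]
    refine Finset.prod_le_prod (fun i _ => integral_nonneg fun x => (Real.exp_pos _).le)
      fun i _ => (h.integral_exp_le' ?_).trans (Real.exp_le_exp.2 ?_)
    · rw [abs_mul, ht]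
      calc s * |c i| * B ≤ s * 1 * B := by gcongr; exact hc i
        _ ≤ 1 := by linarith
    · have e1 : (t * c i) ^ 2 = s ^ 2 * c i ^ 2 := by rw [mul_pow, ← sq_abs t, ht]
      have e2 : |t * c i| ^ 3 ≤ s ^ 3 * c i ^ 2 := by
        rw [abs_mul, ht, mul_pow]
        refine mul_le_mul_of_nonneg_left ?_ (by positivity)
        rw [← sq_abs (c i)]
        exact pow_le_pow_of_le_one (abs_nonneg _) (hc i) (by norm_num)
      rw [e1]
      have := mul_le_mul_of_nonneg_right e2 (by positivity : 0 ≤ B ^ 3)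
      linarith
  exact h.integral_pow_le_of_mgf c hr hs (key s (abs_of_pos hs))
    (key (-s) (by rw [abs_neg, abs_of_pos hs]))

/-- This is the Taylor remainder of order `2 r` of the characteristic function; it is small as soon
as `r` is a large multiple of `B ^ 2 Q`. -/
lemma integral_pow_div_factorial_le (h : MomentsMatch n p m B v) (c : ι → ℝ) {r : ℕ} (hr0 : r ≠ 0)
    (hr : 2 * r ≤ m) {Q : ℝ} (hQ : 0 < Q) (hcQ : ∑ i, c i ^ 2 ≤ Q) :
    (∫ x, (∑ i, c i * p (n i * x)) ^ (2 * r) ∂unitMeasure) / (2 * r).factorial ≤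
      (Real.exp 1 * B ^ 2 * Q / (2 * r)) ^ r := by
  have hB : 0 < B := zero_lt_one.trans_le h.one_le
  have hr' : (0 : ℝ) < r := by exact_mod_cast Nat.pos_of_ne_zero hr0
  -- The minimiser of `exp (s² B² Q / 2) / s ^ (2 r)`.
  set s := √(2 * r / (B ^ 2 * Q)) with hs
  have hs0 : 0 < s := Real.sqrt_pos.2 (by positivity)
  have hs2 : s ^ 2 = 2 * r / (B ^ 2 * Q) := Real.sq_sqrt (by positivity)
  have h1 := h.integral_pow_le c hr hs0
  rw [div_le_iff₀ (by positivity)]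
  refine h1.trans ?_
  have h2 : Real.exp (s ^ 2 * B ^ 2 * (∑ i, c i ^ 2) / 2) ≤ Real.exp 1 ^ r := by
    rw [← Real.exp_nat_mul, mul_one]
    refine Real.exp_le_exp.2 ?_
    rw [hs2]
    have : 2 * ↑r / (B ^ 2 * Q) * B ^ 2 * (∑ i, c i ^ 2) / 2 = r * ((∑ i, c i ^ 2) / Q) := by
      field_simp
    rw [this]
    have : (∑ i, c i ^ 2) / Q ≤ 1 := (div_le_one hQ).2 hcQ
    nlinarith
  calc _ ≤ (2 * r).factorial / s ^ (2 * r) * Real.exp 1 ^ r := by gcongr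
    _ = (2 * r).factorial / (2 * r / (B ^ 2 * Q)) ^ r * Real.exp 1 ^ r := by rw [pow_mul, hs2]
    _ = _ := by
      rw [div_pow, div_pow, mul_pow, mul_pow, mul_pow, mul_pow]
      field_simp

/-- Comparison of characteristic functions with the Gaussian one. -/
theorem norm_charFun_sub_le (h : MomentsMatch n p m B v) (c : ι → ℝ) {r : ℕ} (hr0 : r ≠ 0)
    (hr : 2 * r ≤ m) {Q : ℝ} (hQ : 0 < Q) (hcQ : ∑ i, c i ^ 2 ≤ Q) :
    ‖∫ x, Complex.exp ((∑ i, c i * p (n i * x) : ℝ) * Complex.I) ∂unitMeasure -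
        Real.exp (-(v * (∑ i, c i ^ 2) / 2))‖ ≤
      ∑ i, (|c i| ^ 3 * B ^ 3 + c i ^ 4 * B ^ 4) +
        2 * (Real.exp 1 * B ^ 2 * Q / (2 * r)) ^ r := by
  have hB : 0 < B := zero_lt_one.trans_le h.one_le
  have hpm := h.measurable
  have hm1 := h.measurable_sum_dilate c
  have hm2 := h.measurable_sum c
  have hb := h.abs_sum_le c
  have t1 := norm_integral_exp_sub_sum_le unitMeasure hm1 (fun x => hb fun i => n i * x) r
  have t2 := norm_integral_exp_sub_sum_le (iidMeasure ι) hm2 hb r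
  -- The moments agree below order `2 r`, so both characteristic functions have the same Taylor
  -- polynomial; the moment of order `2 r` agrees too, so one bound serves both remainders.
  have hsame : ∀ j ∈ Finset.range (2 * r), Complex.I ^ j / (j.factorial : ℂ) *
      ((∫ x, (∑ i, c i * p (n i * x)) ^ j ∂unitMeasure : ℝ) : ℂ) =
      Complex.I ^ j / (j.factorial : ℂ) *
      ((∫ u, (∑ i, c i * p (u i)) ^ j ∂iidMeasure ι : ℝ) : ℂ) := fun j hj => by
    rw [h.integral_pow j (by have := Finset.mem_range.1 hj; omega)]
  rw [Finset.sum_congr rfl hsame] at t1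
  rw [← h.integral_pow _ hr] at t2
  have t3 := h.integral_pow_div_factorial_le c hr0 hr hQ hcQ
  -- For the independent model the characteristic function is a product. Each factor is compared
  -- with its Gaussian counterpart through the common quadratic `1 - v c_i² / 2`.
  have t4 : ‖∫ u, Complex.exp ((∑ i, c i * p (u i) : ℝ) * Complex.I) ∂iidMeasure ι -
      Real.exp (-(v * (∑ i, c i ^ 2) / 2))‖ ≤ ∑ i, (|c i| ^ 3 * B ^ 3 + c i ^ 4 * B ^ 4) := by
    have e1 : ∫ u, Complex.exp ((∑ i, c i * p (u i) : ℝ) * Complex.I) ∂iidMeasure ι =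
        ∏ i, ∫ x, Complex.exp ((c i * p x : ℝ) * Complex.I) ∂unitMeasure := by
      rw [← integral_fintype_prod_eq_prod (μ := fun _ : ι => unitMeasure)
        (f := fun i x => Complex.exp ((c i * p x : ℝ) * Complex.I))]
      refine integral_congr_ae (ae_of_all _ fun u => ?_)
      simp only [← Complex.exp_sum]; push_cast; rw [Finset.sum_mul]
    have e2 : ((Real.exp (-(v * (∑ i, c i ^ 2) / 2)) : ℝ) : ℂ) =
        ∏ i, ((Real.exp (-(v * c i ^ 2 / 2)) : ℝ) : ℂ) := by
      rw [← Complex.ofReal_prod, ← Real.exp_sum]; congr 2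
      rw [Finset.sum_neg_distrib, ← Finset.sum_div, Finset.mul_sum]
    rw [e1, e2]
    refine (norm_prod_sub_prod_le _ _ _ (fun i _ => ?_) (fun i _ => ?_)).trans
      (Finset.sum_le_sum fun i _ => ?_)
    · refine (norm_integral_le_of_norm_le_const (C := 1) (ae_of_all _ fun x => ?_)).trans (by simp)
      rw [Complex.norm_exp_ofReal_mul_I]
    · rw [Complex.norm_real, Real.norm_of_nonneg (Real.exp_pos _).le]
      have := h.variance_nonneg
      exact Real.exp_le_one_iff.2 (by have : 0 ≤ v * c i ^ 2 / 2 := by positivity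
                                      linarith)
    · have i1 : Integrable (fun x => ((p x : ℝ) : ℂ)) unitMeasure :=
        (integrable_of_abs_le hpm h.abs_le).ofReal
      have i2' : Integrable (fun x => p x ^ 2) unitMeasure :=
        integrable_of_abs_le (by fun_prop) (B := B ^ 2) fun x => by
          rw [abs_pow]; exact pow_le_pow_left₀ (abs_nonneg _) (h.abs_le x) 2
      have i2 : Integrable (fun x => ((p x ^ 2 : ℝ) : ℂ)) unitMeasure := i2'.ofReal
      have iE : Integrable (fun x => Complex.exp ((c i * p x : ℝ) * Complex.I)) unitMeasure :=
        Integrable.of_bound (by fun_prop) 1 (ae_of_all _ fun a => by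
          rw [Complex.norm_exp_ofReal_mul_I])
      have il : Integrable (fun x => 1 + c i * Complex.I * ((p x : ℝ) : ℂ)) unitMeasure :=
        (integrable_const _).add (i1.const_mul _)
      have iq : Integrable (fun x => (1 + c i * Complex.I * ((p x : ℝ) : ℂ) -
          c i ^ 2 / 2 * ((p x ^ 2 : ℝ) : ℂ))) unitMeasure :=
        il.sub (i2.const_mul _)
      have e3 : ∫ x, (1 + c i * Complex.I * ((p x : ℝ) : ℂ) -
          c i ^ 2 / 2 * ((p x ^ 2 : ℝ) : ℂ)) ∂unitMeasure = ((1 - v * c i ^ 2 / 2 : ℝ) : ℂ) := by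
        rw [integral_sub il (i2.const_mul _),
          integral_add (integrable_const _) (i1.const_mul _), integral_const_mul,
          integral_const_mul, integral_complex_ofReal, integral_complex_ofReal, h.integral_eq_zero,
          h.integral_sq]
        simp; ring
      have s1 : ‖∫ x, Complex.exp ((c i * p x : ℝ) * Complex.I) ∂unitMeasure -
          ((1 - v * c i ^ 2 / 2 : ℝ) : ℂ)‖ ≤ |c i| ^ 3 * B ^ 3 := by
        rw [← e3, ← integral_sub iE iq]
        refine (norm_integral_le_of_norm_le_const (C := |c i| ^ 3 * B ^ 3)
          (ae_of_all _ fun x => ?_)).trans (by simp)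
        have h5 := norm_exp_I_sub_sum_le 3 (c i * p x)
        have e4 : ∑ j ∈ Finset.range 3, (((c i * p x : ℝ) : ℂ) * Complex.I) ^ j /
            (j.factorial : ℂ) = 1 + c i * Complex.I * ((p x : ℝ) : ℂ) -
            c i ^ 2 / 2 * ((p x ^ 2 : ℝ) : ℂ) := by
          simp [Finset.sum_range_succ, Nat.factorial, mul_pow]; ring
        rw [e4] at h5
        refine h5.trans ?_
        have h6 : |c i * p x| ^ 3 ≤ |c i| ^ 3 * B ^ 3 := by
          rw [abs_mul, mul_pow]
          have := pow_le_pow_left₀ (abs_nonneg _) (h.abs_le x) 3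
          gcongr
        have h7 : (0 : ℝ) ≤ |c i * p x| ^ 3 := by positivity
        refine (div_le_self h7 ?_).trans h6
        norm_num [Nat.factorial]
      have s2 : ‖((1 - v * c i ^ 2 / 2 : ℝ) : ℂ) - ((Real.exp (-(v * c i ^ 2 / 2)) : ℝ) : ℂ)‖ ≤
          c i ^ 4 * B ^ 4 := by
        have hv := h.variance_nonneg
        have hvB := h.variance_le
        rw [← Complex.ofReal_sub, Complex.norm_real, Real.norm_eq_abs, abs_sub_comm]
        refine (abs_exp_neg_sub_le (by positivity)).trans ?_
        have : v * c i ^ 2 / 2 ≤ B ^ 2 * c i ^ 2 := by nlinarith [sq_nonneg (c i)]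
        calc (v * c i ^ 2 / 2) ^ 2 ≤ (B ^ 2 * c i ^ 2) ^ 2 :=
              pow_le_pow_left₀ (by positivity) this 2
          _ = _ := by ring
      calc _ ≤ _ := norm_sub_le_norm_sub_add_norm_sub _ ((1 - v * c i ^ 2 / 2 : ℝ) : ℂ) _
        _ ≤ _ := add_le_add s1 s2
  set M := ∑ j ∈ Finset.range (2 * r), Complex.I ^ j / (j.factorial : ℂ) *
      ((∫ u, (∑ i, c i * p (u i)) ^ j ∂iidMeasure ι : ℝ) : ℂ)
  set φ := ∫ x, Complex.exp ((∑ i, c i * p (n i * x) : ℝ) * Complex.I) ∂unitMeasure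
  set ψ := ∫ u, Complex.exp ((∑ i, c i * p (u i) : ℝ) * Complex.I) ∂iidMeasure ι
  set G := ((Real.exp (-(v * (∑ i, c i ^ 2) / 2)) : ℝ) : ℂ)
  have e : φ - G = (φ - M) - (ψ - M) + (ψ - G) := by ring
  rw [e]
  refine (norm_add_le _ _).trans ?_
  have := norm_sub_le (φ - M) (ψ - M)
  linarith

end MomentsMatch

/-! ### From absence of relations to dissociation. -/

/-- For large `k`, no linear relation of length at most `W k` with coefficients at most
`(k + 1) ^ W k` between `n 0, …, n k` involves `n k`. -/
def NoRelations (n : ℕ → ℤ) (W : ℕ → ℕ) : Prop :=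
  ∀ᶠ k in atTop, ∀ r ≤ W k, ∀ (g : Fin r → ℕ) (h : Fin r → ℤ), (∀ j, g j ≤ k) →
    (∀ j, |h j| ≤ ((k + 1) ^ W k : ℕ)) → ∑ j, h j * n (g j) = 0 → ∑ j with g j = k, h j = 0

/-- In a nontrivial relation, consider the largest index `e i` whose total coefficient is nonzero.
The terms above it cancel within each index, leaving a relation that involves `n (e i)`, which is
excluded because `W R ≤ W (e i)`. The enumeration `e` need not be monotone, which is what admits
permutations. -/
lemma NoRelations.isDissociated {n : ℕ → ℤ} {W : ℕ → ℕ} (hn : NoRelations n W) (hW : Monotone W) :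
    ∀ᶠ R in atTop, ∀ (ι : Type) [DecidableEq ι] (e : ι → ℕ), Function.Injective e →
      (∀ i, R < e i) → IsDissociated (fun i => n (e i)) (W R) ((R + 1) ^ W R) := by
  obtain ⟨R₀, hR₀⟩ := eventually_atTop.1 hn
  filter_upwards [eventually_ge_atTop R₀] with R hR ι _ e he hRe r hr g h hh hsum
  by_contra! hcon
  set S : Finset ι := (Finset.univ.image g).filter fun i => ∑ j with g j = i, h j ≠ 0 with hS
  have hSne : S.Nonempty := by
    obtain ⟨i, hi⟩ := hcon
    refine ⟨i, Finset.mem_filter.2 ⟨?_, hi⟩⟩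
    obtain ⟨j, hj, -⟩ := Finset.exists_ne_zero_of_sum_ne_zero hi
    exact Finset.mem_image.2 ⟨j, Finset.mem_univ _, (Finset.mem_filter.1 hj).2⟩
  obtain ⟨i, hiS, himax⟩ := S.exists_max_image e hSne
  have hzero : ∀ i', e i < e i' → ∑ j with g j = i', h j = 0 := by
    intro i' hi'
    by_contra hne
    have : i' ∈ S := by
      refine Finset.mem_filter.2 ⟨?_, hne⟩
      obtain ⟨j, hj, -⟩ := Finset.exists_ne_zero_of_sum_ne_zero hne
      exact Finset.mem_image.2 ⟨j, Finset.mem_univ _, (Finset.mem_filter.1 hj).2⟩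
    exact absurd (himax i' this) (by omega)
  have hk : R < e i := hRe i
  have hWk : W R ≤ W (e i) := hW hk.le
  have key := hR₀ (e i) (by omega) r (hr.trans hWk)
    -- Terms above `e i` are kept as zero coefficients at index `0`, so the length `r` does not
    -- change.
    (fun j => if e (g j) ≤ e i then e (g j) else 0) (fun j => if e (g j) ≤ e i then h j else 0)
    (fun j => by split_ifs <;> omega)
    (fun j => by
      split_ifs
      · refine (hh j).trans ?_
        have : (R + 1) ^ W R ≤ (e i + 1) ^ W (e i) :=
          (Nat.pow_le_pow_left (by omega) _).trans (Nat.pow_le_pow_right (by omega) hWk)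
        exact_mod_cast this
      · simp; positivity) ?_
  · apply (Finset.mem_filter.1 hiS).2
    rw [← key, Finset.sum_filter, Finset.sum_filter]
    refine Finset.sum_congr rfl fun j _ => ?_
    by_cases hj : e (g j) ≤ e i
    · simp [hj, he.eq_iff]
    · have : g j ≠ i := fun h => hj (by rw [h])
      simp [hj, this]
  · have h1 : ∑ j, h j * n (e (g j)) = ∑ j with e (g j) ≤ e i, h j * n (e (g j)) +
        ∑ j with ¬ e (g j) ≤ e i, h j * n (e (g j)) := (Finset.sum_filter_add_sum_filter_not _ _ _).symm
    have h2 : ∑ j with ¬ e (g j) ≤ e i, h j * n (e (g j)) = 0 := by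
      rw [← Finset.sum_fiberwise_of_maps_to (t := Finset.univ.image g) (g := g)
        (fun j _ => Finset.mem_image.2 ⟨j, Finset.mem_univ _, rfl⟩)]
      refine Finset.sum_eq_zero fun i' _ => ?_
      by_cases hi' : e i < e i'
      · have : ∑ j ∈ (Finset.univ.filter fun j => ¬ e (g j) ≤ e i) with g j = i',
            h j * n (e (g j)) = (∑ j with g j = i', h j) * n (e i') := by
          rw [Finset.filter_filter, Finset.sum_mul]
          refine Finset.sum_congr ?_ fun j hj => ?_
          · ext j; simp only [Finset.mem_filter, Finset.mem_univ, true_and]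
            constructor
            · exact fun h => h.2
            · exact fun h => ⟨by rw [h]; omega, h⟩
          · rw [(Finset.mem_filter.1 hj).2]
        rw [this, hzero i' hi', zero_mul]
      · refine Finset.sum_eq_zero fun j hj => ?_
        simp only [Finset.mem_filter, Finset.mem_univ, true_and] at hj
        rw [hj.2] at hj; omega
    rw [hsum, h2, add_zero] at h1
    refine Eq.trans ?_ h1.symm
    rw [Finset.sum_filter]
    refine Finset.sum_congr rfl fun j _ => ?_
    split_ifs <;> simp

/-! ### The probability of a linear relation -/

lemma uniformOn_singleton_le {s : Set ℤ} (hs : s.Finite) (x : ℤ) :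
    uniformOn s {x} ≤ ((s.ncard : ENNReal))⁻¹ := by
  rw [uniformOn, cond_apply hs.measurableSet, Measure.count_apply_finite s hs,
    ← Set.ncard_eq_toFinset_card s hs]
  calc _ ≤ ((s.ncard : ENNReal))⁻¹ * 1 := by
        gcongr
        calc Measure.count (s ∩ {x}) ≤ Measure.count {x} := measure_mono Set.inter_subset_right
          _ = 1 := Measure.count_singleton x
    _ = _ := mul_one _

section

variable {s : ℕ → Set ℤ}

/-- Once the other coordinates are fixed, the relation reads `c n_k = -Y` with `c ≠ 0`, which at
most one value of `n_k` solves; and `n_k` is independent of `Y`. -/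
lemma infinitePi_uniformOn_relation_le (hs : ∀ i, (s i).Finite) (hne : ∀ i, (s i).Nonempty) {k r : ℕ}
    {g : Fin r → ℕ} (h : Fin r → ℤ) (hg : ∀ j, g j ≤ k) (hc : ∑ j with g j = k, h j ≠ 0) :
    Measure.infinitePi (fun i => uniformOn (s i)) {n : ℕ → ℤ | ∑ j, h j * n (g j) = 0} ≤
      (((s k).ncard : ENNReal))⁻¹ := by
  have hprob (i : ℕ) : IsProbabilityMeasure (uniformOn (s i)) :=
    isProbabilityMeasure_uniformOn (hs i) (hne i)
  set μ := Measure.infinitePi (fun i => uniformOn (s i)) with hμ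
  set c := ∑ j with g j = k, h j with hcdef
  set X : (ℕ → ℤ) → ℤ := fun n => c * n k with hX
  set Y : (ℕ → ℤ) → ℤ := fun n => ∑ j with ¬ g j = k, h j * n (g j) with hY
  have hXm : Measurable X := by
    have : Measurable fun n : ℕ → ℤ => n k := measurable_pi_apply k
    exact this.const_mul c
  have hYm : Measurable Y := by
    refine Finset.measurable_fun_sum _ fun j _ => ?_
    have : Measurable fun n : ℕ → ℤ => n (g j) := measurable_pi_apply _
    exact this.const_mul _
  have hindep : IndepFun Y X μ := by
    have h1 : iIndepFun (fun (i : ℕ) (n : ℕ → ℤ) => n i) μ :=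
      iIndepFun_infinitePi (P := fun i => uniformOn (s i)) (X := fun i (x : ℤ) => x)
        fun i => measurable_id
    have h2 := h1.indepFun_finset (Finset.range k) {k} (by simp) (fun i => measurable_pi_apply i)
    have h3 := h2.comp (φ := fun z : (Finset.range k → ℤ) => ∑ j with ¬ g j = k,
        h j * (if hj : g j ∈ Finset.range k then z ⟨g j, hj⟩ else 0))
      (ψ := fun z : (({k} : Finset ℕ) → ℤ) => c * z ⟨k, Finset.mem_singleton_self k⟩)
      (measurable_of_countable _) (measurable_of_countable _)
    convert! h3 using 1
    funext n
    simp only [hY, Function.comp]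
    refine Finset.sum_congr rfl fun j hj => ?_
    have h4 : g j ∈ Finset.range k := by
      have := hg j
      have := (Finset.mem_filter.1 hj).2
      rw [Finset.mem_range]; omega
    rw [dif_pos h4]
  have hsub : {n : ℕ → ℤ | ∑ j, h j * n (g j) = 0} ⊆ ⋃ y : ℤ, (Y ⁻¹' {y} ∩ X ⁻¹' {-y}) := by
    intro n hn
    have h1 : ∑ j, h j * n (g j) = X n + Y n := by
      rw [← Finset.sum_filter_add_sum_filter_not Finset.univ (fun j => g j = k)]
      congr 1
      rw [hX, hcdef]
      simp only
      rw [Finset.sum_mul]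
      refine Finset.sum_congr rfl fun j hj => ?_
      rw [(Finset.mem_filter.1 hj).2]
    rw [Set.mem_ofPred_eq, h1] at hn
    refine Set.mem_iUnion.2 ⟨Y n, rfl, ?_⟩
    simp only [Set.mem_preimage, Set.mem_singleton_iff]; omega
  have hpt : ∀ y : ℤ, μ (X ⁻¹' {-y}) ≤ (((s k).ncard : ENNReal))⁻¹ := by
    intro y
    -- If `c` does not divide `y`, the left side is empty and the rounded quotient is harmless.
    have h1 : X ⁻¹' {-y} ⊆ (fun n : ℕ → ℤ => n k) ⁻¹' {-y / c} := by
      intro n hn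
      simp only [hX, Set.mem_preimage, Set.mem_singleton_iff] at hn ⊢
      rw [← hn, Int.mul_ediv_cancel_left _ hc]
    refine (measure_mono h1).trans ?_
    rw [← Measure.map_apply (measurable_pi_apply k) (measurableSet_singleton _),
      Measure.infinitePi_map_eval]
    exact uniformOn_singleton_le (hs k) _
  have hYprob : IsProbabilityMeasure (μ.map Y) := Measure.isProbabilityMeasure_map hYm.aemeasurable
  calc μ {n : ℕ → ℤ | ∑ j, h j * n (g j) = 0}
      ≤ ∑' y : ℤ, μ (Y ⁻¹' {y} ∩ X ⁻¹' {-y}) := (measure_mono hsub).trans (measure_iUnion_le _)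
    _ = ∑' y : ℤ, μ (Y ⁻¹' {y}) * μ (X ⁻¹' {-y}) := by
        refine tsum_congr fun y => ?_
        exact hindep.measure_inter_preimage_eq_mul _ _ (measurableSet_singleton _)
          (measurableSet_singleton _)
    _ ≤ ∑' y : ℤ, μ.map Y {y} * (((s k).ncard : ENNReal))⁻¹ := by
        refine ENNReal.tsum_le_tsum fun y => ?_
        rw [Measure.map_apply hYm (measurableSet_singleton _)]
        exact mul_le_mul_right (hpt y) _
    _ = (∑' y : ℤ, μ.map Y {y}) * (((s k).ncard : ENNReal))⁻¹ := ENNReal.tsum_mul_right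
    _ ≤ 1 * (((s k).ncard : ENNReal))⁻¹ := by
        gcongr
        have h5 : ∑' y : ℤ, μ.map Y {y} = μ.map Y Set.univ := by
          rw [← Set.iUnion_of_singleton ℤ, measure_iUnion]
          · exact fun a b hab => by simpa using hab
          · exact fun a => measurableSet_singleton a
        rw [h5]; exact prob_le_one
    _ = _ := one_mul _

/-- Union bound: there are `w + 1` lengths, and each entry of a relation has `k + 1` possible
indices and `2 Q + 1` possible coefficients. -/
lemma measure_exists_relation_le (hs : ∀ i, (s i).Finite) (hne : ∀ i, (s i).Nonempty) (k w Q : ℕ) :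
    Measure.infinitePi (fun i => uniformOn (s i)) {n : ℕ → ℤ | ∃ r ≤ w, ∃ (g : Fin r → ℕ)
      (h : Fin r → ℤ), (∀ j, g j ≤ k) ∧ (∀ j, |h j| ≤ (Q : ℤ)) ∧ ∑ j, h j * n (g j) = 0 ∧
        ∑ j with g j = k, h j ≠ 0} ≤
      (((w + 1) * ((k + 1) * (2 * Q + 1)) ^ w : ℕ) : ENNReal) * (((s k).ncard : ENNReal))⁻¹ := by
  classical
  set μ := Measure.infinitePi (fun i => uniformOn (s i)) with hμ
  set I : ∀ r : ℕ, Finset (Fin r → ℕ × ℤ) := fun r =>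
    Fintype.piFinset fun _ : Fin r => Finset.range (k + 1) ×ˢ Finset.Icc (-(Q : ℤ)) Q with hI
  -- The relations with zero total coefficient at `k` are assigned the empty event, so that the
  -- bound for one relation holds over the whole index set.
  set E : ∀ r : ℕ, (Fin r → ℕ × ℤ) → Set (ℕ → ℤ) := fun r a =>
    if ∑ j with (a j).1 = k, (a j).2 ≠ 0 then {n | ∑ j, (a j).2 * n (a j).1 = 0} else ∅ with hE
  have hsub : {n : ℕ → ℤ | ∃ r ≤ w, ∃ (g : Fin r → ℕ)
      (h : Fin r → ℤ), (∀ j, g j ≤ k) ∧ (∀ j, |h j| ≤ (Q : ℤ)) ∧ ∑ j, h j * n (g j) = 0 ∧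
        ∑ j with g j = k, h j ≠ 0} ⊆ ⋃ r ∈ Finset.range (w + 1), ⋃ a ∈ I r, E r a := by
    rintro n ⟨r, hr, g, h, hg, hh, hsum, hc⟩
    simp only [Set.mem_iUnion, exists_prop]
    refine ⟨r, Finset.mem_range.2 (by omega), fun j => (g j, h j), ?_, ?_⟩
    · simp only [hI, Fintype.mem_piFinset, Finset.mem_product, Finset.mem_range, Finset.mem_Icc]
      exact fun j => ⟨by have := hg j; omega, abs_le.1 (hh j)⟩
    · simp only [hE]
      rw [if_pos hc]
      exact hsum
  have hEa : ∀ r, ∀ a ∈ I r, μ (E r a) ≤ (((s k).ncard : ENNReal))⁻¹ := by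
    intro r a ha
    simp only [hE]
    split_ifs with hc
    · simp only [hI, Fintype.mem_piFinset, Finset.mem_product, Finset.mem_range, Finset.mem_Icc] at ha
      exact infinitePi_uniformOn_relation_le hs hne (g := fun j => (a j).1) (fun j => (a j).2)
        (fun j => by have := (ha j).1; omega) hc
    · simp
  have hcard : ∀ r, (I r).card = ((k + 1) * (2 * Q + 1)) ^ r := by
    intro r
    simp only [hI, Fintype.card_piFinset, Finset.prod_const, Finset.card_univ, Fintype.card_fin,
      Finset.card_product, Finset.card_range, Int.card_Icc]
    congr 2; omega
  calc _ ≤ μ (⋃ r ∈ Finset.range (w + 1), ⋃ a ∈ I r, E r a) := measure_mono hsub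
    _ ≤ ∑ r ∈ Finset.range (w + 1), μ (⋃ a ∈ I r, E r a) := measure_biUnion_finset_le _ _
    _ ≤ ∑ r ∈ Finset.range (w + 1), ∑ a ∈ I r, μ (E r a) :=
        Finset.sum_le_sum fun r _ => measure_biUnion_finset_le _ _
    _ ≤ ∑ r ∈ Finset.range (w + 1), ∑ a ∈ I r, (((s k).ncard : ENNReal))⁻¹ :=
        Finset.sum_le_sum fun r _ => Finset.sum_le_sum fun a ha => hEa r a ha
    _ ≤ ∑ r ∈ Finset.range (w + 1), (((k + 1) * (2 * Q + 1)) ^ w : ℕ) *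
          (((s k).ncard : ENNReal))⁻¹ := by
        refine Finset.sum_le_sum fun r hr => ?_
        rw [Finset.sum_const, nsmul_eq_mul, hcard]
        gcongr
        · exact Nat.succ_le_of_lt (by positivity)
        · exact Nat.lt_succ_iff.1 (Finset.mem_range.1 hr)
    _ = _ := by
        rw [Finset.sum_const, nsmul_eq_mul, Finset.card_range, ← mul_assoc]
        push_cast; ring

end

/-! ### The size of the blocks and the order of independence -/

lemma le_ncard_blockIntegers (a : ℝ) (ω : ℕ → ℝ) (k : ℕ) :
    endpoint a ω k - endpoint a ω (k - 1) - 1 ≤ ((blockIntegers a ω k).ncard : ℝ) := by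
  have h1 : blockIntegers a ω k =
      ((Finset.Ico ⌈endpoint a ω (k - 1)⌉ ⌈endpoint a ω k⌉ : Finset ℤ) : Set ℤ) := by
    ext m
    simp [blockIntegers, Int.ceil_le, Int.lt_ceil]
  rw [h1, Set.ncard_coe_finset, Int.card_Ico]
  have h2 := Int.le_ceil (endpoint a ω k)
  have h3 := Int.ceil_lt_add_one (endpoint a ω (k - 1))
  have h4 : ((⌈endpoint a ω k⌉ - ⌈endpoint a ω (k - 1)⌉ : ℤ) : ℝ) ≤
      ((⌈endpoint a ω k⌉ - ⌈endpoint a ω (k - 1)⌉).toNat : ℝ) := by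
    exact_mod_cast Int.self_le_toNat _
  push_cast at h4
  linarith

/-- By monotonicity of `ω`, `(k - 1) ^ ω_{k-1} ≤ (k - 1) ^ ω_k ≤ (k - 1) k ^ (ω_k - 1)`, and
subtracting from `k · k ^ (ω_k - 1)` leaves one copy of `k ^ (ω_k - 1)`. -/
lemma mul_rpow_le_endpoint_sub {a : ℝ} (ha : 0 < a) {ω : ℕ → ℝ} (hω : MonotoneOn ω (Set.Ici 1))
    {k : ℕ} (hk : 2 ≤ k) (h1 : 1 ≤ ω k) :
    a * (k : ℝ) ^ (ω k - 1) ≤ endpoint a ω k - endpoint a ω (k - 1) := by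
  have hk0 : (0 : ℝ) < k := by positivity
  have hk1 : (1 : ℝ) ≤ ((k - 1 : ℕ) : ℝ) := by exact_mod_cast (by omega : 1 ≤ k - 1)
  have hcast : ((k - 1 : ℕ) : ℝ) = (k : ℝ) - 1 := by rw [Nat.cast_sub (by omega)]; simp
  rw [endpoint, endpoint, if_neg (by omega), if_neg (by omega), ← mul_sub]
  refine mul_le_mul_of_nonneg_left ?_ ha.le
  have h2 : ((k - 1 : ℕ) : ℝ) ^ ω (k - 1) ≤ ((k - 1 : ℕ) : ℝ) ^ ω k :=
    Real.rpow_le_rpow_of_exponent_le hk1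
      (hω (by simp; omega) (by simp; omega) (by omega))
  have h3 : ((k - 1 : ℕ) : ℝ) ^ ω k ≤ (k : ℝ) ^ (ω k - 1) * ((k : ℝ) - 1) := by
    have h4 : ω k = (ω k - 1) + 1 := by ring
    have h0 : (0 : ℝ) < ((k - 1 : ℕ) : ℝ) := by linarith
    rw [h4, Real.rpow_add_one h0.ne', ← h4, hcast]
    refine mul_le_mul_of_nonneg_right ?_ (by linarith)
    exact Real.rpow_le_rpow (by linarith) (by linarith) (by linarith)
  have h5 : (k : ℝ) ^ ω k = (k : ℝ) ^ (ω k - 1) * k := by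
    rw [← Real.rpow_add_one hk0.ne']; congr 1; ring
  nlinarith

/-- The length up to which linear relations are excluded. -/
def relationOrder (ω : ℕ → ℝ) (k : ℕ) : ℕ := min k ⌊√(ω (k + 1)) / 2⌋₊

lemma relationOrder_mono {ω : ℕ → ℝ} (hω : MonotoneOn ω (Set.Ici 1)) : Monotone (relationOrder ω) := by
  intro k l hkl
  refine min_le_min hkl (Nat.floor_mono ?_)
  have := hω (by simp : k + 1 ∈ Set.Ici 1) (by simp : l + 1 ∈ Set.Ici 1) (by omega : k + 1 ≤ l + 1)
  have := Real.sqrt_le_sqrt this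
  linarith

lemma tendsto_relationOrder {ω : ℕ → ℝ} (hω : Tendsto ω atTop atTop) :
    Tendsto (relationOrder ω) atTop atTop := by
  refine tendsto_atTop.2 fun b => ?_
  have h : Tendsto (fun k => ⌊√(ω (k + 1)) / 2⌋₊) atTop atTop := by
    refine tendsto_nat_floor_atTop.comp ?_
    exact (Real.tendsto_sqrt_atTop.comp (hω.comp (tendsto_add_atTop_nat 1))).atTop_div_const
      (by norm_num)
  filter_upwards [eventually_ge_atTop b, h.eventually_ge_atTop b] with k h1 h2 using le_min h1 h2

/-- The square root halves the exponent `α`; a further halving absorbs the factor `1 / 2` and the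
floor. The cap `1` on the exponent keeps the power of `log k` below the other entry `k` of the
minimum. -/
lemma log_rpow_le_relationOrder {ω : ℕ → ℝ} {α : ℝ} (hα : 0 < α) {k₀ : ℕ}
    (h : ∀ k, k₀ ≤ k → Real.log k ^ α ≤ ω k) :
    ∀ᶠ k : ℕ in atTop, Real.log k ^ (min (α / 4) 1) ≤ relationOrder ω k := by
  have hlog : Tendsto (fun k : ℕ => Real.log k) atTop atTop :=
    Real.tendsto_log_atTop.comp tendsto_natCast_atTop_atTop
  have ht : Tendsto (fun k : ℕ => Real.log k ^ (α / 4)) atTop atTop :=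
    (tendsto_rpow_atTop (by positivity)).comp hlog
  filter_upwards [ht.eventually_ge_atTop 4, hlog.eventually_ge_atTop 1, eventually_ge_atTop k₀,
    eventually_ge_atTop 1] with k h4 h1 hk hk1
  have hle : Real.log k ^ (min (α / 4) 1) ≤ Real.log k ^ (α / 4) :=
    Real.rpow_le_rpow_of_exponent_le h1 (min_le_left _ _)
  rw [relationOrder, Nat.cast_min]
  refine le_min ?_ ?_
  · calc _ ≤ Real.log k ^ (1 : ℝ) := Real.rpow_le_rpow_of_exponent_le h1 (min_le_right _ _)
      _ = Real.log k := Real.rpow_one _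
      _ ≤ k := Real.log_le_self (by positivity)
  · refine hle.trans ?_
    have h5 : Real.log k ^ α ≤ ω (k + 1) := by
      refine le_trans ?_ (h (k + 1) (by omega))
      refine Real.rpow_le_rpow (by linarith) ?_ hα.le
      exact Real.log_le_log (by positivity) (by push_cast; linarith)
    have h6 : Real.log k ^ α = (Real.log k ^ (α / 4) * Real.log k ^ (α / 4)) ^ 2 := by
      rw [← Real.rpow_add (by linarith), ← Real.rpow_natCast, ← Real.rpow_mul (by linarith)]
      congr 1; push_cast; ring
    have h7 : Real.log k ^ (α / 4) * Real.log k ^ (α / 4) ≤ √(ω (k + 1)) := by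
      rw [h6] at h5
      exact Real.le_sqrt_of_sq_le h5
    have h8 := Nat.lt_floor_add_one (√(ω (k + 1)) / 2)
    nlinarith

/-- Borel–Cantelli: a relation at level `k` has probability at most `(k + 1) ^ (-2)` for large `k`.
-/
lemma ae_noRelations {ω : ℕ → ℝ} {a : ℝ} (hω_mono : MonotoneOn ω (Set.Ici 1))
    (hω_lim : Tendsto ω atTop atTop) (ha_pos : 0 < a)
    (ha : ∀ k, 1 ≤ k → (blockIntegers a ω k).Nonempty) :
    ∀ᵐ n ∂(randomSeqLaw a ω), NoRelations n (relationOrder ω) := by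
  set μ := randomSeqLaw a ω with hμ
  have hprob := isProbabilityMeasure_randomSeqLaw ha
  set W := relationOrder ω with hW
  set E : ℕ → Set (ℕ → ℤ) := fun k => {n : ℕ → ℤ | ∃ r ≤ W k, ∃ (g : Fin r → ℕ)
      (h : Fin r → ℤ), (∀ j, g j ≤ k) ∧ (∀ j, |h j| ≤ (((k + 1) ^ W k : ℕ) : ℤ)) ∧
        ∑ j, h j * n (g j) = 0 ∧ ∑ j with g j = k, h j ≠ 0} with hE
  have hbound : ∀ᶠ k in atTop, μ (E k) ≤ ENNReal.ofReal (1 / ((k : ℝ) + 1) ^ 2) := by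
    filter_upwards [(hω_lim.comp (tendsto_add_atTop_nat 1)).eventually_ge_atTop 25,
      eventually_ge_atTop 1, (tendsto_natCast_atTop_atTop (R := ℝ)).eventually_ge_atTop (2 / a)]
      with k h25 hk1 hka
    simp only [Function.comp] at h25
    have h1 := measure_exists_relation_le (s := fun i => blockIntegers a ω (i + 1))
      (fun i => blockIntegers_finite a ω _) (fun i => ha _ (by omega)) k (W k) ((k + 1) ^ W k)
    refine h1.trans ?_
    set K : ℝ := (k : ℝ) + 1 with hK
    have hK2 : 2 ≤ K := by
      have : (1 : ℝ) ≤ k := by exact_mod_cast hk1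
      linarith
    set w := W k with hw
    -- the number of relations
    have hcount : (((w + 1) * ((k + 1) * (2 * (k + 1) ^ w + 1)) ^ w : ℕ) : ℝ) ≤
        K ^ (w ^ 2 + 3 * w + 2) := by
      push_cast
      rw [← hK]
      have e1 : ((w : ℝ) + 1) ≤ K ^ 2 := by
        have : (w : ℝ) ≤ k := by exact_mod_cast min_le_left _ _
        nlinarith
      have e2 : 2 * K ^ w + 1 ≤ K ^ (w + 2) := by
        have : 1 ≤ K ^ w := one_le_pow₀ (by linarith)
        have : 4 ≤ K ^ 2 := by nlinarith
        rw [pow_add]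
        nlinarith
      calc _ ≤ K ^ 2 * (K * K ^ (w + 2)) ^ w := by gcongr
        _ = _ := by rw [← pow_succ', ← pow_mul, ← pow_add]; congr 1; ring
    -- The reason for the order `√ω / 2`: then `w² ≤ ω / 4`, and the lower terms fit below `ω - 2`
    -- once `ω ≥ 25`. The argument is `k + 1` because coordinate `k` is drawn from the block with
    -- that number.
    have hwω : ((w ^ 2 + 3 * w + 4 : ℕ) : ℝ) ≤ ω (k + 1) - 2 := by
      have e1 : (w : ℝ) ≤ √(ω (k + 1)) / 2 := by
        refine le_trans ?_ (Nat.floor_le (by positivity))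
        exact_mod_cast min_le_right _ _
      have e2 : 5 ≤ √(ω (k + 1)) := Real.le_sqrt_of_sq_le (by linarith)
      have e3 : √(ω (k + 1)) ^ 2 = ω (k + 1) := Real.sq_sqrt (by linarith)
      have e4 : (0 : ℝ) ≤ w := by positivity
      push_cast
      nlinarith
    have hcard : K ^ (w ^ 2 + 3 * w + 4) ≤ ((blockIntegers a ω (k + 1)).ncard : ℝ) := by
      have e1 := le_ncard_blockIntegers a ω (k + 1)
      rw [Nat.add_sub_cancel] at e1
      have e2 := mul_rpow_le_endpoint_sub ha_pos hω_mono (k := k + 1) (by omega) (by linarith)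
      rw [Nat.add_sub_cancel] at e2
      push_cast at e2
      rw [← hK] at e2
      have e3 : K ^ (ω (k + 1) - 1) = K ^ (ω (k + 1) - 2) * K := by
        rw [← Real.rpow_add_one (by linarith)]; congr 1; ring
      have e4 : K ^ (w ^ 2 + 3 * w + 4) ≤ K ^ (ω (k + 1) - 2) := by
        rw [← Real.rpow_natCast]
        exact Real.rpow_le_rpow_of_exponent_le (by linarith) hwω
      have e5 : 1 ≤ K ^ (w ^ 2 + 3 * w + 4) := one_le_pow₀ (by linarith)
      have e6 : 2 ≤ a * K := by
        rw [div_le_iff₀ ha_pos] at hka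
        nlinarith
      rw [e3] at e2
      have e7 : 2 * K ^ (ω (k + 1) - 2) ≤ a * (K ^ (ω (k + 1) - 2) * K) := by nlinarith
      linarith
    have hcpos : (0 : ℝ) < ((blockIntegers a ω (k + 1)).ncard : ℝ) :=
      lt_of_lt_of_le (by positivity) hcard
    have e8 : (((blockIntegers a ω (k + 1)).ncard : ENNReal))⁻¹ =
        ENNReal.ofReal (((blockIntegers a ω (k + 1)).ncard : ℝ)⁻¹) := by
      rw [ENNReal.ofReal_inv_of_pos hcpos, ENNReal.ofReal_natCast]
    rw [e8, ← ENNReal.ofReal_natCast, ← ENNReal.ofReal_mul (by positivity)]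
    refine ENNReal.ofReal_le_ofReal ?_
    rw [← div_eq_mul_inv, div_le_div_iff₀ hcpos (by positivity), one_mul]
    calc _ ≤ K ^ (w ^ 2 + 3 * w + 2) * K ^ 2 := by gcongr
      _ = K ^ (w ^ 2 + 3 * w + 4) := by rw [← pow_add]
      _ ≤ _ := hcard
  obtain ⟨k₁, hk₁⟩ := eventually_atTop.1 hbound
  have hsum : Summable fun k : ℕ => 1 / ((k : ℝ) + 1) ^ 2 := by
    have := (summable_nat_add_iff 1).2 (Real.summable_one_div_nat_pow.2 (by norm_num : 1 < 2))
    simpa using this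
  have hfin : ∑' k, μ (E (k + k₁)) ≠ ⊤ := by
    refine ne_top_of_le_ne_top ?_ (ENNReal.tsum_le_tsum fun k => hk₁ (k + k₁) (by omega))
    have h2 := (summable_nat_add_iff k₁).2 hsum
    rw [← ENNReal.ofReal_tsum_of_nonneg (fun k => by positivity) h2]
    exact ENNReal.ofReal_ne_top
  filter_upwards [ae_eventually_notMem hfin] with n hn
  obtain ⟨k₂, hk₂⟩ := eventually_atTop.1 hn
  refine eventually_atTop.2 ⟨k₁ + k₂, fun k hk r hr g h hg hh hs => ?_⟩
  by_contra hne
  refine hk₂ (k - k₁) (by omega) ?_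
  rw [Nat.sub_add_cancel (by omega)]
  exact ⟨r, hr, g, h, hg, hh, hs, hne⟩

/-! ### Reduction of permuted sums at a scale `R`. -/

/-- The positions below `R ^ 8` whose index after the permutation exceeds `R`. -/
def bigIndices (σ : Equiv.Perm ℕ) (R : ℕ) : Finset ℕ := (Finset.range (R ^ 8)).filter (R < σ ·)

/-- By injectivity of `σ`, at most `R + 1` positions carry an index on which there is no arithmetic
control. -/
lemma card_filter_le_add_one (σ : Equiv.Perm ℕ) (R : ℕ) (s : Finset ℕ) :
    (s.filter fun i => ¬ R < σ i).card ≤ R + 1 := by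
  calc (s.filter fun i => ¬ R < σ i).card = ((s.filter fun i => ¬ R < σ i).image σ).card :=
        (Finset.card_image_of_injective _ σ.injective).symm
    _ ≤ (Finset.range (R + 1)).card := Finset.card_le_card fun j hj => by
        obtain ⟨i, hi, rfl⟩ := Finset.mem_image.1 hj
        have := (Finset.mem_filter.1 hi).2
        exact Finset.mem_range.2 (by omega)
    _ = R + 1 := Finset.card_range _

/-- The indicator weights of an interval of positions. -/
def indicatorWeight {s : Finset ℕ} (M N : ℕ) (i : s) : ℝ := if (i : ℕ) ∈ Finset.Ico M N then 1 else 0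

lemma sum_indicatorWeight_mul {σ : Equiv.Perm ℕ} {R M N : ℕ} (hN : N ≤ R ^ 8) (F : ℕ → ℝ) :
    ∑ i : bigIndices σ R, indicatorWeight M N i * F i =
      ∑ i ∈ (Finset.Ico M N).filter (R < σ ·), F i := by
  have h1 : ∑ i : bigIndices σ R, indicatorWeight M N i * F i =
      ∑ i ∈ bigIndices σ R, (if i ∈ Finset.Ico M N then 1 else 0) * F i :=
    Finset.sum_coe_sort (bigIndices σ R) fun i => (if i ∈ Finset.Ico M N then (1 : ℝ) else 0) * F i
  rw [h1]
  simp only [ite_mul, one_mul, zero_mul]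
  rw [← Finset.sum_filter]
  refine Finset.sum_congr ?_ fun _ _ => rfl
  ext i
  simp only [bigIndices, Finset.mem_filter, Finset.mem_range, Finset.mem_Ico]
  constructor
  · rintro ⟨⟨_, h2⟩, h3⟩; exact ⟨h3, h2⟩
  · rintro ⟨h3, h2⟩; exact ⟨⟨by omega, h2⟩, h3⟩

lemma indicatorWeight_sq {s : Finset ℕ} (M N : ℕ) (i : s) :
    indicatorWeight M N i ^ 2 = indicatorWeight M N i := by
  unfold indicatorWeight; split_ifs <;> simp

lemma abs_indicatorWeight_le {s : Finset ℕ} (M N : ℕ) (i : s) : |indicatorWeight M N i| ≤ 1 := by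
  unfold indicatorWeight; split_ifs <;> simp

lemma sum_indicatorWeight_sq {σ : Equiv.Perm ℕ} {R M N : ℕ} (hN : N ≤ R ^ 8) :
    ∑ i : bigIndices σ R, indicatorWeight M N i ^ 2 =
      (((Finset.Ico M N).filter (R < σ ·)).card : ℝ) := by
  have := sum_indicatorWeight_mul (σ := σ) (M := M) hN fun _ => 1
  simp only [mul_one] at this
  simp_rw [indicatorWeight_sq]
  rw [this]; simp

lemma card_Ico_filter_le (σ : Equiv.Perm ℕ) (R M N : ℕ) :
    ((Finset.Ico M N).filter (R < σ ·)).card ≤ N - M :=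
  (Finset.card_filter_le _ _).trans (Nat.card_Ico M N).le

lemma le_card_Ico_filter (σ : Equiv.Perm ℕ) (R M N : ℕ) :
    N - M ≤ ((Finset.Ico M N).filter (R < σ ·)).card + (R + 1) := by
  have h1 := Finset.card_filter_add_card_filter_not (s := Finset.Ico M N) (R < σ ·)
  have h2 := card_filter_le_add_one σ R (Finset.Ico M N)
  rw [Nat.card_Ico] at h1
  omega

lemma sum_indicatorWeight_sq_le {σ : Equiv.Perm ℕ} {R M N : ℕ} (hMN : M ≤ N) (hN : N ≤ R ^ 8) :
    ∑ i : bigIndices σ R, indicatorWeight M N i ^ 2 ≤ (N : ℝ) - M := by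
  rw [sum_indicatorWeight_sq hN, ← Nat.cast_sub hMN]
  exact_mod_cast card_Ico_filter_le σ R M N

lemma le_sum_indicatorWeight_sq {σ : Equiv.Perm ℕ} {R M N : ℕ} (hMN : M ≤ N) (hN : N ≤ R ^ 8) :
    (N : ℝ) - M - (R + 1) ≤ ∑ i : bigIndices σ R, indicatorWeight M N i ^ 2 := by
  rw [sum_indicatorWeight_sq hN, ← Nat.cast_sub hMN, sub_le_iff_le_add]
  exact_mod_cast le_card_Ico_filter σ R M N

/-- At scale `R`, the sums of `f` over positions below `R ^ 8` are, up to a small error, sums of a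
trigonometric polynomial `p` whose moments of order at most `m` match those of independent
copies. -/
structure IsScale (f : ℝ → ℝ) (n : ℕ → ℤ) (σ : Equiv.Perm ℕ) (R m : ℕ) (B C : ℝ) (p : ℝ → ℝ) (v : ℝ)
    (D : ℝ → ℝ) : Prop where
  moments : MomentsMatch (fun i : bigIndices σ R => n (σ i)) p m B v
  variance : |v - l2Norm f ^ 2| ≤ C / R
  measurable : Measurable D
  nonneg : ∀ x, 0 ≤ D x
  integrable : Integrable D unitMeasure
  integral_le : ∫ x, D x ∂unitMeasure ≤ C / R ^ 8
  abs_sub_le : ∀ x M N, M ≤ N → N ≤ R ^ 8 → |∑ i ∈ Finset.Ico M N, f (n (σ i) * x) -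
    ∑ i : bigIndices σ R, indicatorWeight M N i * p (n (σ i) * x)| ≤ (R + 1) * B + D x

lemma IsTrigPoly.mono {H H' : ℕ} {p : ℝ → ℝ} (hp : IsTrigPoly H p) (h : H ≤ H') :
    IsTrigPoly H' p := by
  obtain ⟨s, k, w, hs, hw⟩ := hp
  exact ⟨s, k, w, fun a ha => (hs a ha).trans (by exact_mod_cast h), hw⟩

lemma IsDissociated.ne_zero {ι : Type*} [DecidableEq ι] {n : ι → ℤ} {m H : ℕ}
    (hn : IsDissociated n m H) (hm : 1 ≤ m) (hH : 1 ≤ H) (i : ι) : n i ≠ 0 := by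
  intro h0
  have := hn 1 hm (fun _ => i) (fun _ => 1) (fun _ => by simpa using hH) (by simp [h0]) i
  simp at this

/-- The error function `D` sums `|f - p|` over all controlled positions at once, so it serves every
interval of positions below `R ^ 8` simultaneously; this uniformity is used in the maximal
inequality. -/
theorem exists_scale {n : ℕ → ℤ} {W : ℕ → ℕ} (hn : NoRelations n W) (hW : Monotone W)
    (hWlim : Tendsto W atTop atTop) {f : ℝ → ℝ} (hf : Admissible f) (σ : Equiv.Perm ℕ) :
    ∃ B C : ℝ, 1 ≤ B ∧ 0 ≤ C ∧ ∀ᶠ R in atTop, ∃ p v D, IsScale f n σ R (W R) B C p v D := by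
  obtain ⟨B, hB1, hB⟩ := hf.exists_bound
  obtain ⟨C, hC0, hC⟩ := hf.exists_trigPoly hB
  have hfm := hf.measurable
  refine ⟨B, 2 * B * C, hB1, by positivity, ?_⟩
  filter_upwards [hn.isDissociated hW, hWlim.eventually_ge_atTop 32, eventually_ge_atTop 1]
    with R hdis hW32 hR1
  have hR1' : (1 : ℝ) ≤ R := by exact_mod_cast hR1
  have hd := hdis (bigIndices σ R) (fun i => σ i) (fun i j hij => Subtype.ext (σ.injective hij))
    (fun i => (Finset.mem_filter.1 i.2).2)
  -- Degree `R ^ 32` gives `L¹` error `C / R ^ 16` per term, hence at most `C / R ^ 8` over `R ^ 8`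
  -- terms. It is admissible because `R ^ 32 ≤ (R + 1) ^ W R` once `W R ≥ 32`.
  obtain ⟨p, hp, hpm, hpB, hpper, hp0, hpf⟩ := hC (R ^ 32) (by positivity)
  have hsqrt : √((R ^ 32 : ℕ) : ℝ) = R ^ 16 := by
    rw [Nat.cast_pow, show (R : ℝ) ^ 32 = (R ^ 16) ^ 2 by ring]
    exact Real.sqrt_sq (by positivity)
  rw [hsqrt] at hpf
  have hp' : IsTrigPoly ((R + 1) ^ W R) p := hp.mono
    ((Nat.pow_le_pow_left (by omega) _).trans (Nat.pow_le_pow_right (by omega) hW32))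
  have hn0 : ∀ i : bigIndices σ R, n (σ i) ≠ 0 := fun i =>
    hd.ne_zero (by omega) (Nat.one_le_pow _ _ (by omega)) i
  have hbd : ∀ x, |f x - p x| ≤ 2 * B := fun x =>
    (abs_sub _ _).trans (by linarith [hB x, hpB x])
  have hint : ∀ k : ℤ, Integrable (fun x => |f (k * x) - p (k * x)|) unitMeasure := fun k =>
    integrable_of_abs_le (by fun_prop) (B := 2 * B) fun x => by rw [abs_abs]; exact hbd _
  refine ⟨p, ∫ x, p x ^ 2 ∂unitMeasure,
    fun x => ∑ i : bigIndices σ R, |f (n (σ i) * x) - p (n (σ i) * x)|,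
    ⟨hpm, hB1, hpB, hp0, rfl, fun r hr c => hd.integral_pow_eq hp' c hr⟩, ?_, ?_, ?_, ?_, ?_, ?_⟩
  · have h1 : l2Norm f ^ 2 = ∫ x, f x ^ 2 ∂unitMeasure := by
      rw [l2Norm, Real.sq_sqrt, integral_unitMeasure]
      rw [← integral_unitMeasure]
      exact integral_nonneg fun x => sq_nonneg _
    have i1 : Integrable (fun x => p x ^ 2) unitMeasure :=
      integrable_of_abs_le (by fun_prop) (B := B ^ 2) fun x => by
        rw [abs_pow]; exact pow_le_pow_left₀ (abs_nonneg _) (hpB x) 2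
    have i2 : Integrable (fun x => f x ^ 2) unitMeasure :=
      integrable_of_abs_le (by fun_prop) (B := B ^ 2) fun x => by
        rw [abs_pow]; exact pow_le_pow_left₀ (abs_nonneg _) (hB x) 2
    rw [h1, ← integral_sub i1 i2]
    calc |∫ x, (p x ^ 2 - f x ^ 2) ∂unitMeasure| ≤ ∫ x, |p x ^ 2 - f x ^ 2| ∂unitMeasure :=
          abs_integral_le_integral_abs
      _ ≤ ∫ x, 2 * B * |f x - p x| ∂unitMeasure := by
          refine integral_mono (i1.sub i2).abs
            ((by simpa using hint 1 : Integrable (fun x => |f x - p x|) unitMeasure).const_mul _)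
            fun x => ?_
          have e : p x ^ 2 - f x ^ 2 = (p x + f x) * (p x - f x) := by ring
          simp only [e, abs_mul]
          rw [abs_sub_comm (p x)]
          refine mul_le_mul_of_nonneg_right ?_ (abs_nonneg _)
          exact (abs_add_le _ _).trans (by linarith [hB x, hpB x])
      _ = 2 * B * ∫ x, |f x - p x| ∂unitMeasure := integral_const_mul _ _
      _ ≤ 2 * B * (C / R ^ 16) := by gcongr
      _ ≤ 2 * B * (C / R) := by
          gcongr
          exact le_self_pow₀ hR1' (by norm_num)
      _ = _ := by ring
  · exact Finset.measurable_fun_sum _ fun i _ => by fun_prop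
  · exact fun x => Finset.sum_nonneg fun i _ => abs_nonneg _
  · exact integrable_finsetSum _ fun i _ => hint _
  · rw [integral_finsetSum _ fun i _ => hint _]
    calc _ = ∑ i : bigIndices σ R, ∫ x, |f x - p x| ∂unitMeasure := by
          refine Finset.sum_congr rfl fun i _ => ?_
          exact integral_comp_int_mul (g := fun x => |f x - p x|) (fun x => by
            simp only [hf.periodic x, hpper x]) (by fun_prop) (B := 2 * B)
            (fun x => by rw [abs_abs]; exact hbd x) (hn0 i)
      _ ≤ ∑ i : bigIndices σ R, C / R ^ 16 := Finset.sum_le_sum fun i _ => hpf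
      _ = (bigIndices σ R).card * (C / R ^ 16) := by simp
      _ ≤ (R : ℝ) ^ 8 * (C / R ^ 16) := by
          gcongr
          have := (Finset.card_filter_le (Finset.range (R ^ 8)) (R < σ ·)).trans
            (Finset.card_range _).le
          exact_mod_cast this
      _ = C / R ^ 8 := by field_simp
      _ ≤ _ := by gcongr; nlinarith
  · intro x M N hMN hN
    rw [sum_indicatorWeight_mul hN fun i => p (n (σ i) * x)]
    rw [← Finset.sum_filter_add_sum_filter_not (Finset.Ico M N) (R < σ ·), add_sub_right_comm,
      ← Finset.sum_sub_distrib]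
    have h1 : |∑ i ∈ (Finset.Ico M N).filter (R < σ ·), (f (n (σ i) * x) - p (n (σ i) * x))| ≤
        ∑ i : bigIndices σ R, |f (n (σ i) * x) - p (n (σ i) * x)| := by
      refine (Finset.abs_sum_le_sum_abs _ _).trans ?_
      rw [Finset.sum_coe_sort (bigIndices σ R) fun i => |f (n (σ i) * x) - p (n (σ i) * x)|]
      refine Finset.sum_le_sum_of_subset_of_nonneg ?_ fun _ _ _ => abs_nonneg _
      intro i hi
      simp only [bigIndices, Finset.mem_filter, Finset.mem_range, Finset.mem_Ico] at hi ⊢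
      exact ⟨by omega, hi.2⟩
    have h2 : |∑ i ∈ (Finset.Ico M N).filter (fun i => ¬ R < σ i), f (n (σ i) * x)| ≤
        (R + 1) * B := by
      refine (Finset.abs_sum_le_sum_abs _ _).trans ?_
      refine (Finset.sum_le_sum fun i _ => hB _).trans ?_
      rw [Finset.sum_const, nsmul_eq_mul]
      gcongr
      exact_mod_cast card_filter_le_add_one σ R _
    refine (abs_add_le _ _).trans ?_
    linarith

/-! ### The central limit theorem. -/

lemma norm_exp_mul_I_sub_le (u w : ℝ) :
    ‖Complex.exp (u * Complex.I) - Complex.exp (w * Complex.I)‖ ≤ |u - w| := by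
  have e : Complex.exp (u * Complex.I) - Complex.exp (w * Complex.I) =
      Complex.exp (w * Complex.I) * (Complex.exp (Complex.I * ((u - w : ℝ) : ℂ)) - 1) := by
    rw [mul_sub, ← Complex.exp_add]; congr 2; push_cast; ring; ring
  rw [e, norm_mul, Complex.norm_exp_ofReal_mul_I, one_mul]
  simpa using Real.norm_exp_I_mul_ofReal_sub_one_le (x := u - w)

lemma norm_integral_exp_sub_le {X Y D : ℝ → ℝ} (hX : Measurable X) (hY : Measurable Y)
    (hD : Integrable D unitMeasure) (h : ∀ x, |X x - Y x| ≤ D x) :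
    ‖∫ x, Complex.exp (X x * Complex.I) ∂unitMeasure -
      ∫ x, Complex.exp (Y x * Complex.I) ∂unitMeasure‖ ≤ ∫ x, D x ∂unitMeasure := by
  have i : ∀ Z : ℝ → ℝ, Measurable Z →
      Integrable (fun x => Complex.exp (Z x * Complex.I)) unitMeasure := fun Z hZ =>
    Integrable.of_bound (by fun_prop) 1 (ae_of_all _ fun x => by rw [Complex.norm_exp_ofReal_mul_I])
  rw [← integral_sub (i X hX) (i Y hY)]
  exact norm_integral_le_of_norm_le hD (ae_of_all _ fun x =>
    (norm_exp_mul_I_sub_le _ _).trans (h x))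

lemma integral_unitInterval (F : ℝ → ℂ) :
    ∫ x : unitInterval, F x = ∫ x, F x ∂unitMeasure := by
  rw [← integral_Icc_eq_integral_Ioc]
  exact integral_subtype (s := Set.Icc (0 : ℝ) 1) measurableSet_Icc F

lemma measurable_partialSum {f : ℝ → ℝ} (hf : Measurable f) (n : ℕ → ℤ) (N : ℕ) :
    Measurable (partialSum f n N) := by
  unfold partialSum
  exact Finset.measurable_fun_sum _ fun i _ => by fun_prop

/-- An error bound for the characteristic function of a normalized sum at scale `R`. -/
lemma IsScale.norm_charFun_sub_le {f : ℝ → ℝ} (hf : Admissible f) {n : ℕ → ℤ} {σ : Equiv.Perm ℕ}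
    {R m : ℕ} {B C v : ℝ} {p D : ℝ → ℝ} (h : IsScale f n σ R m B C p v D) (hR : 1 ≤ R) {N r : ℕ}
    (hN : N ≤ R ^ 8) (hRN : R ^ 4 ≤ N) (hr0 : r ≠ 0) (hr : 2 * r ≤ m) (t : ℝ) :
    ‖∫ x, Complex.exp ((t * (partialSum f (n ∘ σ) N x / √N) : ℝ) * Complex.I) ∂unitMeasure -
      Real.exp (-(l2Norm f ^ 2 * t ^ 2 / 2))‖ ≤
      |t| * (((R + 1) * B + C / R ^ 8) / R ^ 2) +
      (t ^ 2 * (|t| * B ^ 3 / R ^ 2 + t ^ 2 * B ^ 4 / R ^ 4)) +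
        2 * (Real.exp 1 * B ^ 2 * (t ^ 2 + 1) / (2 * r)) ^ r +
      t ^ 2 * (C / R + B ^ 2 * (R + 1) / R ^ 4) := by
  have hB : 1 ≤ B := h.moments.one_le
  have hR' : (1 : ℝ) ≤ R := by exact_mod_cast hR
  have hRN' : (R : ℝ) ^ 4 ≤ N := by exact_mod_cast hRN
  have hNpos : (0 : ℝ) < N := lt_of_lt_of_le (by positivity) hRN'
  have hsN : (R : ℝ) ^ 2 ≤ √N := Real.le_sqrt_of_sq_le (by rw [← pow_mul]; exact hRN')
  have hsN0 : 0 < √(N : ℝ) := Real.sqrt_pos.2 hNpos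
  have hsq : √(N : ℝ) ^ 2 = N := Real.sq_sqrt hNpos.le
  -- Each weight is at most `|t| / √N ≤ |t| / R ^ 2`, which makes the cubic and quartic error terms
  -- small.
  set c : bigIndices σ R → ℝ := fun i => t / √N * indicatorWeight 0 N i with hc
  have hcsq : ∑ i, c i ^ 2 = t ^ 2 / N * ∑ i : bigIndices σ R, indicatorWeight 0 N i ^ 2 := by
    rw [Finset.mul_sum]
    refine Finset.sum_congr rfl fun i _ => ?_
    rw [hc]; simp only [mul_pow, div_pow, hsq]
  have hq1 := sum_indicatorWeight_sq_le (σ := σ) (R := R) (Nat.zero_le N) hN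
  have hq2 := le_sum_indicatorWeight_sq (σ := σ) (R := R) (Nat.zero_le N) hN
  simp only [Nat.cast_zero, sub_zero] at hq1 hq2
  set q := ∑ i : bigIndices σ R, indicatorWeight 0 N i ^ 2 with hq
  have hq0 : 0 ≤ q := Finset.sum_nonneg fun i _ => sq_nonneg _
  have hcle : ∑ i, c i ^ 2 ≤ t ^ 2 := by
    rw [hcsq, div_mul_eq_mul_div, div_le_iff₀ hNpos]
    exact mul_le_mul_of_nonneg_left hq1 (sq_nonneg _)
  have habs : ∀ i, |c i| ≤ |t| / R ^ 2 := fun i => by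
    simp only [hc, abs_mul, abs_div, abs_of_pos hsN0]
    calc _ ≤ |t| / √N * 1 := by gcongr; exact abs_indicatorWeight_le _ _ _
      _ ≤ _ := by rw [mul_one]; gcongr
  have key := h.moments.norm_charFun_sub_le c hr0 hr (Q := t ^ 2 + 1) (by positivity)
    (hcle.trans (by linarith))
  -- replacing `f` by the trigonometric polynomial
  have s1 : ‖∫ x, Complex.exp ((t * (partialSum f (n ∘ σ) N x / √N) : ℝ) * Complex.I) ∂unitMeasure -
      ∫ x, Complex.exp ((∑ i, c i * p (n (σ i) * x) : ℝ) * Complex.I) ∂unitMeasure‖ ≤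
      |t| * (((R + 1) * B + C / R ^ 8) / R ^ 2) := by
    have hDi : Integrable (fun x => |t| / R ^ 2 * ((R + 1) * B + D x)) unitMeasure :=
      ((integrable_const _).add h.integrable).const_mul _
    refine (norm_integral_exp_sub_le (((measurable_partialSum hf.measurable _ _).div_const _).const_mul
      _) (h.moments.measurable_sum_dilate c) hDi fun x => ?_).trans ?_
    · have e1 : t * (partialSum f (n ∘ σ) N x / √N) - ∑ i, c i * p (n (σ i) * x) =
          t / √N * (∑ i ∈ Finset.Ico 0 N, f (n (σ i) * x) -
            ∑ i : bigIndices σ R, indicatorWeight 0 N i * p (n (σ i) * x)) := by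
        rw [mul_sub, Finset.mul_sum Finset.univ, partialSum, Finset.range_eq_Ico]
        simp only [hc, Function.comp, mul_assoc]
        congr 1
        ring
      rw [e1, abs_mul, abs_div, abs_of_pos hsN0]
      have := h.abs_sub_le x 0 N (Nat.zero_le _) hN
      have h0 : 0 ≤ (R + 1) * B + D x := (abs_nonneg _).trans this
      gcongr
    · rw [integral_const_mul, integral_add (integrable_const _) h.integrable]
      have := h.integral_le
      simp only [integral_const, probReal_univ, one_smul]
      rw [div_mul_eq_mul_div, mul_div_assoc]
      gcongr
  have s2 : ∑ i, (|c i| ^ 3 * B ^ 3 + c i ^ 4 * B ^ 4) ≤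
      t ^ 2 * (|t| * B ^ 3 / R ^ 2 + t ^ 2 * B ^ 4 / R ^ 4) := by
    have hterm : ∀ i, |c i| ^ 3 * B ^ 3 + c i ^ 4 * B ^ 4 ≤
        c i ^ 2 * (|t| * B ^ 3 / R ^ 2 + t ^ 2 * B ^ 4 / R ^ 4) := by
      intro i
      have e1 : |c i| ^ 3 = c i ^ 2 * |c i| := by rw [← sq_abs (c i)]; ring
      have e2 : c i ^ 4 = c i ^ 2 * |c i| ^ 2 := by rw [sq_abs]; ring
      have e3 : |c i| ^ 2 ≤ (|t| / R ^ 2) ^ 2 := pow_le_pow_left₀ (abs_nonneg _) (habs i) 2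
      have e4 : (|t| / (R : ℝ) ^ 2) ^ 2 = t ^ 2 / R ^ 4 := by rw [div_pow, sq_abs, ← pow_mul]
      rw [e1, e2, mul_add, mul_assoc, mul_assoc]
      have f1 : |c i| * B ^ 3 ≤ |t| * B ^ 3 / R ^ 2 := by
        calc _ ≤ |t| / R ^ 2 * B ^ 3 := by gcongr; exact habs i
          _ = _ := by ring
      have f2 : |c i| ^ 2 * B ^ 4 ≤ t ^ 2 * B ^ 4 / R ^ 4 := by
        calc _ ≤ (t ^ 2 / R ^ 4) * B ^ 4 := by gcongr; rw [← e4]; exact e3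
          _ = _ := by ring
      gcongr
    refine (Finset.sum_le_sum fun i _ => hterm i).trans ?_
    rw [← Finset.sum_mul]
    gcongr
  -- Two variance errors: `v` against `‖f‖²`, and the proportion of discarded positions, at most `(R
  -- + 1) / R ^ 4`. Both pass through the function `exp (-·)`, which is 1-Lipschitz on the
  -- nonnegative half-line.
  have s3 : ‖((Real.exp (-(v * (∑ i, c i ^ 2) / 2)) : ℝ) : ℂ) -
      (Real.exp (-(l2Norm f ^ 2 * t ^ 2 / 2)) : ℝ)‖ ≤
      t ^ 2 * (C / R + B ^ 2 * (R + 1) / R ^ 4) := by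
    rw [← Complex.ofReal_sub, Complex.norm_real, Real.norm_eq_abs]
    have hexp : ∀ a b : ℝ, 0 ≤ a → 0 ≤ b → |Real.exp (-a) - Real.exp (-b)| ≤ |a - b| := by
      have aux : ∀ a b : ℝ, 0 ≤ a → a ≤ b → |Real.exp (-a) - Real.exp (-b)| ≤ |a - b| := by
        intro a b ha hab
        have h1 : Real.exp (-b) ≤ Real.exp (-a) := Real.exp_le_exp.2 (by linarith)
        rw [abs_of_nonneg (by linarith), abs_of_nonpos (by linarith)]
        have h2 : Real.exp (-b) = Real.exp (-a) * Real.exp (a - b) := by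
          rw [← Real.exp_add]; congr 1; ring
        have h3 := Real.add_one_le_exp (a - b)
        have h4 : Real.exp (-a) ≤ 1 := Real.exp_le_one_iff.2 (by linarith)
        have h5 := Real.exp_pos (-a)
        rw [h2]; nlinarith
      intro a b ha hb
      rcases le_total a b with hab | hab
      · exact aux a b ha hab
      · rw [abs_sub_comm, abs_sub_comm a b]; exact aux b a hb hab
    have hv0 := h.moments.variance_nonneg
    have hvB := h.moments.variance_le
    refine (hexp _ _ (by positivity) (by positivity)).trans ?_
    rw [hcsq]
    have e1 : v * (t ^ 2 / N * q) / 2 - l2Norm f ^ 2 * t ^ 2 / 2 =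
        t ^ 2 * ((v - l2Norm f ^ 2) / 2 - v * ((N - q) / N) / 2) := by
      field_simp; ring
    rw [e1, abs_mul, abs_of_nonneg (sq_nonneg t)]
    gcongr
    refine (abs_sub _ _).trans (add_le_add ?_ ?_)
    · have := h.variance
      rw [abs_div, abs_of_pos (by norm_num : (0:ℝ) < 2)]
      have := abs_nonneg (v - l2Norm f ^ 2)
      linarith
    · have h1 : 0 ≤ (N - q) / N := div_nonneg (by linarith) hNpos.le
      rw [abs_of_nonneg (by positivity)]
      have h2 : (N - q) / N ≤ (R + 1) / R ^ 4 := by gcongr; linarith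
      calc v * ((N - q) / N) / 2 ≤ v * ((N - q) / N) := by
            have : 0 ≤ v * ((N - q) / N) := by positivity
            linarith
        _ ≤ B ^ 2 * ((R + 1) / R ^ 4) := by gcongr
        _ = _ := by ring
  have tri := norm_sub_le_norm_sub_add_norm_sub
    (∫ x, Complex.exp ((t * (partialSum f (n ∘ σ) N x / √N) : ℝ) * Complex.I) ∂unitMeasure)
    (∫ x, Complex.exp ((∑ i, c i * p (n (σ i) * x) : ℝ) * Complex.I) ∂unitMeasure)
    ((Real.exp (-(l2Norm f ^ 2 * t ^ 2 / 2)) : ℝ) : ℂ)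
  have tri2 := norm_sub_le_norm_sub_add_norm_sub
    (∫ x, Complex.exp ((∑ i, c i * p (n (σ i) * x) : ℝ) * Complex.I) ∂unitMeasure)
    ((Real.exp (-(v * (∑ i, c i ^ 2) / 2)) : ℝ) : ℂ)
    ((Real.exp (-(l2Norm f ^ 2 * t ^ 2 / 2)) : ℝ) : ℂ)
  linarith

lemma tendsto_nat_sqrt : Tendsto Nat.sqrt atTop atTop := by
  refine tendsto_atTop.2 fun b => ?_
  filter_upwards [eventually_ge_atTop (b * b)] with N hN
  exact Nat.le_sqrt.2 hN

/-- Convergence of the characteristic functions of the normalized sums. -/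
lemma tendsto_charFun_partialSum {n : ℕ → ℤ} {W : ℕ → ℕ} (hn : NoRelations n W) (hW : Monotone W)
    (hWlim : Tendsto W atTop atTop) {f : ℝ → ℝ} (hf : Admissible f) (σ : Equiv.Perm ℕ) (t : ℝ) :
    Tendsto (fun N : ℕ => ∫ x, Complex.exp ((t * (partialSum f (n ∘ σ) N x / √N) : ℝ) * Complex.I)
      ∂unitMeasure) atTop (𝓝 (Real.exp (-(l2Norm f ^ 2 * t ^ 2 / 2)) : ℝ)) := by
  obtain ⟨B, C, hB, hC, hscale⟩ := exists_scale hn hW hWlim hf σ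
  set r : ℕ → ℕ := fun R => W R / 2 with hr
  have hrlim : Tendsto r atTop atTop := by
    refine tendsto_atTop.2 fun b => ?_
    filter_upwards [hWlim.eventually_ge_atTop (2 * b)] with R hR
    rw [hr]; simp only; omega
  have hRlim : Tendsto (fun R : ℕ => (R : ℝ)) atTop atTop := tendsto_natCast_atTop_atTop
  have hinv : ∀ k : ℕ, k ≠ 0 → Tendsto (fun R : ℕ => ((R : ℝ) ^ k)⁻¹) atTop (𝓝 0) := fun k hk =>
    tendsto_inv_atTop_zero.comp ((tendsto_pow_atTop hk).comp hRlim)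
  set err : ℕ → ℝ := fun R => |t| * (((R + 1) * B + C / R ^ 8) / R ^ 2) +
      (t ^ 2 * (|t| * B ^ 3 / R ^ 2 + t ^ 2 * B ^ 4 / R ^ 4)) +
        2 * (Real.exp 1 * B ^ 2 * (t ^ 2 + 1) / (2 * r R)) ^ r R +
      t ^ 2 * (C / R + B ^ 2 * (R + 1) / R ^ 4) with herr
  have herr0 : Tendsto err atTop (𝓝 0) := by
    have p1 : Tendsto (fun R : ℕ => |t| * (((R + 1) * B + C / R ^ 8) / R ^ 2)) atTop (𝓝 0) := by
      have : Tendsto (fun R : ℕ => |t| * (B * ((R : ℝ) ^ 1)⁻¹ + B * ((R : ℝ) ^ 2)⁻¹ +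
          C * ((R : ℝ) ^ 10)⁻¹)) atTop (𝓝 (|t| * (B * 0 + B * 0 + C * 0))) :=
        ((((hinv 1 (by norm_num)).const_mul B).add ((hinv 2 (by norm_num)).const_mul B)).add
          ((hinv 10 (by norm_num)).const_mul C)).const_mul _
      simp only [mul_zero, add_zero] at this
      refine this.congr' ?_
      filter_upwards [eventually_ge_atTop 1] with R hR
      have : (R : ℝ) ≠ 0 := by positivity
      field_simp
    have p2 : Tendsto (fun R : ℕ => t ^ 2 * (|t| * B ^ 3 / R ^ 2 + t ^ 2 * B ^ 4 / R ^ 4)) atTop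
        (𝓝 0) := by
      have := (((hinv 2 (by norm_num)).const_mul (|t| * B ^ 3)).add
        ((hinv 4 (by norm_num)).const_mul (t ^ 2 * B ^ 4))).const_mul (t ^ 2)
      simpa only [mul_zero, add_zero, ← div_eq_mul_inv] using this
    have p3 : Tendsto (fun R : ℕ => 2 * (Real.exp 1 * B ^ 2 * (t ^ 2 + 1) / (2 * r R)) ^ r R) atTop
        (𝓝 0) := by
      have h1 : Tendsto (fun R => 2 * ((1 : ℝ) / 2) ^ r R) atTop (𝓝 (2 * 0)) :=
        ((tendsto_pow_atTop_nhds_zero_of_lt_one (by norm_num) (by norm_num)).comp hrlim).const_mul 2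
      rw [mul_zero] at h1
      refine squeeze_zero' (Eventually.of_forall fun R => by positivity) ?_ h1
      have hr' : Tendsto (fun R => (r R : ℝ)) atTop atTop := tendsto_natCast_atTop_atTop.comp hrlim
      filter_upwards [hr'.eventually_ge_atTop (Real.exp 1 * B ^ 2 * (t ^ 2 + 1)),
        hr'.eventually_ge_atTop 1] with R hR hR1
      gcongr 2 * ?_ ^ _
      rw [div_le_div_iff₀ (by positivity) (by norm_num)]
      linarith
    have p4 : Tendsto (fun R : ℕ => t ^ 2 * (C / R + B ^ 2 * (R + 1) / R ^ 4)) atTop (𝓝 0) := by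
      have : Tendsto (fun R : ℕ => t ^ 2 * (C * ((R : ℝ) ^ 1)⁻¹ + B ^ 2 * ((R : ℝ) ^ 3)⁻¹ +
          B ^ 2 * ((R : ℝ) ^ 4)⁻¹)) atTop (𝓝 (t ^ 2 * (C * 0 + B ^ 2 * 0 + B ^ 2 * 0))) :=
        ((((hinv 1 (by norm_num)).const_mul C).add ((hinv 3 (by norm_num)).const_mul (B ^ 2))).add
          ((hinv 4 (by norm_num)).const_mul (B ^ 2))).const_mul _
      simp only [mul_zero, add_zero] at this
      refine this.congr' ?_
      filter_upwards [eventually_ge_atTop 1] with R hR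
      have : (R : ℝ) ≠ 0 := by positivity
      field_simp
      ring
    have := ((p1.add p2).add p3).add p4
    simpa only [add_zero] using this
  have hbig : ∀ᶠ R in atTop, ∀ N, N ≤ R ^ 8 → R ^ 4 ≤ N →
      ‖∫ x, Complex.exp ((t * (partialSum f (n ∘ σ) N x / √N) : ℝ) * Complex.I) ∂unitMeasure -
      Real.exp (-(l2Norm f ^ 2 * t ^ 2 / 2))‖ ≤ err R := by
    filter_upwards [hscale, eventually_ge_atTop 1, hrlim.eventually_ge_atTop 1]
      with R ⟨p, v, D, hs⟩ hR hr1 N h1 h2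
    exact hs.norm_charFun_sub_le hf hR h1 h2 (by omega) (by rw [hr]; simp only; omega) t
  -- The scale is the integer fourth root of `N`. Then `R ^ 4 ≤ N < (R + 1) ^ 4 ≤ R ^ 8`, the last
  -- step using `R ≥ 2`.
  have hcomp : Tendsto (fun N => Nat.sqrt (Nat.sqrt N)) atTop atTop :=
    tendsto_nat_sqrt.comp tendsto_nat_sqrt
  refine tendsto_iff_norm_sub_tendsto_zero.2 ?_
  refine squeeze_zero' (Eventually.of_forall fun _ => norm_nonneg _) ?_ (herr0.comp hcomp)
  filter_upwards [hcomp.eventually hbig, hcomp.eventually_ge_atTop 2] with N hN h2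
  refine hN N ?_ ?_
  · set R := Nat.sqrt (Nat.sqrt N) with hR
    have e1 : Nat.sqrt N < (R + 1) ^ 2 := Nat.lt_succ_sqrt' _
    have e2 : N < (Nat.sqrt N + 1) ^ 2 := Nat.lt_succ_sqrt' _
    have e3 : R + 1 ≤ R ^ 2 := by nlinarith
    have e4 : N < ((R + 1) ^ 2) ^ 2 := e2.trans_le (Nat.pow_le_pow_left (by omega) 2)
    calc N ≤ ((R + 1) ^ 2) ^ 2 := e4.le
      _ ≤ ((R ^ 2) ^ 2) ^ 2 := by gcongr
      _ = R ^ 8 := by ring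
  · set R := Nat.sqrt (Nat.sqrt N) with hR
    calc R ^ 4 = (R ^ 2) ^ 2 := by ring
      _ ≤ (Nat.sqrt N) ^ 2 := Nat.pow_le_pow_left (Nat.sqrt_le' _) 2
      _ ≤ N := Nat.sqrt_le' _

theorem satisfiesCLT_of_noRelations {n : ℕ → ℤ} {W : ℕ → ℕ} (hn : NoRelations n W) (hW : Monotone W)
    (hWlim : Tendsto W atTop atTop) {f : ℝ → ℝ} (hf : Admissible f) (σ : Equiv.Perm ℕ) :
    SatisfiesCLT f (n ∘ σ) := by
  have hm : ∀ N : ℕ, Measurable fun x : unitInterval => partialSum f (n ∘ σ) N (x : ℝ) / √(N : ℝ) :=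
    fun N => ((measurable_partialSum hf.measurable _ _).comp measurable_subtype_coe).div_const _
  refine ⟨fun N => (hm N).aemeasurable, measurable_id.aemeasurable, ?_⟩
  refine ProbabilityMeasure.tendsto_iff_tendsto_charFun.2 fun t => ?_
  have h1 := tendsto_charFun_partialSum hn hW hWlim hf σ t
  simp only [ProbabilityMeasure.coe_mk, Measure.map_id]
  rw [charFun_gaussianReal]
  convert! h1 using 2 with N
  · rw [charFun_apply_real, integral_map (hm N).aemeasurable (by fun_prop)]
    rw [← integral_unitInterval]
    refine integral_congr_ae (ae_of_all _ fun x => ?_)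
    simp only; push_cast; ring_nf
  · push_cast
    rw [Real.coe_toNNReal _ (sq_nonneg _)]
    push_cast
    congr 1; simp

/-! ### Tail bounds from high moments. -/

/-- The Stirling sequence decreases from its first value `e / √2`. The factor `e ^ (-n)`, lost in
the bound `n ^ n`, is what produces the sharp Gaussian exponent. -/
lemma factorial_le_stirling {n : ℕ} (hn : n ≠ 0) :
    (n.factorial : ℝ) ≤ Real.exp 1 * n * (n / Real.exp 1) ^ n := by
  obtain ⟨k, rfl⟩ := Nat.exists_eq_succ_of_ne_zero hn
  have h1 := Stirling.stirlingSeq'_antitone (Nat.zero_le k)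
  simp only [Function.comp, Nat.succ_eq_add_one, zero_add] at h1
  rw [Stirling.stirlingSeq_one, Stirling.stirlingSeq] at h1
  have hk : (0 : ℝ) < ((k + 1 : ℕ) : ℝ) := by positivity
  rw [div_le_iff₀ (by positivity)] at h1
  have h2 : Real.exp 1 / √2 * (√(2 * ((k + 1 : ℕ) : ℝ)) * (((k + 1 : ℕ) : ℝ) / Real.exp 1) ^ (k + 1))
      = Real.exp 1 * √((k + 1 : ℕ) : ℝ) * (((k + 1 : ℕ) : ℝ) / Real.exp 1) ^ (k + 1) := by
    rw [Real.sqrt_mul (by norm_num)]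
    field_simp
  rw [h2] at h1
  refine h1.trans ?_
  · have : √((k + 1 : ℕ) : ℝ) ≤ ((k + 1 : ℕ) : ℝ) := by
      rw [Real.sqrt_le_left hk.le]
      have : (1 : ℝ) ≤ ((k + 1 : ℕ) : ℝ) := by exact_mod_cast Nat.succ_pos k
      nlinarith
    gcongr

lemma measureReal_le_integral_pow_div {α : Type*} [MeasurableSpace α] (μ : Measure α)
    [IsProbabilityMeasure μ] {S : α → ℝ} (hS : Measurable S) {K : ℝ} (hK : ∀ a, |S a| ≤ K)
    {lam : ℝ} (hlam : 0 < lam) (r : ℕ) :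
    μ.real {a | lam ≤ |S a|} ≤ (∫ a, S a ^ (2 * r) ∂μ) / lam ^ (2 * r) := by
  have hi : Integrable (fun a => S a ^ (2 * r)) μ :=
    integrable_of_abs_le (by fun_prop) (B := K ^ (2 * r)) fun u => by
      rw [abs_pow]; exact pow_le_pow_left₀ (abs_nonneg _) (hK u) _
  have h1 := mul_meas_ge_le_integral_of_nonneg
    (ae_of_all _ fun a => (even_two_mul r).pow_nonneg (S a)) hi (lam ^ (2 * r))
  rw [le_div_iff₀ (by positivity), mul_comm]
  refine le_trans ?_ h1
  refine mul_le_mul_of_nonneg_left (measureReal_mono ?_) (by positivity)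
  intro a ha
  rw [Set.mem_ofPred_eq] at ha ⊢
  rw [← (even_two_mul r).pow_abs (S a)]
  gcongr

namespace MomentsMatch

variable {ι : Type*} [Fintype ι] {n : ι → ℤ} {p : ℝ → ℝ} {m : ℕ} {B v : ℝ}

/-- A crude tail bound. -/
lemma measureReal_le (h : MomentsMatch n p m B v) (c : ι → ℝ) {r : ℕ} (hr0 : r ≠ 0)
    (hr : 2 * r ≤ m) {Q : ℝ} (hQ : 0 < Q) (hcQ : ∑ i, c i ^ 2 ≤ Q) {lam : ℝ} (hlam : 0 < lam) :
    unitMeasure.real {x | lam ≤ |∑ i, c i * p (n i * x)|} ≤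
      (2 * r * Real.exp 1 * B ^ 2 * Q / lam ^ 2) ^ r := by
  have hr' : (0 : ℝ) < r := by exact_mod_cast Nat.pos_of_ne_zero hr0
  have h1 := measureReal_le_integral_pow_div unitMeasure (h.measurable_sum_dilate c)
    (fun x => h.abs_sum_le c fun i => n i * x) hlam r
  have h2 := h.integral_pow_div_factorial_le c hr0 hr hQ hcQ
  rw [div_le_iff₀ (by positivity)] at h2
  refine h1.trans ?_
  have h3 : ((2 * r).factorial : ℝ) ≤ (2 * r) ^ (2 * r) := by
    exact_mod_cast Nat.factorial_le_pow (2 * r)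
  calc _ ≤ (Real.exp 1 * B ^ 2 * Q / (2 * r)) ^ r * (2 * r) ^ (2 * r) / lam ^ (2 * r) := by
        gcongr
        exact h2.trans (by gcongr)
    _ = _ := by
        rw [pow_mul lam, pow_mul (2 * (r : ℝ)), ← mul_pow, ← div_pow]
        congr 1; field_simp

/-- A tail bound with the sharp Gaussian exponent. -/
lemma measureReal_le_sharp (h : MomentsMatch n p m B v) (c : ι → ℝ) (hc : ∀ i, |c i| ≤ 1)
    {q V lam y : ℝ} (hq : 0 < q) (hcq : ∑ i, c i ^ 2 ≤ q) (hV : 0 < V) (hvV : v ≤ V)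
    (hlam : 0 < lam) (hy : lam ^ 2 = y * (q * V)) (hy2 : 2 ≤ y) (hym : y ≤ m)
    (hs : lam / (q * V) * B ≤ 1) :
    unitMeasure.real {x | lam ≤ |∑ i, c i * p (n i * x)|} ≤
      Real.exp 3 * y * Real.exp (-y / 2 + q * (lam / (q * V)) ^ 3 * B ^ 3) := by
  have hB : 0 < B := zero_lt_one.trans_le h.one_le
  set s := lam / (q * V) with hsdef
  have hs0 : 0 < s := by positivity
  -- The optimal moment order is about `y = lam² / (q V)`. With `s = lam / (q V)` one has `s lam = q
  -- s² V = y`, so the factorial contributes `exp (-y)` and the exponential moment `exp (y / 2)`.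
  -- Rounding `r` down costs the factor `exp 2`.
  set r := ⌊y / 2⌋₊ with hr
  have hr1 : 1 ≤ r := Nat.le_floor (by push_cast; linarith)
  have hr2 : (r : ℝ) ≤ y / 2 := Nat.floor_le (by linarith)
  have hr3 : y / 2 < r + 1 := Nat.lt_floor_add_one _
  have hrm : 2 * r ≤ m := by
    have : ((2 * r : ℕ) : ℝ) ≤ m := by push_cast; linarith
    exact_mod_cast this
  have h1 := measureReal_le_integral_pow_div unitMeasure (h.measurable_sum_dilate c)
    (fun x => h.abs_sum_le c fun i => n i * x) hlam r
  have h2 := h.integral_pow_le_sharp c hc hrm hs0 hs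
  have hsl : s * lam = y := by
    rw [hsdef, div_mul_eq_mul_div, ← sq, hy]; field_simp
  have hsv : q * (s ^ 2 * V) = y := by
    rw [← hsl]; rw [hsdef]; field_simp
  have hv0 := h.variance_nonneg
  have h3 : Real.exp ((∑ i, c i ^ 2) * (s ^ 2 * v / 2 + s ^ 3 * B ^ 3)) ≤
      Real.exp (y / 2 + q * s ^ 3 * B ^ 3) := by
    refine Real.exp_le_exp.2 ?_
    calc _ ≤ q * (s ^ 2 * V / 2 + s ^ 3 * B ^ 3) := by gcongr
      _ = _ := by rw [← hsv]; ring
  have h4 := factorial_le_stirling (n := 2 * r) (by omega)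
  have h5 : ((2 * r).factorial : ℝ) / (s ^ (2 * r) * lam ^ (2 * r)) ≤
      Real.exp 3 * y * Real.exp (-y) := by
    rw [← mul_pow, hsl, div_le_iff₀ (by positivity)]
    refine h4.trans ?_
    push_cast
    have e1 : (2 * (r : ℝ) / Real.exp 1) ^ (2 * r) ≤ y ^ (2 * r) * Real.exp (2 - y) := by
      rw [div_pow, ← Real.exp_nat_mul, div_eq_mul_inv, ← Real.exp_neg]
      gcongr
      · linarith
      · push_cast; linarith
    calc Real.exp 1 * (2 * (r : ℝ)) * (2 * (r : ℝ) / Real.exp 1) ^ (2 * r)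
        ≤ Real.exp 1 * y * (y ^ (2 * r) * Real.exp (2 - y)) := by gcongr; linarith
      _ = _ := by
        have : Real.exp 1 * Real.exp (2 - y) = Real.exp 3 * Real.exp (-y) := by
          rw [← Real.exp_add, ← Real.exp_add]; congr 1; ring
        linear_combination (y * y ^ (2 * r)) * this
  calc _ ≤ _ := h1
    _ ≤ ((2 * r).factorial : ℝ) / s ^ (2 * r) * Real.exp (y / 2 + q * s ^ 3 * B ^ 3) /
        lam ^ (2 * r) := by
        gcongr
        exact h2.trans (by gcongr)
    _ = ((2 * r).factorial : ℝ) / (s ^ (2 * r) * lam ^ (2 * r)) *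
        Real.exp (y / 2 + q * s ^ 3 * B ^ 3) := by field_simp
    _ ≤ Real.exp 3 * y * Real.exp (-y) * Real.exp (y / 2 + q * s ^ 3 * B ^ 3) := by gcongr
    _ = _ := by rw [mul_assoc _ (Real.exp (-y)), ← Real.exp_add]; congr 2; ring

end MomentsMatch

/-! ### The upper half of the law of the iterated logarithm. -/

/-- Dyadic chaining. -/
lemma abs_sub_le_of_dyadic {F : ℕ → ℝ} {lam : ℕ → ℝ} (hlam : ∀ k, 0 ≤ lam k) {j K : ℕ} (hK : K ≤ j)
    (h : ∀ k < K, ∀ b < 2 ^ (j + 1 - k), |F ((b + 1) * 2 ^ k) - F (b * 2 ^ k)| ≤ lam k)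
    {N : ℕ} (hN : N < 2 ^ (j + 1)) :
    |F N - F (N / 2 ^ K * 2 ^ K)| ≤ ∑ k ∈ Finset.range K, lam k := by
  induction K with
  | zero => simp
  | succ K ih =>
    have ih' := ih (by omega) fun k hk => h k (by omega)
    rw [Finset.sum_range_succ]
    have h1 : |F (N / 2 ^ K * 2 ^ K) - F (N / 2 ^ (K + 1) * 2 ^ (K + 1))| ≤ lam K := by
      set b := N / 2 ^ K with hb
      have e1 : N / 2 ^ (K + 1) = b / 2 := by rw [pow_succ, ← Nat.div_div_eq_div_mul]
      have e2 : b / 2 * 2 ^ (K + 1) = (b / 2 * 2) * 2 ^ K := by rw [pow_succ]; ring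
      rw [e1, e2]
      rcases Nat.mod_two_eq_zero_or_one b with h0 | h0
      · have : b / 2 * 2 = b := by omega
        rw [this]; simpa using hlam K
      · have : b = b / 2 * 2 + 1 := by omega
        have hlt : b < 2 ^ (j + 1 - K) := by
          rw [hb, Nat.div_lt_iff_lt_mul (by positivity), ← pow_add]
          rwa [Nat.sub_add_cancel (by omega)]
        have := h K (by omega) (b / 2 * 2) (by omega)
        rwa [← ‹b = b / 2 * 2 + 1›] at this
    calc _ ≤ _ := abs_sub_le _ (F (N / 2 ^ K * 2 ^ K)) _
      _ ≤ _ := add_le_add ih' h1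

lemma indicatorWeight_sub {s : Finset ℕ} {M N : ℕ} (h : M ≤ N) (i : s) :
    indicatorWeight M N i = indicatorWeight 0 N i - indicatorWeight 0 M i := by
  unfold indicatorWeight
  simp only [Finset.mem_Ico]
  by_cases h1 : (i : ℕ) < M
  · rw [if_neg (by omega), if_pos (by omega), if_pos (by omega)]; simp
  · by_cases h2 : (i : ℕ) < N
    · rw [if_pos (by omega), if_pos (by omega), if_neg (by omega)]; simp
    · rw [if_neg (by omega), if_neg (by omega), if_neg (by omega)]; simp

lemma sum_range_pow_sub_le {x : ℝ} (h0 : 0 < x) (h1 : x < 1) {j K : ℕ} (hK : K ≤ j) :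
    ∑ k ∈ Finset.range K, x ^ (j - k) ≤ x ^ (j - K) * (x / (1 - x)) := by
  induction K with
  | zero =>
    have : 0 < 1 - x := by linarith
    simp; positivity
  | succ K ih =>
    rw [Finset.sum_range_succ]
    have := ih (by omega)
    have h2 : 0 < 1 - x := by linarith
    have e : x ^ (j - K) = x ^ (j - (K + 1)) * x := by rw [← pow_succ]; congr 1; omega
    have e2 : x ^ (j - K) * (x / (1 - x)) + x ^ (j - K) = x ^ (j - (K + 1)) * (x / (1 - x)) := by
      rw [e]; field_simp; ring
    linarith

/-- The maximal inequality behind the upper bound in the law of the iterated logarithm: outside a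
small set, all sums over initial segments of dyadic length are bounded. -/
lemma IsScale.exists_exceptional_set {f : ℝ → ℝ} {n : ℕ → ℤ} {σ : Equiv.Perm ℕ}
    {R m : ℕ} {B C v : ℝ} {p D : ℝ → ℝ} (h : IsScale f n σ R m B C p v D) {j l : ℕ} (hlj : l ≤ j)
    (hjR : 2 ^ (j + 1) ≤ R ^ 8) {ε V L A : ℝ} (hε0 : 0 < ε) (hε1 : ε ≤ 1) (hV : 0 < V)
    (hvV : v ≤ V) (hL : 6 ≤ L) (hLm : 8 * L ≤ m) (h1 : 4 * L * B ^ 2 ≤ V * 2 ^ j)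
    (h2 : 64 * L ^ 3 * B ^ 6 ≤ V ^ 3 * 2 ^ j) (hA : A = 8 * Real.exp 1 ^ 2 * B ^ 2) :
    ∃ G : Set ℝ, unitMeasure.real G ≤ C / R ^ 8 +
      (2 ^ (l + 1) + 1) * (Real.exp 4 * (4 * L) * Real.exp (-((1 + ε) * L))) +
        2 * Real.exp (-(2 * L)) ∧
      ∀ x ∉ G, ∀ N, 2 ^ j ≤ N → N < 2 ^ (j + 1) → |partialSum f (n ∘ σ) N x| ≤
        (R + 1) * B + 1 + √(2 * (1 + ε) * L * (N * V)) + √(A * L * 2 ^ j) * (3 * (3 / 4) ^ l) := by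
  have hB1 := h.moments.one_le
  have hB : 0 < B := zero_lt_one.trans_le hB1
  have hA0 : 0 < A := by rw [hA]; positivity
  have hL0 : 0 < L := by linarith
  set S : ℕ → ℕ → ℝ → ℝ := fun M N x =>
    ∑ i : bigIndices σ R, indicatorWeight M N i * p (n (σ i) * x) with hS
  -- The ratio `3 / 4` is geometric, so the increments sum to a multiple of `(3 / 4) ^ l`, and its
  -- square `9 / 16` exceeds the ratio `1 / 2` of the variances. The quotient `8 / 9`, raised to a
  -- power at least `12`, beats the `2 ^ (j + 1 - k)` intervals at level `k`.
  set lam : ℕ → ℝ := fun k => √(A * L * 2 ^ j) * (3 / 4) ^ (j - k) with hlam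
  set Lam : ℕ → ℝ := fun N => √(2 * (1 + ε) * L * (N * V)) with hLam
  have hlam0 : ∀ k, 0 < lam k := fun k => by simp only [hlam]; positivity
  set G0 : Set ℝ := {x | 1 ≤ D x} with hG0
  -- The sharp tail bound is applied only on a grid of `2 ^ l + 1` lengths, with `l` fixed; chaining
  -- with cruder tails fills the gaps.
  set G1 : ℕ → Set ℝ := fun i => {x | Lam (i * 2 ^ (j - l)) ≤ |S 0 (i * 2 ^ (j - l)) x|} with hG1
  set G2 : ℕ → ℕ → Set ℝ := fun k b => {x | lam k ≤ |S (b * 2 ^ k) ((b + 1) * 2 ^ k) x|} with hG2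
  -- the exceptional sets are small
  have m0 : unitMeasure.real G0 ≤ C / R ^ 8 := by
    have := mul_meas_ge_le_integral_of_nonneg (ae_of_all _ h.nonneg) h.integrable 1
    rw [one_mul] at this
    exact this.trans h.integral_le
  have m1 : ∀ i ∈ Finset.Icc (2 ^ l) (2 ^ (l + 1)), unitMeasure.real (G1 i) ≤
      Real.exp 4 * (4 * L) * Real.exp (-((1 + ε) * L)) := by
    intro i hi
    rw [Finset.mem_Icc] at hi
    have hq1 : 2 ^ j ≤ i * 2 ^ (j - l) := by
      calc 2 ^ j = 2 ^ l * 2 ^ (j - l) := by rw [← pow_add]; congr 1; omega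
        _ ≤ _ := by gcongr; exact hi.1
    have hq2 : i * 2 ^ (j - l) ≤ R ^ 8 := by
      refine le_trans ?_ hjR
      calc i * 2 ^ (j - l) ≤ 2 ^ (l + 1) * 2 ^ (j - l) := by gcongr; exact hi.2
        _ = 2 ^ (j + 1) := by rw [← pow_add]; congr 1; omega
    set N := i * 2 ^ (j - l) with hN
    have hq1' : (2 : ℝ) ^ j ≤ N := by exact_mod_cast hq1
    have hN0 : (0 : ℝ) < N := lt_of_lt_of_le (by positivity) hq1'
    have hy : Lam N ^ 2 = (2 * (1 + ε) * L) * (N * V) := Real.sq_sqrt (by positivity)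
    have hLam0 : 0 < Lam N := Real.sqrt_pos.2 (by positivity)
    set s := Lam N / (N * V) with hs
    have hs0 : 0 < s := by positivity
    have hs2 : s ^ 2 = 2 * (1 + ε) * L / (N * V) := by rw [hs, div_pow, hy]; field_simp
    have hs2le : s ^ 2 ≤ 4 * L / (N * V) := by rw [hs2]; gcongr; linarith
    have hsB : s * B ≤ 1 := by
      refine (sq_le_one_iff₀ (by positivity)).1 ?_
      rw [mul_pow]
      calc s ^ 2 * B ^ 2 ≤ 4 * L / (N * V) * B ^ 2 := by gcongr
        _ = 4 * L * B ^ 2 / (N * V) := by ring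
        _ ≤ 1 := by
          rw [div_le_one (by positivity)]
          nlinarith
    -- The cubic correction costs at most a factor `exp 1`, whence `exp 4` in place of `exp 3`.
    have hs3 : N * s ^ 3 * B ^ 3 ≤ 1 := by
      refine (sq_le_one_iff₀ (by positivity)).1 ?_
      calc (N * s ^ 3 * B ^ 3) ^ 2 = N ^ 2 * (s ^ 2) ^ 3 * B ^ 6 := by ring
        _ ≤ N ^ 2 * (4 * L / (N * V)) ^ 3 * B ^ 6 := by gcongr
        _ = 64 * L ^ 3 * B ^ 6 / (V ^ 3 * N) := by field_simp; ring
        _ ≤ 1 := by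
          rw [div_le_one (by positivity)]
          have : V ^ 3 * 2 ^ j ≤ V ^ 3 * N := by gcongr
          linarith
    have := h.moments.measureReal_le_sharp (indicatorWeight 0 N) (abs_indicatorWeight_le 0 N)
      (q := N) hN0 (by simpa using sum_indicatorWeight_sq_le (σ := σ) (Nat.zero_le N) hq2) hV hvV
      hLam0 hy (by nlinarith) (by nlinarith) hsB
    refine this.trans ?_
    rw [← hs]
    calc _ ≤ Real.exp 3 * (4 * L) * Real.exp (-(2 * (1 + ε) * L) / 2 + 1) := by
          gcongr
          linarith
      _ = _ := by
        have : -(2 * (1 + ε) * L) / 2 + 1 = 1 + -((1 + ε) * L) := by ring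
        rw [this, Real.exp_add, show (4 : ℝ) = 3 + 1 by norm_num, Real.exp_add]; ring
  have m2 : ∀ k ∈ Finset.range (j - l), ∀ b ∈ Finset.range (2 ^ (j + 1 - k)),
      unitMeasure.real (G2 k b) ≤ Real.exp (-(2 * L)) * (1 / 4) ^ (j - k) := by
    intro k hk b hb
    rw [Finset.mem_range] at hk hb
    have hN : (b + 1) * 2 ^ k ≤ R ^ 8 := by
      refine le_trans ?_ hjR
      calc (b + 1) * 2 ^ k ≤ 2 ^ (j + 1 - k) * 2 ^ k := by gcongr; exact hb
        _ = 2 ^ (j + 1) := by rw [← pow_add]; congr 1; omega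
    set r := ⌈2 * L⌉₊ with hr
    have hr1 : 2 * L ≤ r := Nat.le_ceil _
    have hr2 : (r : ℝ) < 2 * L + 1 := Nat.ceil_lt_add_one (by positivity)
    have hr12 : 12 ≤ r := by
      have : (12 : ℝ) ≤ r := by linarith
      exact_mod_cast this
    have hrm : 2 * r ≤ m := by
      have : ((2 * r : ℕ) : ℝ) ≤ m := by push_cast; linarith
      exact_mod_cast this
    have hQ := sum_indicatorWeight_sq_le (σ := σ) (R := R) (M := b * 2 ^ k) (N := (b + 1) * 2 ^ k)
      (by gcongr; omega) hN
    have hQ' : (((b + 1) * 2 ^ k : ℕ) : ℝ) - ((b * 2 ^ k : ℕ) : ℝ) = 2 ^ k := by push_cast; ring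
    rw [hQ'] at hQ
    have := h.moments.measureReal_le (indicatorWeight (b * 2 ^ k) ((b + 1) * 2 ^ k))
      (by omega) hrm (by positivity) hQ (hlam0 k)
    refine this.trans ?_
    have e1 : lam k ^ 2 = A * L * 2 ^ j * (9 / 16) ^ (j - k) := by
      simp only [hlam]
      rw [mul_pow, Real.sq_sqrt (by positivity), ← pow_mul, mul_comm _ 2, pow_mul]; norm_num
    have e2 : (2 : ℝ) ^ j = 2 ^ k * 2 ^ (j - k) := by rw [← pow_add]; congr 1; omega
    have e3 : 2 * r * Real.exp 1 * B ^ 2 * 2 ^ k / lam k ^ 2 =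
        (2 * r * Real.exp 1 * B ^ 2 / (A * L)) * (8 / 9) ^ (j - k) := by
      have e4 : (8 / 9 : ℝ) ^ (j - k) = 1 / (2 ^ (j - k) * (9 / 16) ^ (j - k)) := by
        rw [← mul_pow, ← one_div_pow]; norm_num
      rw [e1, e2, e4]
      field_simp
    -- The constant `A` is chosen so that this base is at most `exp (-1)`; here `2 r ≤ 8 L`.
    have e5 : 2 * r * Real.exp 1 * B ^ 2 / (A * L) ≤ Real.exp (-1) := by
      rw [div_le_iff₀ (by positivity), hA, Real.exp_neg]
      have : (Real.exp 1)⁻¹ * (8 * Real.exp 1 ^ 2 * B ^ 2 * L) = 8 * L * (Real.exp 1 * B ^ 2) := by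
        field_simp
      rw [this]
      have : 0 < Real.exp 1 * B ^ 2 := by positivity
      nlinarith
    rw [e3, mul_pow]
    gcongr ?_ * ?_
    · calc _ ≤ Real.exp (-1) ^ r := by gcongr
        _ = Real.exp (-(r : ℝ)) := by rw [← Real.exp_nat_mul]; congr 1; ring
        _ ≤ _ := Real.exp_le_exp.2 (by linarith)
    · rw [← pow_mul, mul_comm, pow_mul]
      gcongr
      calc (8 / 9 : ℝ) ^ r ≤ (8 / 9) ^ 12 :=
            pow_le_pow_of_le_one (by norm_num) (by norm_num) hr12
        _ ≤ 1 / 4 := by norm_num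
  refine ⟨G0 ∪ ((⋃ i ∈ Finset.Icc (2 ^ l) (2 ^ (l + 1)), G1 i) ∪
    ⋃ k ∈ Finset.range (j - l), ⋃ b ∈ Finset.range (2 ^ (j + 1 - k)), G2 k b), ?_, ?_⟩
  · refine (measureReal_union_le _ _).trans ?_
    rw [add_assoc]
    refine add_le_add m0 ((measureReal_union_le _ _).trans (add_le_add ?_ ?_))
    · refine (measureReal_biUnion_finset_le _ _).trans ((Finset.sum_le_sum m1).trans ?_)
      rw [Finset.sum_const, nsmul_eq_mul]
      gcongr
      have : (Finset.Icc (2 ^ l) (2 ^ (l + 1))).card ≤ 2 ^ (l + 1) + 1 := by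
        rw [Nat.card_Icc]; exact Nat.sub_le _ _
      exact_mod_cast this
    · refine (measureReal_biUnion_finset_le _ _).trans ?_
      calc _ ≤ ∑ k ∈ Finset.range (j - l), 2 * Real.exp (-(2 * L)) * (1 / 2) ^ (j - k) := by
            refine Finset.sum_le_sum fun k hk => ?_
            refine (measureReal_biUnion_finset_le _ _).trans
              ((Finset.sum_le_sum (m2 k hk)).trans ?_)
            rw [Finset.sum_const, nsmul_eq_mul, Finset.card_range]
            have hk' := Finset.mem_range.1 hk
            rw [show j + 1 - k = (j - k) + 1 by omega, pow_succ]
            push_cast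
            have e : (1 / 2 : ℝ) ^ (j - k) = 2 ^ (j - k) * (1 / 4) ^ (j - k) := by
              rw [← mul_pow]; norm_num
            rw [e]
            exact le_of_eq (by ring)
        _ ≤ _ := by
            rw [← Finset.mul_sum]
            have := sum_range_pow_sub_le (x := 1 / 2) (by norm_num) (by norm_num)
              (Nat.sub_le j l)
            have h3 : (1 / 2 : ℝ) ^ (j - (j - l)) ≤ 1 := pow_le_one₀ (by norm_num) (by norm_num)
            have h4 : ∑ k ∈ Finset.range (j - l), (1 / 2 : ℝ) ^ (j - k) ≤ 1 := by
              refine this.trans ?_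
              norm_num at h3 ⊢
              exact h3
            have := Real.exp_pos (-(2 * L))
            nlinarith
  · intro x hx N hN1 hN2
    simp only [Set.mem_union, Set.mem_iUnion, not_or, not_exists, hG0, hG1, hG2,
      Set.mem_ofPred_eq, not_le] at hx
    obtain ⟨hx0, hx1, hx2⟩ := hx
    have c1 := h.abs_sub_le x 0 N (Nat.zero_le _) (by omega)
    have c2 := abs_sub_le_of_dyadic (F := fun M => S 0 M x) (lam := lam) (fun k => (hlam0 k).le)
      (Nat.sub_le j l) (fun k hk b hb => by
        have h5 := hx2 k (Finset.mem_range.2 hk) b (Finset.mem_range.2 hb)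
        have e : S (b * 2 ^ k) ((b + 1) * 2 ^ k) x = S 0 ((b + 1) * 2 ^ k) x - S 0 (b * 2 ^ k) x := by
          simp only [hS]
          rw [← Finset.sum_sub_distrib]
          refine Finset.sum_congr rfl fun i _ => ?_
          rw [indicatorWeight_sub (by gcongr; omega)]; ring
        rw [e] at h5
        exact h5.le) hN2
    set i := N / 2 ^ (j - l) with hi
    have hi1 : 2 ^ l ≤ i := by
      rw [hi, Nat.le_div_iff_mul_le (by positivity), ← pow_add]
      rwa [Nat.add_sub_cancel' hlj]
    have hi2 : i ≤ 2 ^ (l + 1) := by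
      rw [hi, Nat.div_le_iff_le_mul_add_pred (by positivity), mul_comm, ← pow_add]
      rw [show l + 1 + (j - l) = j + 1 by omega]; omega
    have c3 := hx1 i (Finset.mem_Icc.2 ⟨hi1, hi2⟩)
    have c4 : Lam (i * 2 ^ (j - l)) ≤ Lam N := by
      simp only [hLam]
      refine Real.sqrt_le_sqrt ?_
      have : ((i * 2 ^ (j - l) : ℕ) : ℝ) ≤ N := by exact_mod_cast Nat.div_mul_le_self N _
      gcongr
    have c5 : ∑ k ∈ Finset.range (j - l), lam k ≤ √(A * L * 2 ^ j) * (3 * (3 / 4) ^ l) := by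
      simp only [hlam]
      rw [← Finset.mul_sum]
      gcongr
      refine (sum_range_pow_sub_le (by norm_num) (by norm_num) (Nat.sub_le j l)).trans
        (le_of_eq ?_)
      rw [Nat.sub_sub_self hlj]; norm_num; ring
    have e6 : partialSum f (n ∘ σ) N x = ∑ i ∈ Finset.Ico 0 N, f (n (σ i) * x) := by
      rw [partialSum, Finset.range_eq_Ico]; rfl
    rw [e6]
    have t1 := abs_sub_abs_le_abs_sub (∑ i ∈ Finset.Ico 0 N, f (n (σ i) * x)) (S 0 N x)
    have t2 := abs_sub_abs_le_abs_sub (S 0 N x) (S 0 (i * 2 ^ (j - l)) x)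
    simp only [hS] at *
    linarith

lemma ae_eventually_notMem_of_measureReal_le {α : Type*} [MeasurableSpace α] {μ : Measure α}
    [IsProbabilityMeasure μ] {G : ℕ → Set α} {u : ℕ → ℝ} (hu : Summable u) (hu0 : ∀ j, 0 ≤ u j)
    (h : ∀ᶠ j in atTop, μ.real (G j) ≤ u j) : ∀ᵐ x ∂μ, ∀ᶠ j in atTop, x ∉ G j := by
  obtain ⟨j₀, hj₀⟩ := eventually_atTop.1 h
  have hfin : ∑' j, μ (G (j + j₀)) ≠ ⊤ := by
    refine ne_top_of_le_ne_top (b := ENNReal.ofReal (∑' j, u (j + j₀))) ENNReal.ofReal_ne_top ?_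
    rw [ENNReal.ofReal_tsum_of_nonneg (fun j => hu0 _) ((summable_nat_add_iff j₀).2 hu)]
    refine ENNReal.tsum_le_tsum fun j => ?_
    have := hj₀ (j + j₀) (by omega)
    rw [← ofReal_measureReal]
    exact ENNReal.ofReal_le_ofReal this
  filter_upwards [ae_eventually_notMem hfin] with x hx
  obtain ⟨j₁, hj₁⟩ := eventually_atTop.1 hx
  refine eventually_atTop.2 ⟨j₀ + j₁, fun j hj => ?_⟩
  have := hj₁ (j - j₀) (by omega)
  rwa [Nat.sub_add_cancel (by omega)] at this

lemma tendsto_log_natCast : Tendsto (fun j : ℕ => Real.log j) atTop atTop :=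
  Real.tendsto_log_atTop.comp tendsto_natCast_atTop_atTop

/-- Along `k = q ^ J`, the order of independence beats any multiple of `log J`, even after raising
the logarithm to a power. -/
lemma eventually_rpow_le_order {W : ℕ → ℕ} {β : ℝ} (hβ : 0 < β)
    (hlog : ∀ᶠ k : ℕ in atTop, Real.log k ^ β ≤ W k) {q : ℕ} (hq : 2 ≤ q) :
    ∀ᶠ J : ℕ in atTop, ((J : ℝ) / 2) ^ β ≤ W (q ^ J) := by
  have hlim : Tendsto (fun J : ℕ => q ^ J) atTop atTop := tendsto_pow_atTop_atTop_of_one_lt (by omega)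
  filter_upwards [hlim.eventually hlog] with J hJ
  refine le_trans ?_ hJ
  have h2 : (1 : ℝ) / 2 ≤ Real.log q := by
    have := Real.log_two_gt_d9
    have := Real.log_le_log (by norm_num) (by exact_mod_cast hq : (2 : ℝ) ≤ q)
    linarith
  refine Real.rpow_le_rpow (by positivity) ?_ hβ.le
  push_cast
  rw [Real.log_pow]
  nlinarith [(Nat.cast_nonneg J : (0 : ℝ) ≤ J)]

/-- At scale `R = 2 ^ (j / 4)` the logarithm of `R` is of order `j`, so the available moment order
is at least a power of `j`, far above the order `log j ≈ log log N` required. This is where the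
growth of `ω` enters the upper bound. -/
lemma eventually_log_le_order {W : ℕ → ℕ} {β : ℝ} (hβ : 0 < β)
    (hlog : ∀ᶠ k : ℕ in atTop, Real.log k ^ β ≤ W k) :
    ∀ᶠ j : ℕ in atTop, 8 * Real.log j ≤ W (2 ^ (j / 4)) := by
  have hdiv : Tendsto (fun j : ℕ => j / 4) atTop atTop := Nat.tendsto_div_const_atTop (by norm_num)
  have h1 : ∀ᶠ y : ℝ in atTop, 8 * Real.log y ≤ (y / 16) ^ β := by
    have hc : (0 : ℝ) < (1 / 16) ^ β / 8 := by positivity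
    filter_upwards [(isLittleO_log_rpow_atTop hβ).bound hc, eventually_ge_atTop 1] with y hy hy1
    rw [Real.norm_of_nonneg (Real.log_nonneg hy1), Real.norm_of_nonneg (by positivity)] at hy
    have : (y / 16) ^ β = (1 / 16) ^ β * y ^ β := by
      rw [← Real.mul_rpow (by norm_num) (by linarith)]; congr 1; ring
    rw [this]; linarith
  filter_upwards [hdiv.eventually (eventually_rpow_le_order hβ hlog le_rfl),
    (tendsto_natCast_atTop_atTop (R := ℝ)).eventually h1, eventually_ge_atTop 6] with j h2 h3 h6
  refine h3.trans (le_trans ?_ h2)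
  refine Real.rpow_le_rpow (by positivity) ?_ hβ.le
  have h4 : j ≤ 8 * (j / 4) := by omega
  have h5 : (j : ℝ) ≤ 8 * ((j / 4 : ℕ) : ℝ) := by exact_mod_cast h4
  linarith

lemma log_le_loglog_add_one {j N : ℕ} (hj : 1 ≤ j) (hN : 2 ^ j ≤ N) :
    Real.log j ≤ Real.log (Real.log N) + 1 := by
  have hj' : (0 : ℝ) < j := by exact_mod_cast hj
  have h2 := Real.log_two_gt_d9
  have h1 : j * Real.log 2 ≤ Real.log N := by
    rw [← Real.log_pow]
    exact Real.log_le_log (by positivity) (by exact_mod_cast hN)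
  have h3 : Real.log j + Real.log (Real.log 2) ≤ Real.log (Real.log N) := by
    rw [← Real.log_mul hj'.ne' (by linarith)]
    exact Real.log_le_log (by positivity) h1
  have h4 : -1 ≤ Real.log (Real.log 2) := by
    rw [Real.le_log_iff_exp_le (by linarith)]
    have h5 := Real.exp_one_gt_d9
    rw [Real.exp_neg]
    calc (Real.exp 1)⁻¹ ≤ 2⁻¹ := by gcongr; linarith
      _ ≤ _ := by norm_num; linarith
  linarith

/-- The scale `R = 2 ^ (j / 4)` covers lengths up to `2 ^ (j + 1) ≤ R ^ 8`, while `R ^ 4 ≤ 2 ^ j`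
keeps the uncontrolled terms small. With `L = log j` the main exceptional probability is of order `j
^ (-1-ε) log j`, which is summable. Thirds of `δ` pay for the uncontrolled terms, the inflation of
the main term, and the chaining. -/
theorem ae_eventually_abs_partialSum_le {n : ℕ → ℤ} {W : ℕ → ℕ} (hn : NoRelations n W)
    (hW : Monotone W) (hWlim : Tendsto W atTop atTop) {β : ℝ} (hβ : 0 < β)
    (hlog : ∀ᶠ k : ℕ in atTop, Real.log k ^ β ≤ W k) {f : ℝ → ℝ} (hf : Admissible f)
    (σ : Equiv.Perm ℕ) {δ : ℝ} (hδ : 0 < δ) :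
    ∀ᵐ x ∂unitMeasure, ∀ᶠ N : ℕ in atTop, |partialSum f (n ∘ σ) N x| ≤
      (l2Norm f + δ) * √(2 * N * Real.log (Real.log N)) := by
  obtain ⟨B, C, hB, hC, hscale⟩ := exists_scale hn hW hWlim hf σ
  have hnorm : 0 ≤ l2Norm f := Real.sqrt_nonneg _
  set A := 8 * Real.exp 1 ^ 2 * B ^ 2 with hA
  -- choice of the parameters
  obtain ⟨ε, hε0, hε1, hε⟩ : ∃ ε : ℝ, 0 < ε ∧ ε ≤ 1 ∧
      (1 + ε) * √(l2Norm f ^ 2 + ε) ≤ l2Norm f + δ / 3 := by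
    have hcont : Continuous fun ε : ℝ => (1 + ε) * √(l2Norm f ^ 2 + ε) := by fun_prop
    have h0 : (1 + (0 : ℝ)) * √(l2Norm f ^ 2 + 0) < l2Norm f + δ / 3 := by
      rw [add_zero, add_zero, one_mul, Real.sqrt_sq hnorm]; linarith
    have h1 : ∀ᶠ ε in 𝓝[>] (0 : ℝ), (1 + ε) * √(l2Norm f ^ 2 + ε) < l2Norm f + δ / 3 :=
      ((hcont.tendsto 0).eventually_lt_const h0).filter_mono nhdsWithin_le_nhds
    have h2 : ∀ᶠ ε in 𝓝[>] (0 : ℝ), ε ∈ Set.Ioc (0 : ℝ) 1 := Ioc_mem_nhdsGT one_pos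
    obtain ⟨ε, h3, h4⟩ := (h1.and h2).exists
    exact ⟨ε, h4.1, h4.2, h3.le⟩
  obtain ⟨l, hl⟩ : ∃ l : ℕ, √A * (3 * (3 / 4) ^ l) ≤ δ / 3 := by
    have h1 : Tendsto (fun l : ℕ => √A * (3 * (3 / 4 : ℝ) ^ l)) atTop (𝓝 (√A * (3 * 0))) :=
      ((tendsto_pow_atTop_nhds_zero_of_lt_one (by norm_num) (by norm_num)).const_mul 3).const_mul _
    rw [mul_zero, mul_zero] at h1
    exact (h1.eventually_le_const (by positivity)).exists
  set V := l2Norm f ^ 2 + ε with hV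
  have hV0 : 0 < V := by positivity
  set R : ℕ → ℕ := fun j => 2 ^ (j / 4) with hR
  have hdiv : Tendsto (fun j : ℕ => j / 4) atTop atTop := Nat.tendsto_div_const_atTop (by norm_num)
  have hRlim : Tendsto R atTop atTop :=
    (tendsto_pow_atTop_atTop_of_one_lt (by norm_num : 1 < 2)).comp hdiv
  have hRlim' : Tendsto (fun j => (R j : ℝ)) atTop atTop := tendsto_natCast_atTop_atTop.comp hRlim
  have hpow : ∀ (k : ℕ) (c : ℝ), 0 < c → ∀ᶠ j : ℕ in atTop, Real.log j ^ k ≤ c * 2 ^ j := by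
    intro k c hc
    have h1 : ∀ᶠ j : ℕ in atTop, (j : ℝ) ^ k ≤ c * 2 ^ j := by
      have := (isLittleO_pow_const_const_pow_of_one_lt (R := ℝ) k (by norm_num : (1 : ℝ) < 2)).bound hc
      filter_upwards [this] with j hj
      rw [Real.norm_of_nonneg (by positivity), Real.norm_of_nonneg (by positivity)] at hj
      exact hj
    filter_upwards [h1, eventually_ge_atTop 1] with j hj hj1
    refine le_trans ?_ hj
    have : (1 : ℝ) ≤ j := by exact_mod_cast hj1
    exact pow_le_pow_left₀ (Real.log_nonneg this) (Real.log_le_self (by positivity)) k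
  -- the exceptional sets
  set u : ℕ → ℝ := fun j => C / 2 * (1 / 2) ^ j +
      (2 ^ (l + 1) + 1) * (Real.exp 4 * (4 / (ε / 2))) * (1 / (j : ℝ) ^ (1 + ε / 2)) +
        2 * (1 / (j : ℝ) ^ 2) with hu
  have husum : Summable u := by
    refine ((summable_geometric_two.mul_left _).add ?_).add ?_
    · exact (Real.summable_one_div_nat_rpow.2 (by linarith)).mul_left _
    · exact (Real.summable_one_div_nat_pow.2 (by norm_num)).mul_left _
  have hu0 : ∀ j, 0 ≤ u j := fun j => by simp only [hu]; positivity
  have hex : ∀ᶠ j : ℕ in atTop, ∃ G : Set ℝ, unitMeasure.real G ≤ u j ∧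
      ∀ x ∉ G, ∀ N, 2 ^ j ≤ N → N < 2 ^ (j + 1) → |partialSum f (n ∘ σ) N x| ≤
        (R j + 1) * B + 1 + √(2 * (1 + ε) * Real.log j * (N * V)) +
          √(A * Real.log j * 2 ^ j) * (3 * (3 / 4) ^ l) := by
    filter_upwards [hRlim.eventually hscale, eventually_ge_atTop l, eventually_ge_atTop 7,
      tendsto_log_natCast.eventually_ge_atTop 6, eventually_log_le_order hβ hlog,
      hRlim'.eventually_ge_atTop (C / ε), hpow 1 (V / (4 * B ^ 2)) (by positivity),
      hpow 3 (V ^ 3 / (64 * B ^ 6)) (by positivity)] with j ⟨p, v, D, hs⟩ hlj h7 h6 hW8 hCε hp1 hp3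
    have hjR : 2 ^ (j + 1) ≤ R j ^ 8 := by
      simp only [hR]
      rw [← pow_mul]
      exact Nat.pow_le_pow_right (by norm_num) (by omega)
    have hRpos : (0 : ℝ) < R j := by simp only [hR]; positivity
    have hvV : v ≤ V := by
      have := (abs_le.1 hs.variance).2
      have h3 : C / R j ≤ ε := by
        rw [div_le_iff₀ hRpos]
        rw [div_le_iff₀ hε0] at hCε
        linarith
      rw [hV]; linarith
    obtain ⟨G, hG1, hG2⟩ := hs.exists_exceptional_set hlj hjR hε0 hε1 hV0 hvV h6 hW8
      (by rw [pow_one, div_mul_eq_mul_div, le_div_iff₀ (by positivity)] at hp1; linarith)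
      (by rw [div_mul_eq_mul_div, le_div_iff₀ (by positivity)] at hp3; linarith) hA
    refine ⟨G, hG1.trans ?_, hG2⟩
    have hj0 : (0 : ℝ) < j := by positivity
    have e1 : C / (R j : ℝ) ^ 8 ≤ C / 2 * (1 / 2) ^ j := by
      calc C / (R j : ℝ) ^ 8 ≤ C / 2 ^ (j + 1) := by
            gcongr
            exact_mod_cast hjR
        _ = _ := by rw [pow_succ, one_div_pow]; field_simp
    have hexp : ∀ y : ℝ, Real.exp (-(y * Real.log j)) = 1 / (j : ℝ) ^ y := by
      intro y
      rw [Real.exp_neg, mul_comm, ← Real.rpow_def_of_pos hj0, one_div]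
    have e2 : Real.exp (-(2 * Real.log j)) = 1 / (j : ℝ) ^ 2 := by
      rw [hexp]; norm_num
    -- The logarithm is absorbed by half of the surplus exponent `ε`.
    have e3 : 4 * Real.log j * Real.exp (-((1 + ε) * Real.log j)) ≤
        4 / (ε / 2) * (1 / (j : ℝ) ^ (1 + ε / 2)) := by
      rw [hexp]
      have h5 := Real.log_le_rpow_div hj0.le (half_pos hε0)
      have h8 : (j : ℝ) ^ (1 + ε) = (j : ℝ) ^ (1 + ε / 2) * (j : ℝ) ^ (ε / 2) := by
        rw [← Real.rpow_add hj0]; congr 1; ring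
      rw [h8]
      calc _ ≤ 4 * ((j : ℝ) ^ (ε / 2) / (ε / 2)) *
            (1 / ((j : ℝ) ^ (1 + ε / 2) * (j : ℝ) ^ (ε / 2))) := by gcongr
        _ = _ := by
          have : (j : ℝ) ^ (ε / 2) ≠ 0 := (Real.rpow_pos_of_pos hj0 _).ne'
          field_simp
    rw [e2]
    simp only [hu]
    refine add_le_add (add_le_add e1 ?_) le_rfl
    have : (0 : ℝ) ≤ (2 ^ (l + 1) + 1) * Real.exp 4 := by positivity
    calc _ = (2 ^ (l + 1) + 1) * Real.exp 4 *
          (4 * Real.log j * Real.exp (-((1 + ε) * Real.log j))) := by ring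
      _ ≤ _ := mul_le_mul_of_nonneg_left e3 this
      _ = _ := by ring
  obtain ⟨j₀, hj₀⟩ := eventually_atTop.1 hex
  choose! G hG1 hG2 using hj₀
  have hae := ae_eventually_notMem_of_measureReal_le (μ := unitMeasure) husum hu0
    (eventually_atTop.2 ⟨j₀, hG1⟩)
  filter_upwards [hae] with x hx
  have hNlog : Tendsto (fun N : ℕ => Nat.log 2 N) atTop atTop := by
    refine tendsto_atTop.2 fun b => ?_
    filter_upwards [eventually_ge_atTop (2 ^ b)] with N hN
    exact Nat.le_log_of_pow_le (by norm_num) hN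
  have hloglog : Tendsto (fun N : ℕ => Real.log (Real.log N)) atTop atTop :=
    Real.tendsto_log_atTop.comp tendsto_log_natCast
  filter_upwards [hNlog.eventually hx, hNlog.eventually_ge_atTop j₀, hNlog.eventually_ge_atTop 4,
    hloglog.eventually_ge_atTop 1, hloglog.eventually_ge_atTop (1 / ε),
    (hRlim'.comp hNlog).eventually_ge_atTop ((2 * B + 1) * (3 / δ)),
    eventually_ge_atTop 1] with N hxN hjN hj4 hll1 hllε hRN hN1
  set j := Nat.log 2 N with hj
  have hN2 : 2 ^ j ≤ N := Nat.pow_log_le_self 2 (by omega)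
  have hN3 : N < 2 ^ (j + 1) := Nat.lt_pow_succ_log_self (by norm_num) N
  have key := hG2 j hjN x hxN N hN2 hN3
  have hNpos : (0 : ℝ) < N := by positivity
  have hL1 := log_le_loglog_add_one (by omega) hN2
  set LL := Real.log (Real.log N) with hLL
  have hlj0 : 0 ≤ Real.log j := Real.log_natCast_nonneg j
  have hLε : Real.log j ≤ (1 + ε) * LL := by
    rw [div_le_iff₀ hε0] at hllε; linarith
  have hL2 : Real.log j ≤ 2 * LL := by linarith
  have hR1 : (1 : ℝ) ≤ R j := by
    have : 1 ≤ R j := by simp only [hR]; exact Nat.one_le_two_pow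
    exact_mod_cast this
  have t1 : (R j + 1) * B + 1 ≤ δ / 3 * √(2 * N * LL) := by
    simp only [Function.comp] at hRN
    have h1 : (R j : ℝ) ^ 4 ≤ N := by
      have : R j ^ 4 ≤ N := by
        refine le_trans ?_ hN2
        simp only [hR]
        rw [← pow_mul]
        exact Nat.pow_le_pow_right (by norm_num) (by omega)
      exact_mod_cast this
    have h2 : (R j : ℝ) ^ 2 ≤ √(2 * N * LL) := by
      refine Real.le_sqrt_of_sq_le ?_
      have h3 : ((R j : ℝ) ^ 2) ^ 2 = (R j : ℝ) ^ 4 := by ring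
      rw [h3]
      have h4 : (N : ℝ) * 1 ≤ N * LL := mul_le_mul_of_nonneg_left hll1 hNpos.le
      linarith
    calc (R j + 1) * B + 1 ≤ (2 * B + 1) * R j := by nlinarith
      _ = δ / 3 * (((2 * B + 1) * (3 / δ)) * R j) := by field_simp
      _ ≤ δ / 3 * (R j * R j) := by gcongr
      _ ≤ _ := by rw [← sq]; gcongr
  have t2 : √(2 * (1 + ε) * Real.log j * (N * V)) ≤ (1 + ε) * √V * √(2 * N * LL) := by
    rw [← Real.sqrt_sq (by linarith : 0 ≤ 1 + ε), ← Real.sqrt_mul (by positivity),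
      ← Real.sqrt_mul (by positivity), Real.sqrt_sq (by linarith : 0 ≤ 1 + ε)]
    refine Real.sqrt_le_sqrt ?_
    calc 2 * (1 + ε) * Real.log j * (N * V) ≤ 2 * (1 + ε) * ((1 + ε) * LL) * (N * V) := by gcongr
      _ = _ := by ring
  have t3 : √(A * Real.log j * 2 ^ j) ≤ √A * √(2 * N * LL) := by
    rw [← Real.sqrt_mul (by positivity)]
    refine Real.sqrt_le_sqrt ?_
    have : (2 : ℝ) ^ j ≤ N := by exact_mod_cast hN2
    calc A * Real.log j * 2 ^ j ≤ A * (2 * LL) * N := by gcongr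
      _ = _ := by ring
  have hs0 : 0 ≤ √(2 * N * LL) := Real.sqrt_nonneg _
  calc _ ≤ _ := key
    _ ≤ δ / 3 * √(2 * N * LL) + (1 + ε) * √V * √(2 * N * LL) +
        √A * √(2 * N * LL) * (3 * (3 / 4) ^ l) := by gcongr
    _ = (δ / 3 + (1 + ε) * √V + √A * (3 * (3 / 4) ^ l)) * √(2 * N * LL) := by ring
    _ ≤ _ := mul_le_mul_of_nonneg_right (by linarith) hs0

/-! ### The second moment method for nearly independent sums. -/

section SecondMoment

variable {α ι κ : Type*} [MeasurableSpace α] {μ : Measure α} [IsProbabilityMeasure μ]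
  [Fintype κ] {S : ι → α → ℝ} {g : ℝ → ℝ} {a : κ → ℂ} {τ : κ → ℝ}
  {γ : κ → ℝ} {G η : ℝ}

lemma abs_integral_trigSum_sub_le (hS : ∀ j, Measurable (S j)) (ha : ∑ k, ‖a k‖ ≤ 1)
    (hg : ∀ s, (g s : ℂ) = ∑ k, a k * Complex.exp ((τ k * s : ℝ) * Complex.I))
    (hG : (G : ℂ) = ∑ k, a k * γ k) (hη : 0 ≤ η) (j : ι)
    (h : ∀ k, ‖∫ x, Complex.exp ((τ k * S j x : ℝ) * Complex.I) ∂μ - γ k‖ ≤ η) :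
    |∫ x, g (S j x) ∂μ - G| ≤ η := by
  have hint : ∀ k, Integrable (fun x => a k * Complex.exp ((τ k * S j x : ℝ) * Complex.I)) μ := by
    intro k
    refine (Integrable.of_bound (C := 1) ?_ (ae_of_all _ fun x => ?_)).const_mul _
    · have := hS j
      exact (by fun_prop : Measurable _).aestronglyMeasurable
    · rw [Complex.norm_exp_ofReal_mul_I]
  have h1 : ((∫ x, g (S j x) ∂μ : ℝ) : ℂ) =
      ∑ k, a k * ∫ x, Complex.exp ((τ k * S j x : ℝ) * Complex.I) ∂μ := by
    rw [← integral_complex_ofReal]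
    simp_rw [hg]
    rw [integral_finsetSum _ fun k _ => hint k]
    simp_rw [integral_const_mul]
  rw [← Real.norm_eq_abs, ← Complex.norm_real, Complex.ofReal_sub, h1, hG, ← Finset.sum_sub_distrib]
  calc _ ≤ ∑ k, ‖a k‖ * η := by
        refine (norm_sum_le _ _).trans (Finset.sum_le_sum fun k _ => ?_)
        rw [← mul_sub, norm_mul]
        exact mul_le_mul_of_nonneg_left (h k) (norm_nonneg _)
    _ ≤ η := by
        rw [← Finset.sum_mul]
        nlinarith

lemma abs_integral_trigSum_mul_sub_le (hS : ∀ j, Measurable (S j)) (ha : ∑ k, ‖a k‖ ≤ 1)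
    (hg : ∀ s, (g s : ℂ) = ∑ k, a k * Complex.exp ((τ k * s : ℝ) * Complex.I))
    (hG : (G : ℂ) = ∑ k, a k * γ k) (hη : 0 ≤ η) (j j' : ι)
    (h : ∀ k l, ‖∫ x, Complex.exp ((τ k * S j x + τ l * S j' x : ℝ) * Complex.I) ∂μ
      - γ k * γ l‖ ≤ η) :
    |∫ x, g (S j x) * g (S j' x) ∂μ - G ^ 2| ≤ η := by
  have hint : ∀ k l, Integrable (fun x => a k * a l *
      Complex.exp ((τ k * S j x + τ l * S j' x : ℝ) * Complex.I)) μ := by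
    intro k l
    refine (Integrable.of_bound (C := 1) ?_ (ae_of_all _ fun x => ?_)).const_mul _
    · have := hS j
      have := hS j'
      exact (by fun_prop : Measurable _).aestronglyMeasurable
    · rw [Complex.norm_exp_ofReal_mul_I]
  have hprod : ∀ x, ((g (S j x) * g (S j' x) : ℝ) : ℂ) = ∑ k, ∑ l, a k * a l *
      Complex.exp ((τ k * S j x + τ l * S j' x : ℝ) * Complex.I) := by
    intro x
    push_cast
    rw [hg, hg, Finset.sum_mul_sum]
    refine Finset.sum_congr rfl fun k _ => Finset.sum_congr rfl fun l _ => ?_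
    push_cast
    rw [add_mul, Complex.exp_add]
    ring
  have h1 : ((∫ x, g (S j x) * g (S j' x) ∂μ : ℝ) : ℂ) =
      ∑ k, ∑ l, a k * a l *
        ∫ x, Complex.exp ((τ k * S j x + τ l * S j' x : ℝ) * Complex.I) ∂μ := by
    rw [← integral_complex_ofReal]
    simp_rw [hprod]
    rw [integral_finsetSum _ fun k _ => integrable_finsetSum _ fun l _ => hint k l]
    refine Finset.sum_congr rfl fun k _ => ?_
    rw [integral_finsetSum _ fun l _ => hint k l]
    simp_rw [integral_const_mul]
  have h2 : ((G ^ 2 : ℝ) : ℂ) = ∑ k, ∑ l, a k * a l * (γ k * γ l) := by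
    push_cast
    rw [hG, sq, Finset.sum_mul_sum]
    exact Finset.sum_congr rfl fun k _ => Finset.sum_congr rfl fun l _ => by ring
  have ha0 : 0 ≤ ∑ k, ‖a k‖ := Finset.sum_nonneg fun _ _ => norm_nonneg _
  rw [← Real.norm_eq_abs, ← Complex.norm_real, Complex.ofReal_sub, h1, h2]
  simp_rw [← Finset.sum_sub_distrib]
  calc _ ≤ ∑ k, ∑ l, ‖a k‖ * ‖a l‖ * η := by
        refine (norm_sum_le _ _).trans (Finset.sum_le_sum fun k _ => ?_)
        refine (norm_sum_le _ _).trans (Finset.sum_le_sum fun l _ => ?_)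
        rw [← mul_sub, norm_mul, norm_mul]
        exact mul_le_mul_of_nonneg_left (h k l) (by positivity)
    _ = (∑ k, ‖a k‖) * (∑ k, ‖a k‖) * η := by
        rw [Finset.sum_mul_sum, Finset.sum_mul]
        exact Finset.sum_congr rfl fun k _ => by rw [Finset.sum_mul]
    _ ≤ 1 * 1 * η := by gcongr
    _ = η := by ring

/-- A second moment bound for sums of trigonometric test functions of variables whose joint
characteristic functions nearly factorise. -/
lemma measureReal_sum_trigSum_le (hS : ∀ j, Measurable (S j)) (ha : ∑ k, ‖a k‖ ≤ 1)
    (hg : ∀ s, (g s : ℂ) = ∑ k, a k * Complex.exp ((τ k * s : ℝ) * Complex.I))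
    (hgm : Measurable g) (hg0 : ∀ s, 0 ≤ g s) (hg1 : ∀ s, g s ≤ 1)
    (hG : (G : ℂ) = ∑ k, a k * γ k) (hG0 : 0 < G) (hG1 : G ≤ 1) (hη : 0 ≤ η)
    (h1 : ∀ j k, ‖∫ x, Complex.exp ((τ k * S j x : ℝ) * Complex.I) ∂μ - γ k‖ ≤ η)
    (h2 : ∀ j j', j ≠ j' → ∀ k l,
      ‖∫ x, Complex.exp ((τ k * S j x + τ l * S j' x : ℝ) * Complex.I) ∂μ - γ k * γ l‖ ≤ η)
    [Fintype ι] [DecidableEq ι] [Nonempty ι] :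
    μ.real {x | ∑ j, g (S j x) ≤ Fintype.card ι * G / 2} ≤
      4 / (Fintype.card ι * G) + 12 * η / G ^ 2 := by
  have hM : (0 : ℝ) < Fintype.card ι := by exact_mod_cast Fintype.card_pos
  have hgS : ∀ j, Measurable fun x => g (S j x) := fun j => hgm.comp (hS j)
  have hbd : ∀ j, Integrable (fun x => g (S j x)) μ := fun j =>
    Integrable.of_bound (C := 1) (hgS j).aestronglyMeasurable (ae_of_all _ fun x => by
      rw [Real.norm_of_nonneg (hg0 _)]; exact hg1 _)
  have hbd2 : ∀ j j', Integrable (fun x => g (S j x) * g (S j' x)) μ := fun j j' =>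
    Integrable.of_bound (C := 1) ((hgS j).mul (hgS j')).aestronglyMeasurable
      (ae_of_all _ fun x => by
        rw [Real.norm_of_nonneg (mul_nonneg (hg0 _) (hg0 _))]
        exact mul_le_one₀ (hg1 _) (hg0 _) (hg1 _))
  have hE : ∀ j j', Integrable (fun x => (g (S j x) - G) * (g (S j' x) - G)) μ := by
    intro j j'
    have : (fun x => (g (S j x) - G) * (g (S j' x) - G)) = fun x =>
        g (S j x) * g (S j' x) - G * g (S j x) - G * g (S j' x) + G ^ 2 := by ext x; ring
    rw [this]
    exact (((hbd2 j j').sub ((hbd j).const_mul G)).sub ((hbd j').const_mul G)).add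
      (integrable_const _)
  have hEq : ∀ j j', ∫ x, (g (S j x) - G) * (g (S j' x) - G) ∂μ =
      ∫ x, g (S j x) * g (S j' x) ∂μ - G * ∫ x, g (S j x) ∂μ - G * ∫ x, g (S j' x) ∂μ + G ^ 2 := by
    intro j j'
    have e1 : Integrable (fun x => g (S j x) * g (S j' x) - G * g (S j x)) μ :=
      (hbd2 j j').sub ((hbd j).const_mul G)
    have e2 : Integrable (fun x => g (S j x) * g (S j' x) - G * g (S j x) - G * g (S j' x)) μ :=
      e1.sub ((hbd j').const_mul G)
    have : (fun x => (g (S j x) - G) * (g (S j' x) - G)) = fun x =>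
        g (S j x) * g (S j' x) - G * g (S j x) - G * g (S j' x) + G ^ 2 := by ext x; ring
    rw [this, integral_add e2 (integrable_const _), integral_sub e1 ((hbd j').const_mul G),
      integral_sub (hbd2 j j') ((hbd j).const_mul G), integral_const_mul, integral_const_mul]
    simp
  have hm : ∀ j, |∫ x, g (S j x) ∂μ - G| ≤ η := fun j =>
    abs_integral_trigSum_sub_le hS ha hg hG hη j (h1 j)
  -- On the diagonal `g² ≤ g`; off it the joint mean is within `η` of `G²`. Replacing the two single
  -- means by `G` costs at most `2 η` more, as `G ≤ 1`.
  have hcov : ∀ j j', ∫ x, (g (S j x) - G) * (g (S j' x) - G) ∂μ ≤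
      (if j = j' then G else 0) + 3 * η := by
    intro j j'
    rw [hEq]
    have m1 := abs_le.1 (hm j)
    have m2 := abs_le.1 (hm j')
    have k1 : G * (G - η) ≤ G * ∫ x, g (S j x) ∂μ := mul_le_mul_of_nonneg_left (by linarith) hG0.le
    have k2 : G * (G - η) ≤ G * ∫ x, g (S j' x) ∂μ := mul_le_mul_of_nonneg_left (by linarith) hG0.le
    have k3 : G * η ≤ 1 * η := mul_le_mul_of_nonneg_right hG1 hη
    split_ifs with hjj
    · have k4 : ∫ x, g (S j x) * g (S j' x) ∂μ ≤ ∫ x, g (S j x) ∂μ := by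
        refine integral_mono (hbd2 _ _) (hbd _) fun x => ?_
        exact mul_le_of_le_one_right (hg0 _) (hg1 _)
      nlinarith [sq_nonneg G]
    · have m3 := abs_le.1 (abs_integral_trigSum_mul_sub_le hS ha hg hG hη j j' (h2 j j' hjj))
      nlinarith
  set Z : α → ℝ := fun x => (∑ j, (g (S j x) - G)) ^ 2 with hZ
  have hZe : ∀ x, Z x = ∑ j, ∑ j', (g (S j x) - G) * (g (S j' x) - G) := fun x => by
    simp only [hZ]; rw [sq, Finset.sum_mul_sum]
  have hZi : Integrable Z μ := by
    rw [funext hZe]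
    exact integrable_finsetSum _ fun j _ => integrable_finsetSum _ fun j' _ => hE j j'
  have hvar : ∫ x, Z x ∂μ ≤ Fintype.card ι * G + Fintype.card ι ^ 2 * (3 * η) := by
    simp_rw [hZe]
    rw [integral_finsetSum _ fun j _ => integrable_finsetSum _ fun j' _ => hE j j']
    calc _ = ∑ j, ∑ j', ∫ x, (g (S j x) - G) * (g (S j' x) - G) ∂μ :=
          Finset.sum_congr rfl fun j _ => integral_finsetSum _ fun j' _ => hE j j'
      _ ≤ ∑ j, ∑ j', ((if j = j' then G else 0) + 3 * η) :=
          Finset.sum_le_sum fun j _ => Finset.sum_le_sum fun j' _ => hcov j j'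
      _ = _ := by
          simp only [Finset.sum_add_distrib, Finset.sum_ite_eq, Finset.mem_univ, if_true,
            Finset.sum_const, Finset.card_univ, nsmul_eq_mul]
          ring
  set M : ℝ := (Fintype.card ι : ℝ) with hMdef
  have hch := mul_meas_ge_le_integral_of_nonneg (ae_of_all μ fun x => sq_nonneg _) hZi ((M * G / 2) ^ 2)
  have hsub : {x | ∑ j, g (S j x) ≤ M * G / 2} ⊆ {x | (M * G / 2) ^ 2 ≤ Z x} := by
    intro x hx
    simp only [Set.mem_ofPred_eq] at hx ⊢
    have hs : ∑ j, (g (S j x) - G) = ∑ j, g (S j x) - M * G := by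
      rw [Finset.sum_sub_distrib, Finset.sum_const, Finset.card_univ, nsmul_eq_mul]
    simp only [hZ]
    rw [hs, ← neg_sq (∑ j, g (S j x) - M * G)]
    exact pow_le_pow_left₀ (by positivity) (by linarith) 2
  have hMG : 0 < M * G := by positivity
  calc _ ≤ μ.real {x | (M * G / 2) ^ 2 ≤ Z x} := measureReal_mono hsub
    _ ≤ (M * G + M ^ 2 * (3 * η)) / (M * G / 2) ^ 2 := by
        rw [le_div_iff₀ (by positivity), mul_comm]
        exact hch.trans hvar
    _ = _ := by field_simp; ring

end SecondMoment

/-! ### A trigonometric bump as test function. -/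

section TestFunction

/-- A trigonometric bump of width `P / √K` about `s₀`. -/
def bump (K : ℕ) (P s₀ s : ℝ) : ℝ := Real.cos ((s - s₀) / (2 * P)) ^ (2 * K)

lemma measurable_bump (K : ℕ) (P s₀ : ℝ) : Measurable (bump K P s₀) := by
  unfold bump; fun_prop

lemma bump_nonneg (K : ℕ) (P s₀ s : ℝ) : 0 ≤ bump K P s₀ s := by
  unfold bump; rw [pow_mul]; positivity

lemma bump_le_one (K : ℕ) (P s₀ s : ℝ) : bump K P s₀ s ≤ 1 := by
  unfold bump; rw [pow_mul]
  exact pow_le_one₀ (sq_nonneg _) (Real.cos_sq_le_one _)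

/-- These come from the binomial expansion of `cos ^ (2 K)`; their moduli sum to `1`, as the second
moment bound requires. The bump is itself a trigonometric sum with frequencies at most `K / P`, so
characteristic functions on a bounded range determine its mean. -/
def bumpCoeff (K : ℕ) (P s₀ : ℝ) (k : Fin (2 * K + 1)) : ℂ :=
  ((2 * K).choose k / 4 ^ K : ℝ) * Complex.exp ((-(((k : ℝ) - K) / P * s₀) : ℝ) * Complex.I)

lemma sum_norm_bumpCoeff (K : ℕ) (P s₀ : ℝ) : ∑ k, ‖bumpCoeff K P s₀ k‖ = 1 := by
  have h : ∀ k, ‖bumpCoeff K P s₀ k‖ = ((2 * K).choose k : ℝ) / 4 ^ K := by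
    intro k
    unfold bumpCoeff
    rw [norm_mul, Complex.norm_exp_ofReal_mul_I, mul_one, Complex.norm_real,
      Real.norm_of_nonneg (by positivity)]
  simp_rw [h]
  rw [← Finset.sum_div, Fin.sum_univ_eq_sum_range (fun k => ((2 * K).choose k : ℝ)),
    ← Nat.cast_sum, Nat.sum_range_choose, pow_mul]
  norm_num

lemma bump_eq_sum (K : ℕ) {P : ℝ} (hP : P ≠ 0) (s₀ s : ℝ) : (bump K P s₀ s : ℂ) =
    ∑ k, bumpCoeff K P s₀ k * Complex.exp ((((k : ℝ) - K) / P * s : ℝ) * Complex.I) := by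
  unfold bump bumpCoeff
  push_cast
  rw [Complex.cos, div_pow, add_pow,
    Fin.sum_univ_eq_sum_range (fun k => ((2 * K).choose k : ℂ) / 4 ^ K *
      Complex.exp (-(((k : ℂ) - K) / P * s₀) * Complex.I) *
        Complex.exp (((k : ℂ) - K) / P * s * Complex.I)), Finset.sum_div]
  refine Finset.sum_congr rfl fun k hk => ?_
  have hk' : k ≤ 2 * K := by simpa [Nat.lt_succ_iff] using hk
  have hP' : (P : ℂ) ≠ 0 := by exact_mod_cast hP
  rw [mul_assoc _ (Complex.exp _) (Complex.exp _), ← Complex.exp_add, ← Complex.exp_nat_mul,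
    ← Complex.exp_nat_mul, ← Complex.exp_add, pow_mul, Nat.cast_sub hk']
  have : (2 : ℂ) ^ 2 = 4 := by norm_num
  rw [this, mul_comm, mul_div_right_comm]
  congr 2
  push_cast
  field_simp
  ring

lemma abs_sub_div_le {K : ℕ} {P : ℝ} (hP : 0 < P) (k : Fin (2 * K + 1)) :
    |((k : ℝ) - K) / P| ≤ K / P := by
  rw [abs_div, abs_of_pos hP]
  have hk : (k : ℕ) ≤ 2 * K := Nat.lt_succ_iff.1 k.2
  have hk' : ((k : ℕ) : ℝ) ≤ 2 * K := by exact_mod_cast hk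
  gcongr
  rw [abs_le]
  constructor <;> linarith [(Nat.cast_nonneg (k : ℕ) : (0 : ℝ) ≤ _)]

/-- In the range allowed the angle `z` lies between `1 / (2 P)` and `π / 2`, so the cosine has not
yet grown again; then `cos² z = 1 - sin² z ≤ exp (-1 / (16 P²))` is raised to the power `K`. -/
lemma bump_le_exp {K : ℕ} {P s₀ s : ℝ} (hP : 0 < P) (h1 : s ≤ s₀ - 1) (h2 : |s| ≤ 2 * P)
    (h3 : |s₀| ≤ P / 2) : bump K P s₀ s ≤ Real.exp (-(K / (16 * P ^ 2))) := by
  set z := (s₀ - s) / (2 * P) with hz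
  have hs := abs_le.1 h2
  have hs0 := abs_le.1 h3
  have hz1 : z ≤ Real.pi / 2 := by
    rw [hz, div_le_iff₀ (by positivity)]
    nlinarith [Real.pi_gt_three]
  have hz0 : 1 / (2 * P) ≤ z := by rw [hz]; gcongr; linarith
  have hz0' : 0 < 1 / (2 * P) := by positivity
  have h4 : 1 / (4 * P) ≤ Real.sin z := by
    refine le_trans ?_ (Real.mul_le_sin (by linarith) hz1)
    have : (1 : ℝ) / 2 ≤ 2 / Real.pi := by
      rw [div_le_div_iff₀ (by norm_num) Real.pi_pos]; linarith [Real.pi_le_four]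
    calc 1 / (4 * P) = 1 / 2 * (1 / (2 * P)) := by field_simp; norm_num
      _ ≤ _ := by gcongr
  have h5 : Real.cos ((s - s₀) / (2 * P)) ^ 2 ≤ Real.exp (-(1 / (4 * P)) ^ 2) := by
    have e : (s - s₀) / (2 * P) = -z := by rw [hz]; ring
    rw [e, Real.cos_neg, Real.cos_sq']
    have : (1 / (4 * P)) ^ 2 ≤ Real.sin z ^ 2 := pow_le_pow_left₀ (by positivity) h4 2
    have := Real.add_one_le_exp (-(1 / (4 * P)) ^ 2)
    linarith
  unfold bump
  rw [pow_mul]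
  refine (pow_le_pow_left₀ (sq_nonneg _) h5 K).trans (le_of_eq ?_)
  rw [← Real.exp_nat_mul]
  congr 1
  field_simp
  norm_num

/-- From `cos² z ≥ 1 - z²` and Bernoulli's inequality. -/
lemma half_le_bump {K : ℕ} {P s₀ s w : ℝ} (hP : 0 < P) (h : |s - s₀| ≤ w)
    (hw : K * w ^ 2 ≤ 2 * P ^ 2) : 1 / 2 ≤ bump K P s₀ s := by
  set z := (s - s₀) / (2 * P) with hz
  have h1 : 1 - z ^ 2 ≤ Real.cos z ^ 2 := by
    rw [Real.cos_sq']
    have := Real.sin_sq_le_sq (x := z)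
    linarith
  have hz2 : z ^ 2 ≤ w ^ 2 / (4 * P ^ 2) := by
    rw [hz, div_pow, mul_pow]
    norm_num
    gcongr ?_ / _
    rw [← sq_abs]
    gcongr
  have h2 : K * z ^ 2 ≤ 1 / 2 := by
    calc (K : ℝ) * z ^ 2 ≤ K * (w ^ 2 / (4 * P ^ 2)) := by gcongr
      _ = K * w ^ 2 / (4 * P ^ 2) := by ring
      _ ≤ 2 * P ^ 2 / (4 * P ^ 2) := by gcongr
      _ = 1 / 2 := by field_simp; norm_num
  unfold bump
  rw [pow_mul]
  rw [← hz]
  have h3 := one_add_mul_le_pow (a := Real.cos z ^ 2 - 1)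
    (by linarith [sq_nonneg (Real.cos z)]) K
  rw [add_sub_cancel] at h3
  nlinarith [(Nat.cast_nonneg K : (0 : ℝ) ≤ K)]

lemma integral_bump_gaussian_eq (K : ℕ) {P : ℝ} (hP : P ≠ 0) (s₀ : ℝ) {v : ℝ} (hv : 0 ≤ v) :
    ((∫ s, bump K P s₀ s ∂gaussianReal 0 v.toNNReal : ℝ) : ℂ) =
      ∑ k, bumpCoeff K P s₀ k * (Real.exp (-(v * (((k : ℝ) - K) / P) ^ 2 / 2)) : ℝ) := by
  rw [← integral_complex_ofReal]
  simp_rw [bump_eq_sum K hP]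
  rw [integral_finsetSum]
  · refine Finset.sum_congr rfl fun k _ => ?_
    rw [integral_const_mul]
    congr 1
    have h := charFun_gaussianReal (μ := 0) (v := v.toNNReal) (((k : ℝ) - K) / P)
    rw [charFun_apply_real] at h
    push_cast at h ⊢
    rw [h]
    congr 1
    have hv' : ((v.toNNReal : ℝ) : ℂ) = v := by rw [Real.coe_toNNReal v hv]
    rw [hv']
    ring
  · intro k _
    refine (Integrable.of_bound (C := 1) ?_ (ae_of_all _ fun x => ?_)).const_mul _
    · exact (by fun_prop : Measurable _).aestronglyMeasurable
    · rw [Complex.norm_exp_ofReal_mul_I]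

lemma le_integral_bump_gaussian {K : ℕ} {P s₀ w v : ℝ} (hP : 0 < P) (hv : 0 < v) (hs : 0 ≤ s₀)
    (hw0 : 0 ≤ w) (hw : K * w ^ 2 ≤ 2 * P ^ 2) :
    w / (2 * √(2 * Real.pi * v)) * Real.exp (-((s₀ + w) ^ 2 / (2 * v))) ≤
      ∫ s, bump K P s₀ s ∂gaussianReal 0 v.toNNReal := by
  have hv' : v.toNNReal ≠ 0 := by simpa using hv
  rw [integral_gaussianReal_eq_integral_smul hv']
  set c : ℝ := (√(2 * Real.pi * v))⁻¹ * Real.exp (-((s₀ + w) ^ 2 / (2 * v))) * (1 / 2) with hc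
  have hint : Integrable fun s => gaussianPDFReal 0 v.toNNReal s • bump K P s₀ s := by
    refine (integrable_gaussianPDFReal 0 v.toNNReal).mul_bdd (c := 1)
      (measurable_bump K P s₀).aestronglyMeasurable (ae_of_all _ fun s => ?_)
    rw [Real.norm_of_nonneg (bump_nonneg _ _ _ _)]; exact bump_le_one _ _ _ _
  have hnn : ∀ s, 0 ≤ gaussianPDFReal 0 v.toNNReal s • bump K P s₀ s := fun s =>
    mul_nonneg (gaussianPDFReal_nonneg _ _ _) (bump_nonneg _ _ _ _)
  calc w / (2 * √(2 * Real.pi * v)) * Real.exp (-((s₀ + w) ^ 2 / (2 * v)))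
      = ∫ s in Set.Icc s₀ (s₀ + w), c := by
        rw [setIntegral_const, Real.volume_real_Icc_of_le (by linarith), smul_eq_mul, hc]
        rw [add_sub_cancel_left]
        field_simp
    _ ≤ ∫ s in Set.Icc s₀ (s₀ + w), gaussianPDFReal 0 v.toNNReal s • bump K P s₀ s := by
        refine setIntegral_mono_on (by simp) hint.integrableOn measurableSet_Icc fun s hs' => ?_
        rw [hc, smul_eq_mul, gaussianPDFReal_def, Real.coe_toNNReal v hv.le]
        beta_reduce
        rw [sub_zero]
        have hb := half_le_bump (K := K) hP (s₀ := s₀) (s := s) (w := w)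
          (by rw [abs_le]; constructor <;> linarith [hs'.1, hs'.2]) hw
        gcongr
        · rw [neg_div]
          gcongr
          · linarith [hs'.1]
          · exact hs'.2
    _ ≤ _ := setIntegral_le_integral hint (ae_of_all _ hnn)

end TestFunction

/-! ### Large sums over one of many disjoint blocks. -/

namespace MomentsMatch

variable {ι : Type*} [Fintype ι] {n : ι → ℤ} {p : ℝ → ℝ} {m : ℕ} {B v : ℝ}

lemma norm_charFun_sub_le_of_abs_le (h : MomentsMatch n p m B v) (c : ι → ℝ) {r : ℕ} (hr0 : r ≠ 0)
    (hr : 2 * r ≤ m) {Q b : ℝ} (hQ : 0 < Q) (hcQ : ∑ i, c i ^ 2 ≤ Q) (hb : 0 ≤ b)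
    (hcb : ∀ i, |c i| ≤ b) :
    ‖∫ x, Complex.exp ((∑ i, c i * p (n i * x) : ℝ) * Complex.I) ∂unitMeasure -
        Real.exp (-(v * (∑ i, c i ^ 2) / 2))‖ ≤
      (b * B ^ 3 + b ^ 2 * B ^ 4) * Q + 2 * (Real.exp 1 * B ^ 2 * Q / (2 * r)) ^ r := by
  have hB : 0 < B := zero_lt_one.trans_le h.one_le
  refine (h.norm_charFun_sub_le c hr0 hr hQ hcQ).trans ?_
  gcongr
  calc ∑ i, (|c i| ^ 3 * B ^ 3 + c i ^ 4 * B ^ 4)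
      ≤ ∑ i, (b * B ^ 3 + b ^ 2 * B ^ 4) * c i ^ 2 := by
        refine Finset.sum_le_sum fun i _ => ?_
        have e1 : |c i| ^ 3 = |c i| * c i ^ 2 := by rw [← sq_abs (c i)]; ring
        have e2 : c i ^ 4 = |c i| ^ 2 * c i ^ 2 := by rw [sq_abs]; ring
        have := hcb i
        calc |c i| ^ 3 * B ^ 3 + c i ^ 4 * B ^ 4
            = (|c i| * B ^ 3 + |c i| ^ 2 * B ^ 4) * c i ^ 2 := by rw [e1, e2]; ring
          _ ≤ _ := by gcongr
    _ = (b * B ^ 3 + b ^ 2 * B ^ 4) * ∑ i, c i ^ 2 := by rw [Finset.mul_sum]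
    _ ≤ _ := by gcongr

/-- The probability that none of several normalised sums over disjoint index sets exceeds a
level. -/
theorem measureReal_forall_lt_le (h : MomentsMatch n p m B v) (hv : 0 < v) {κ : Type*} [Fintype κ]
    [DecidableEq κ] [Nonempty κ] (u : κ → ι → ℝ) (hu : ∀ j, ∑ i, u j i ^ 2 = 1)
    (hdisj : ∀ j j', j ≠ j' → ∀ i, u j i * u j' i = 0) {b : ℝ} (hb : 0 ≤ b)
    (hub : ∀ j i, |u j i| ≤ b) {K r r' : ℕ} {P s₀ T G η : ℝ} (hK : 0 < K) (hP : 0 < P)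
    (hs₀ : |s₀| ≤ P / 2) (hT : T = K / P) (hr0 : r ≠ 0) (hr : 2 * r ≤ m) (hr0' : r' ≠ 0)
    (hr' : 2 * r' ≤ m) (hG : G = ∫ s, bump K P s₀ s ∂gaussianReal 0 v.toNNReal) (hG0 : 0 < G)
    (hKG : Real.exp (-(K / (16 * P ^ 2))) ≤ G / 2)
    (hη : η = (2 * b * T * B ^ 3 + (2 * b * T) ^ 2 * B ^ 4) * (2 * T ^ 2) +
      2 * (Real.exp 1 * B ^ 2 * (2 * T ^ 2) / (2 * r)) ^ r) :
    unitMeasure.real {x | ∀ j, ∑ i, u j i * p (n i * x) < s₀ - 1} ≤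
      Fintype.card κ * (2 * r' * Real.exp 1 * B ^ 2 / (2 * P) ^ 2) ^ r' +
        (4 / (Fintype.card κ * G) + 12 * η / G ^ 2) := by
  have hB : 0 < B := zero_lt_one.trans_le h.one_le
  have hT0 : 0 < T := by rw [hT]; have : (0 : ℝ) < K := by exact_mod_cast hK
                         positivity
  set S : κ → ℝ → ℝ := fun j x => ∑ i, u j i * p (n i * x) with hS
  have hSm : ∀ j, Measurable (S j) := fun j => h.measurable_sum_dilate (u j)
  have hη0 : 0 ≤ η := by rw [hη]; positivity
  have hgi : Integrable (bump K P s₀) (gaussianReal 0 v.toNNReal) :=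
    Integrable.of_bound (C := 1) (measurable_bump K P s₀).aestronglyMeasurable
      (ae_of_all _ fun s => by
        rw [Real.norm_of_nonneg (bump_nonneg _ _ _ _)]; exact bump_le_one _ _ _ _)
  have hG1 : G ≤ 1 := by
    rw [hG]
    calc _ ≤ ∫ _, (1 : ℝ) ∂gaussianReal 0 v.toNNReal :=
          integral_mono hgi (integrable_const _) fun s => bump_le_one _ _ _ _
      _ = 1 := by simp
  set τ : Fin (2 * K + 1) → ℝ := fun k => ((k : ℝ) - K) / P with hτ
  have hτT : ∀ k, |τ k| ≤ T := fun k => by rw [hT]; exact abs_sub_div_le hP k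
  have hτ2 : ∀ k, τ k ^ 2 ≤ T ^ 2 := fun k => by
    rw [← sq_abs]; exact pow_le_pow_left₀ (abs_nonneg _) (hτT k) 2
  have hchar : ∀ c : ι → ℝ, ∑ i, c i ^ 2 ≤ 2 * T ^ 2 → (∀ i, |c i| ≤ 2 * b * T) →
      ‖∫ x, Complex.exp ((∑ i, c i * p (n i * x) : ℝ) * Complex.I) ∂unitMeasure -
        Real.exp (-(v * (∑ i, c i ^ 2) / 2))‖ ≤ η := by
    intro c hc hcb
    rw [hη]
    exact h.norm_charFun_sub_le_of_abs_le c hr0 hr (by positivity) hc (by positivity) hcb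
  have h1 : ∀ j k, ‖∫ x, Complex.exp ((τ k * S j x : ℝ) * Complex.I) ∂unitMeasure -
      (Real.exp (-(v * τ k ^ 2 / 2)) : ℝ)‖ ≤ η := by
    intro j k
    have hc : ∑ i, (τ k * u j i) ^ 2 = τ k ^ 2 := by
      simp_rw [mul_pow]; rw [← Finset.mul_sum, hu, mul_one]
    have := hchar (fun i => τ k * u j i) (by rw [hc]; nlinarith [hτ2 k]) fun i => by
      rw [abs_mul, mul_comm]
      calc |u j i| * |τ k| ≤ b * T := mul_le_mul (hub j i) (hτT k) (abs_nonneg _) hb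
        _ ≤ _ := by nlinarith [mul_nonneg hb hT0.le]
    rw [hc] at this
    convert! this using 7
    simp only [hS, Finset.mul_sum, mul_assoc]
  -- A combination of two block sums is again a weighted sum of dilates. Disjoint supports make the
  -- squared weights add, so the Gaussian approximation factorises.
  have h2 : ∀ j j', j ≠ j' → ∀ k l,
      ‖∫ x, Complex.exp ((τ k * S j x + τ l * S j' x : ℝ) * Complex.I) ∂unitMeasure -
        (Real.exp (-(v * τ k ^ 2 / 2)) : ℝ) * (Real.exp (-(v * τ l ^ 2 / 2)) : ℝ)‖ ≤ η := by
    intro j j' hjj k l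
    have hc : ∑ i, (τ k * u j i + τ l * u j' i) ^ 2 = τ k ^ 2 + τ l ^ 2 := by
      have : ∀ i, (τ k * u j i + τ l * u j' i) ^ 2 =
          τ k ^ 2 * u j i ^ 2 + τ l ^ 2 * u j' i ^ 2 := fun i => by
        have := hdisj j j' hjj i
        linear_combination 2 * τ k * τ l * this
      simp_rw [this]
      rw [Finset.sum_add_distrib, ← Finset.mul_sum, ← Finset.mul_sum, hu, hu, mul_one, mul_one]
    have := hchar (fun i => τ k * u j i + τ l * u j' i)
        (by rw [hc]; linarith [hτ2 k, hτ2 l]) fun i => by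
      refine (abs_add_le _ _).trans ?_
      rw [abs_mul, abs_mul]
      have a1 : |τ k| * |u j i| ≤ T * b := mul_le_mul (hτT k) (hub j i) (abs_nonneg _) hT0.le
      have a2 : |τ l| * |u j' i| ≤ T * b := mul_le_mul (hτT l) (hub j' i) (abs_nonneg _) hT0.le
      linarith
    rw [hc] at this
    rw [← Complex.ofReal_mul, ← Real.exp_add]
    have e1 : -(v * τ k ^ 2 / 2) + -(v * τ l ^ 2 / 2) = -(v * (τ k ^ 2 + τ l ^ 2) / 2) := by ring
    have e2 : ∀ x, τ k * S j x + τ l * S j' x =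
        ∑ i, (τ k * u j i + τ l * u j' i) * p (n i * x) := fun x => by
      simp only [hS, Finset.mul_sum, ← Finset.sum_add_distrib]
      exact Finset.sum_congr rfl fun i _ => by ring
    simp_rw [e1, e2]
    exact this
  have key := measureReal_sum_trigSum_le (μ := unitMeasure) hSm (sum_norm_bumpCoeff K P s₀).le
    (fun s => bump_eq_sum K hP.ne' s₀ s) (measurable_bump K P s₀) (bump_nonneg K P s₀)
    (bump_le_one K P s₀) (by rw [hG]; exact integral_bump_gaussian_eq K hP.ne' s₀ hv.le) hG0 hG1 hη0
    h1 h2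
  -- The bump is periodic and recovers far below `s₀`; values beyond `2 P` are removed by the crude
  -- tail bound.
  set E : κ → Set ℝ := fun j => {x | 2 * P ≤ |S j x|} with hE
  have hEm : ∀ j, unitMeasure.real (E j) ≤
      (2 * r' * Real.exp 1 * B ^ 2 / (2 * P) ^ 2) ^ r' := by
    intro j
    have := h.measureReal_le (u j) hr0' hr' one_pos (hu j).le (by positivity : 0 < 2 * P)
    rwa [mul_one] at this
  -- If every sum is below `s₀ - 1` but within `2 P`, each bump is at most `G / 2`, so their total
  -- is at most half of its expected value.
  have hsub : {x | ∀ j, S j x < s₀ - 1} ⊆ (⋃ j ∈ Finset.univ, E j) ∪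
      {x | ∑ j, bump K P s₀ (S j x) ≤ Fintype.card κ * G / 2} := by
    intro x hx
    by_cases hxE : ∃ j, x ∈ E j
    · obtain ⟨j, hj⟩ := hxE
      exact Or.inl (Set.mem_biUnion (Finset.mem_univ j) hj)
    · right
      push Not at hxE
      calc ∑ j, bump K P s₀ (S j x) ≤ ∑ _j : κ, G / 2 := by
            refine Finset.sum_le_sum fun j _ => (bump_le_exp hP (hx j).le ?_ hs₀).trans hKG
            have := hxE j
            simp only [hE, Set.mem_ofPred_eq, not_le] at this
            exact this.le
        _ = _ := by rw [Finset.sum_const, Finset.card_univ, nsmul_eq_mul]; ring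
  refine (measureReal_mono hsub).trans ((measureReal_union_le _ _).trans (add_le_add ?_ key))
  refine (measureReal_biUnion_finset_le _ _).trans ?_
  calc _ ≤ ∑ _j : κ, (2 * r' * Real.exp 1 * B ^ 2 / (2 * P) ^ 2) ^ r' :=
        Finset.sum_le_sum fun j _ => hEm j
    _ = _ := by rw [Finset.sum_const, Finset.card_univ, nsmul_eq_mul]

end MomentsMatch

lemma indicatorWeight_mul_eq_zero {s : Finset ℕ} {M N M' N' : ℕ}
    (h : Disjoint (Finset.Ico M N) (Finset.Ico M' N')) (i : s) :
    indicatorWeight M N i * indicatorWeight M' N' i = 0 := by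
  unfold indicatorWeight
  by_cases h1 : (i : ℕ) ∈ Finset.Ico M N
  · rw [if_neg (Finset.disjoint_left.1 h h1), mul_zero]
  · rw [if_neg h1, zero_mul]

/-- At a given scale, it is likely that one of the sums over several disjoint intervals of
positions exceeds a level. -/
theorem IsScale.exists_exceptional_set_lower {f : ℝ → ℝ} {n : ℕ → ℤ} {σ : Equiv.Perm ℕ}
    {R m : ℕ} {B C v : ℝ} {p D : ℝ → ℝ} (h : IsScale f n σ R m B C p v D) (hv : 0 < v)
    {κ : Type*} [Fintype κ] [DecidableEq κ] [Nonempty κ] (lo hi : κ → ℕ)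
    (hle : ∀ j, lo j ≤ hi j) (hhi : ∀ j, hi j ≤ R ^ 8)
    (hdisj : ∀ j j', j ≠ j' → Disjoint (Finset.Ico (lo j) (hi j)) (Finset.Ico (lo j') (hi j')))
    {A : ℝ} (hA0 : 0 < A) (hA : ∀ j, A ≤ (hi j : ℝ) - lo j - (R + 1)) {K r r' : ℕ}
    {P s₀ T G η : ℝ} (hK : 0 < K) (hP : 0 < P)
    (hs₀ : |s₀| ≤ P / 2) (hs1 : 1 ≤ s₀) (hT : T = K / P) (hr0 : r ≠ 0) (hr : 2 * r ≤ m)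
    (hr0' : r' ≠ 0) (hr' : 2 * r' ≤ m)
    (hG : G = ∫ s, bump K P s₀ s ∂gaussianReal 0 v.toNNReal) (hG0 : 0 < G)
    (hKG : Real.exp (-(K / (16 * P ^ 2))) ≤ G / 2)
    (hη : η = (2 * (√A)⁻¹ * T * B ^ 3 + (2 * (√A)⁻¹ * T) ^ 2 * B ^ 4) * (2 * T ^ 2) +
      2 * (Real.exp 1 * B ^ 2 * (2 * T ^ 2) / (2 * r)) ^ r) :
    unitMeasure.real {x | ∀ j, ∑ i ∈ Finset.Ico (lo j) (hi j), f (n (σ i) * x) <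
        √((hi j : ℝ) - lo j - (R + 1)) * (s₀ - 1) - ((R + 1) * B + 1)} ≤
      C / R ^ 8 + (Fintype.card κ * (2 * r' * Real.exp 1 * B ^ 2 / (2 * P) ^ 2) ^ r' +
        (4 / (Fintype.card κ * G) + 12 * η / G ^ 2)) := by
  set q : κ → ℝ := fun j => ∑ i : bigIndices σ R, indicatorWeight (lo j) (hi j) i ^ 2 with hq
  have hqA : ∀ j, A ≤ q j := fun j => (hA j).trans (le_sum_indicatorWeight_sq (hle j) (hhi j))
  have hq0 : ∀ j, 0 < q j := fun j => hA0.trans_le (hqA j)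
  set u : κ → bigIndices σ R → ℝ := fun j i => indicatorWeight (lo j) (hi j) i / √(q j) with hu
  have key := h.moments.measureReal_forall_lt_le hv u (fun j => by
      simp only [hu, div_pow, Real.sq_sqrt (hq0 j).le]
      rw [← Finset.sum_div]
      exact div_self (hq0 j).ne')
    (fun j j' hjj i => by
      simp only [hu]
      rw [div_mul_div_comm, indicatorWeight_mul_eq_zero (hdisj j j' hjj), zero_div])
    (by positivity : 0 ≤ (√A)⁻¹)
    (fun j i => by
      simp only [hu]
      rw [abs_div, abs_of_nonneg (Real.sqrt_nonneg _), div_eq_mul_inv]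
      calc _ ≤ 1 * (√A)⁻¹ := by
            have := Real.sqrt_pos.2 hA0
            gcongr
            · exact abs_indicatorWeight_le _ _ _
            · exact hqA j
        _ = _ := one_mul _)
    hK hP hs₀ hT hr0 hr hr0' hr' hG hG0 hKG hη
  have m0 : unitMeasure.real {x | 1 ≤ D x} ≤ C / R ^ 8 := by
    have := mul_meas_ge_le_integral_of_nonneg (ae_of_all _ h.nonneg) h.integrable 1
    rw [one_mul] at this
    exact this.trans h.integral_le
  refine le_trans (measureReal_mono ?_) ((measureReal_union_le {x | 1 ≤ D x} _).trans
    (add_le_add m0 key))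
  intro x hx
  by_cases hD : 1 ≤ D x
  · exact Or.inl hD
  · refine Or.inr fun j => ?_
    have h1 := hx j
    have h2 := (abs_le.1 (h.abs_sub_le x (lo j) (hi j) (hle j) (hhi j))).1
    have h3 : ∑ i : bigIndices σ R, indicatorWeight (lo j) (hi j) i * p (n (σ i) * x) <
        √(q j) * (s₀ - 1) := by
      have : √((hi j : ℝ) - lo j - (R + 1)) * (s₀ - 1) ≤ √(q j) * (s₀ - 1) :=
        mul_le_mul_of_nonneg_right
          (Real.sqrt_le_sqrt (le_sum_indicatorWeight_sq (hle j) (hhi j))) (by linarith)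
      linarith
    have hs := Real.sqrt_pos.2 (hq0 j)
    have h4 : ∑ i, u j i * p (n (σ i) * x) =
        (∑ i : bigIndices σ R, indicatorWeight (lo j) (hi j) i * p (n (σ i) * x)) / √(q j) := by
      rw [Finset.sum_div]
      exact Finset.sum_congr rfl fun i _ => by simp only [hu]; ring
    rw [h4, div_lt_iff₀ hs, mul_comm]
    exact h3

lemma eventually_log_pow_le_rpow {β : ℝ} (hβ : 0 < β) (k : ℕ) (c : ℝ) :
    ∀ᶠ J : ℕ in atTop, c * Real.log J ^ k ≤ (J : ℝ) ^ β := by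
  have h := ((Real.isLittleO_pow_log_id_atTop (n := k)).comp_tendsto
    ((tendsto_rpow_atTop hβ).comp (tendsto_natCast_atTop_atTop (R := ℝ)))).bound
    (by positivity : (0 : ℝ) < β ^ k / (|c| + 1))
  filter_upwards [h, eventually_ge_atTop 1] with J hJ hJ1
  have hJ0 : (0 : ℝ) < J := by exact_mod_cast hJ1
  have hl : 0 ≤ Real.log J := Real.log_natCast_nonneg J
  simp only [Function.comp, id] at hJ
  rw [Real.log_rpow hJ0, Real.norm_of_nonneg (by positivity), Real.norm_of_nonneg (by positivity),
    mul_pow, div_mul_eq_mul_div, le_div_iff₀ (by positivity), mul_assoc] at hJ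
  have h1 := le_of_mul_le_mul_left hJ (by positivity)
  have h2 : c * Real.log J ^ k ≤ (|c| + 1) * Real.log J ^ k :=
    mul_le_mul_of_nonneg_right (by linarith [le_abs_self c]) (by positivity)
  linarith

lemma eventually_mul_pow_le_pow {x : ℝ} (hx : 1 < x) (k : ℕ) (c : ℝ) :
    ∀ᶠ J : ℕ in atTop, c * (J : ℝ) ^ k ≤ x ^ J := by
  have h := (isLittleO_pow_const_const_pow_of_one_lt (R := ℝ) k hx).bound
    (by positivity : (0 : ℝ) < 1 / (|c| + 1))
  filter_upwards [h] with J hJ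
  rw [Real.norm_of_nonneg (by positivity), Real.norm_of_nonneg (by positivity),
    div_mul_eq_mul_div, le_div_iff₀ (by positivity), one_mul] at hJ
  have h2 : c * (J : ℝ) ^ k ≤ (|c| + 1) * (J : ℝ) ^ k :=
    mul_le_mul_of_nonneg_right (by linarith [le_abs_self c]) (by positivity)
  linarith

lemma pow_le_exp_neg {x L : ℝ} {r : ℕ} (h0 : 0 ≤ x) (hx : x ≤ Real.exp (-1)) (hr : L ≤ r) :
    x ^ r ≤ Real.exp (-L) := by
  refine (pow_le_pow_left₀ h0 hx r).trans ?_
  rw [← Real.exp_nat_mul]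
  exact Real.exp_le_exp.2 (by linarith)

/-- The error in the comparison of characteristic functions is smaller than any needed power. -/
lemma charFun_error_le {B c L T X : ℝ} {r : ℕ} (hB : 1 ≤ B) (hc : 1 ≤ c) (hL : 1 ≤ L)
    (hT0 : 0 ≤ T) (hT : T ^ 2 ≤ (65 * c) ^ 2 * L ^ 3) (hr : 8 * (65 * c) ^ 2 * B ^ 2 * L ^ 3 ≤ r)
    (hX : 12 * B ^ 4 * (65 * c) ^ 4 * L ^ 8 * Real.exp (4 * L) ≤ √X) (hX1 : 1 ≤ X) :
    (2 * (√X)⁻¹ * T * B ^ 3 + (2 * (√X)⁻¹ * T) ^ 2 * B ^ 4) * (2 * T ^ 2) +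
      2 * (Real.exp 1 * B ^ 2 * (2 * T ^ 2) / (2 * r)) ^ r ≤ 3 * Real.exp (-(4 * L)) := by
  have hL3 : 1 ≤ L ^ 3 := one_le_pow₀ hL
  have hB2 : 1 ≤ B ^ 2 := one_le_pow₀ hB
  have hc2 : 1 ≤ c ^ 2 := one_le_pow₀ hc
  have hr0 : (0 : ℝ) < r := lt_of_lt_of_le (by positivity) hr
  -- The bound `65 c L ^ (3/2)` for `T` is rounded up to an integral power of `L`.
  set t : ℝ := 65 * c * L ^ 2 with ht
  have ht1 : 1 ≤ t := by
    have : 1 ≤ L ^ 2 := one_le_pow₀ hL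
    have : 1 ≤ 65 * c := by linarith
    rw [ht]; nlinarith
  have hTt : T ≤ t := by
    refine abs_le_of_sq_le_sq' ?_ (by linarith) |>.2
    calc T ^ 2 ≤ (65 * c) ^ 2 * L ^ 3 := hT
      _ ≤ (65 * c) ^ 2 * L ^ 4 := by
          gcongr (65 * c) ^ 2 * ?_
          exact pow_le_pow_right₀ hL (by norm_num)
      _ = t ^ 2 := by rw [ht]; ring
  have hs1 : 1 ≤ √X := Real.one_le_sqrt.2 hX1
  set s := (√X)⁻¹ with hs
  have hs0 : 0 < s := by positivity
  have hsle : s ≤ 1 := inv_le_one_of_one_le₀ hs1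
  have h1 : (2 * s * T * B ^ 3 + (2 * s * T) ^ 2 * B ^ 4) * (2 * T ^ 2) ≤ Real.exp (-(4 * L)) := by
    have hB34 : B ^ 3 ≤ B ^ 4 := pow_le_pow_right₀ hB (by norm_num)
    calc _ ≤ (2 * s * t * B ^ 3 + (2 * s * t) ^ 2 * B ^ 4) * (2 * t ^ 2) := by gcongr
      _ = s * (4 * t ^ 3 * B ^ 3 + 8 * s * t ^ 4 * B ^ 4) := by ring
      _ ≤ s * (4 * t ^ 4 * B ^ 4 + 8 * 1 * t ^ 4 * B ^ 4) := by
          gcongr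
          · norm_num
      _ = s * (12 * B ^ 4 * (65 * c) ^ 4 * L ^ 8) := by rw [ht]; ring
      _ ≤ _ := by
          rw [hs, Real.exp_neg, inv_mul_le_iff₀ (by positivity), ← div_eq_mul_inv,
            le_div_iff₀ (Real.exp_pos _)]
          exact hX
  have h2 : (Real.exp 1 * B ^ 2 * (2 * T ^ 2) / (2 * r)) ^ r ≤ Real.exp (-(4 * L)) := by
    refine pow_le_exp_neg (by positivity) ?_ ?_
    · rw [div_le_iff₀ (by positivity), Real.exp_neg, inv_mul_eq_div, le_div_iff₀ (Real.exp_pos _)]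
      have he : Real.exp 1 * Real.exp 1 ≤ 8 := by
        have := Real.exp_one_lt_d9
        have := Real.exp_pos 1
        nlinarith
      calc Real.exp 1 * B ^ 2 * (2 * T ^ 2) * Real.exp 1
          = 2 * (Real.exp 1 * Real.exp 1) * B ^ 2 * T ^ 2 := by ring
        _ ≤ 2 * 8 * B ^ 2 * ((65 * c) ^ 2 * L ^ 3) := by gcongr
        _ = 2 * (8 * (65 * c) ^ 2 * B ^ 2 * L ^ 3) := by ring
        _ ≤ _ := by gcongr
    · refine le_trans ?_ hr
      have h3 : L ≤ L ^ 3 := le_self_pow₀ hL (by norm_num)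
      calc 4 * L ≤ 8 * (65 * 1) ^ 2 * 1 * L := by nlinarith
        _ ≤ _ := by gcongr
  linarith

/-- With window `w = 1 / L`, the level stays below `(N - 2δ/3) √(2L)` while the standard deviation
is at least `N - δ/3`. The Gaussian exponent is therefore a multiple of `L` with factor strictly
below `1`. -/
lemma le_integral_bump_gaussian_of_variance {N δ L B v c : ℝ} {K : ℕ} (hδ : 0 < δ) (hδN : δ < N)
    (hB : 1 ≤ B) (hL33 : 33 ≤ L) (hLδ : 36 / δ ^ 2 ≤ L) (hv1 : (N - δ / 3) ^ 2 ≤ v)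
    (hvB : v ≤ B ^ 2) (hc : 0 < c) (hK : (K : ℝ) ≤ 65 * c ^ 2 * L ^ 2) :
    1 / L / (2 * (3 * B)) * Real.exp (-(((N - 2 * δ / 3) / (N - δ / 3)) ^ 2 * L)) ≤
      ∫ s, bump K (c * √L) ((N - δ) * √(2 * L) + 1) s ∂gaussianReal 0 v.toNNReal := by
  have hL0 : 0 < L := by linarith
  have hP0 : 0 < c * √L := by positivity
  have hP2 : (c * √L) ^ 2 = c ^ 2 * L := by rw [mul_pow, Real.sq_sqrt hL0.le]
  have hv0 : 0 < v := lt_of_lt_of_le (pow_pos (by linarith) 2) hv1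
  have hw : (K : ℝ) * (1 / L) ^ 2 ≤ 2 * (c * √L) ^ 2 := by
    rw [hP2]
    calc (K : ℝ) * (1 / L) ^ 2 ≤ 65 * c ^ 2 * L ^ 2 * (1 / L) ^ 2 := by gcongr
      _ = 65 * c ^ 2 := by field_simp
      _ ≤ 2 * (c ^ 2 * L) := by nlinarith [sq_nonneg c]
  have hs0 : 0 ≤ (N - δ) * √(2 * L) := mul_nonneg (by linarith) (Real.sqrt_nonneg _)
  refine le_trans ?_ (le_integral_bump_gaussian (K := K) (s₀ := (N - δ) * √(2 * L) + 1) hP0 hv0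
    (by linarith) (by positivity : 0 ≤ 1 / L) hw)
  have h1 : (N - δ) * √(2 * L) + 1 + 1 / L ≤ (N - 2 * δ / 3) * √(2 * L) := by
    have h2 : 1 / L ≤ 1 := by rw [div_le_one hL0]; linarith
    have h3 : 6 ≤ δ * √(2 * L) := by
      refine abs_le_of_sq_le_sq' ?_ (by positivity) |>.2
      rw [mul_pow, Real.sq_sqrt (by positivity)]
      rw [div_le_iff₀ (by positivity)] at hLδ
      linarith
    linarith
  have h4 : ((N - δ) * √(2 * L) + 1 + 1 / L) ^ 2 / (2 * v) ≤
      ((N - 2 * δ / 3) / (N - δ / 3)) ^ 2 * L := by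
    have h0 : 0 < N - δ / 3 := by linarith
    have h5 : 0 < 1 / L := by positivity
    calc _ ≤ ((N - 2 * δ / 3) * √(2 * L)) ^ 2 / (2 * (N - δ / 3) ^ 2) := by
          gcongr
      _ = _ := by
          rw [mul_pow, Real.sq_sqrt (by positivity), div_pow]
          field_simp
  have h5 : √(2 * Real.pi * v) ≤ 3 * B := by
    rw [Real.sqrt_le_left (by positivity)]
    have : 2 * Real.pi ≤ 9 := by linarith [Real.pi_le_four]
    calc 2 * Real.pi * v ≤ 9 * B ^ 2 := by gcongr
      _ = _ := by ring
  have : 0 < √(2 * Real.pi * v) := Real.sqrt_pos.2 (by positivity)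
  gcongr

/-- The condition `c ≥ 5 B`, with `e² ≤ 8`, makes the base at most `exp (-1)`; an order of at least
`4 L` then gives the exponent. -/
lemma tail_error_le {B c L : ℝ} {r : ℕ} (hL : 0 < L) (hB : 1 ≤ B) (hc : 5 * B ≤ c)
    (hr1 : 4 * L ≤ r) (hr2 : (r : ℝ) ≤ 5 * L) :
    (2 * r * Real.exp 1 * B ^ 2 / (2 * (c * √L)) ^ 2) ^ r ≤ Real.exp (-(4 * L)) := by
  have hc0 : 0 < c := by linarith
  refine pow_le_exp_neg (by positivity) ?_ hr1
  rw [div_le_iff₀ (by positivity), Real.exp_neg, inv_mul_eq_div, le_div_iff₀ (Real.exp_pos _),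
    mul_pow, mul_pow, Real.sq_sqrt hL.le]
  have he : Real.exp 1 * Real.exp 1 ≤ 8 := by
    have := Real.exp_one_lt_d9
    have := Real.exp_pos 1
    nlinarith
  have hcB : (5 * B) ^ 2 ≤ c ^ 2 := by gcongr
  calc 2 * r * Real.exp 1 * B ^ 2 * Real.exp 1
      = 2 * r * (Real.exp 1 * Real.exp 1) * B ^ 2 := by ring
    _ ≤ 2 * (5 * L) * 8 * B ^ 2 := by gcongr
    _ ≤ 2 ^ 2 * ((5 * B) ^ 2 * L) := by nlinarith [mul_pos hL (by positivity : 0 < B ^ 2)]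
    _ ≤ _ := by gcongr

/-- The event that none of the sums over the intervals `[q ^ j, q ^ (j + 1))`, `4 J ≤ j < 8 J`,
exceeds a level of the order of the law of the iterated logarithm. -/
def failureSet (f : ℝ → ℝ) (n : ℕ → ℤ) (σ : Equiv.Perm ℕ) (q : ℕ) (B t : ℝ) (J : ℕ) : Set ℝ :=
  {x | ∀ j : Fin (4 * J),
    ∑ i ∈ Finset.Ico (q ^ (4 * J + j)) (q ^ (4 * J + j + 1)), f (n (σ i) * x) <
      √(((q ^ (4 * J + j + 1) : ℕ) : ℝ) - (q ^ (4 * J + j) : ℕ) - ((q ^ J : ℕ) + 1)) *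
        (t * √(2 * Real.log J)) - (((q ^ J : ℕ) + 1) * B + 1)}

-- With `L = log J`, each of the `4 J` blocks has bump mean `G` of order at least `J ^ (-ρ) / L`
-- with `ρ < 1`, so `J G → ∞`. The frequencies used are at most a multiple of `L ^ (3/2)`, and
-- moments of order about `L ^ 3` suffice; the power of `J` available at scale `q ^ J` dominates
-- this. The tail and characteristic function errors are then `O(J ^ (-4))`.
set_option maxHeartbeats 1000000 in
theorem exists_tendsto_measureReal_failureSet {n : ℕ → ℤ} {W : ℕ → ℕ} (hn : NoRelations n W)
    (hW : Monotone W) (hWlim : Tendsto W atTop atTop) {β : ℝ} (hβ : 0 < β)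
    (hlog : ∀ᶠ k : ℕ in atTop, Real.log k ^ β ≤ W k) {f : ℝ → ℝ} (hf : Admissible f)
    (σ : Equiv.Perm ℕ) {δ : ℝ} (hδ : 0 < δ) (hδf : δ < l2Norm f) {q : ℕ} (hq : 2 ≤ q) :
    ∃ B : ℝ, 1 ≤ B ∧
      Tendsto (fun J => unitMeasure.real (failureSet f n σ q B (l2Norm f - δ) J)) atTop (𝓝 0) := by
  obtain ⟨B, C, hB, hC, hscale⟩ := exists_scale hn hW hWlim hf σ
  refine ⟨B, hB, ?_⟩
  set N := l2Norm f with hN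
  have hN0 : 0 < N := hδ.trans hδf
  -- The summand `5 B` serves the tail bound; `4 N + 2` ensures `s₀ ≤ P / 2`.
  set c : ℝ := 5 * B + (4 * N + 2) with hc
  have hc1 : 1 ≤ c := by linarith
  have hqlim : Tendsto (fun J : ℕ => q ^ J) atTop atTop :=
    tendsto_pow_atTop_atTop_of_one_lt (by omega)
  have hqlim' : Tendsto (fun J : ℕ => ((q ^ J : ℕ) : ℝ)) atTop atTop :=
    tendsto_natCast_atTop_atTop.comp hqlim
  set ρ : ℝ := ((N - 2 * δ / 3) / (N - δ / 3)) ^ 2 with hρ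
  have hρ1 : ρ < 1 := by
    have h1 : (N - 2 * δ / 3) / (N - δ / 3) < 1 := by rw [div_lt_one (by linarith)]; linarith
    have h0 : 0 ≤ (N - 2 * δ / 3) / (N - δ / 3) := div_nonneg (by linarith) (by linarith)
    exact pow_lt_one₀ h0 h1 (by norm_num)
  set y : ℕ → ℝ := fun J => (J : ℝ) ^ ((1 - ρ) / 2) with hy
  have hylim : Tendsto y atTop atTop :=
    (tendsto_rpow_atTop (by linarith)).comp (tendsto_natCast_atTop_atTop (R := ℝ))
  have hJlim : Tendsto (fun J : ℕ => (J : ℝ)⁻¹) atTop (𝓝 0) := tendsto_inv_atTop_nhds_zero_nat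
  have hub : Tendsto (fun J : ℕ => C * (J : ℝ)⁻¹ + (4 * (J : ℝ)⁻¹ + ((y J)⁻¹ + 36 * (J : ℝ)⁻¹)))
      atTop (𝓝 0) := by
    have := (hJlim.const_mul C).add ((hJlim.const_mul 4).add
      ((tendsto_inv_atTop_zero.comp hylim).add (hJlim.const_mul 36)))
    simpa using this
  refine squeeze_zero' (.of_forall fun J => measureReal_nonneg) ?_ hub
  filter_upwards [hqlim.eventually hscale, eventually_ge_atTop 2,
    tendsto_log_natCast.eventually_ge_atTop 33,
    tendsto_log_natCast.eventually_ge_atTop (36 / δ ^ 2),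
    hqlim'.eventually_ge_atTop (C / (N * δ / 3)),
    eventually_rpow_le_order hβ hlog hq,
    eventually_log_pow_le_rpow hβ 3 (2 ^ β * (2 * (8 * (65 * c) ^ 2 * B ^ 2 + 1))),
    eventually_log_pow_le_rpow (by linarith : 0 < (1 - ρ) / 2) 1 (6 * B),
    eventually_mul_pow_le_pow (by norm_num : (1 : ℝ) < 1.4) 12 (12 * B ^ 4 * (65 * c) ^ 4),
    hylim.eventually_ge_atTop 1]
    with J ⟨p, v, D, hs⟩ hJ2 hL33 hLδ hRC hWJ hm3 hGL hX hy1
  have hJ0 : (0 : ℝ) < J := by positivity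
  have hJ2' : (2 : ℝ) ≤ J := by exact_mod_cast hJ2
  set L := Real.log J with hL
  have hL0 : 0 < L := by linarith
  have hL1 : 1 ≤ L := by linarith
  have hexpL : Real.exp L = J := Real.exp_log hJ0
  have hLJ : L ≤ J := Real.log_le_self hJ0.le
  have hexp4 : Real.exp (4 * L) = (J : ℝ) ^ 4 := by
    rw [← hexpL, ← Real.exp_nat_mul]; norm_num
  have hexp4' : Real.exp (-(4 * L)) = ((J : ℝ) ^ 4)⁻¹ := by rw [Real.exp_neg, hexp4]
  set Rn := q ^ J with hRn
  have hR2 : (2 : ℝ) ^ J ≤ (Rn : ℝ) := by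
    rw [hRn]; push_cast; gcongr; exact_mod_cast hq
  have hJR : (J : ℝ) ≤ Rn := by
    have h1 : J < 2 ^ J := Nat.lt_two_pow_self
    have h2 : (J : ℝ) ≤ 2 ^ J := by exact_mod_cast h1.le
    linarith
  have hR1 : (2 : ℝ) ≤ Rn := by linarith
  have hR0 : (0 : ℝ) < Rn := by linarith
  -- parameters
  set P := c * √L with hP
  have hsL1 : 1 ≤ √L := Real.one_le_sqrt.2 hL1
  have hP0 : 0 < P := by positivity
  have hP2 : P ^ 2 = c ^ 2 * L := by rw [hP, mul_pow, Real.sq_sqrt hL0.le]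
  set s₀ := (N - δ) * √(2 * L) + 1 with hs₀
  have hs2L : √(2 * L) ≤ 2 * √L := by
    rw [Real.sqrt_mul (by norm_num)]
    have : √2 ≤ 2 := by rw [Real.sqrt_le_left (by norm_num)]; norm_num
    gcongr
  have hs₀1 : 1 ≤ s₀ := by
    have : 0 ≤ (N - δ) * √(2 * L) := mul_nonneg (by linarith) (Real.sqrt_nonneg _)
    linarith
  have hs₀P : |s₀| ≤ P / 2 := by
    rw [abs_of_nonneg (by linarith)]
    have : (N - δ) * √(2 * L) ≤ N * (2 * √L) := by gcongr; linarith
    have h1 : (4 * N + 2) * √L ≤ c * √L := by gcongr; linarith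
    rw [hP, hs₀]
    linarith
  -- Chosen so that `K / (16 P²) ≥ 4 L`: away from the level the bump is at most `J ^ (-4)`.
  set K := ⌈64 * c ^ 2 * L ^ 2⌉₊ with hK
  have hK1 : 64 * c ^ 2 * L ^ 2 ≤ K := Nat.le_ceil _
  have hK2 : (K : ℝ) ≤ 65 * c ^ 2 * L ^ 2 := by
    have h1 := (Nat.ceil_lt_add_one (by positivity : 0 ≤ 64 * c ^ 2 * L ^ 2)).le
    have h2 : 1 ≤ c ^ 2 * L ^ 2 := one_le_mul_of_one_le_of_one_le (one_le_pow₀ hc1) (one_le_pow₀ hL1)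
    linarith
  have hK0 : 0 < K := Nat.ceil_pos.2 (by positivity)
  set T := (K : ℝ) / P with hT
  have hT0 : 0 ≤ T := by positivity
  have hT2 : T ^ 2 ≤ (65 * c) ^ 2 * L ^ 3 := by
    rw [hT, div_pow, hP2, div_le_iff₀ (by positivity)]
    calc (K : ℝ) ^ 2 ≤ (65 * c ^ 2 * L ^ 2) ^ 2 := by gcongr
      _ = _ := by ring
  set r := ⌈8 * (65 * c) ^ 2 * B ^ 2 * L ^ 3⌉₊ with hr
  have hr1 : 8 * (65 * c) ^ 2 * B ^ 2 * L ^ 3 ≤ r := Nat.le_ceil _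
  have hr0 : r ≠ 0 := (Nat.ceil_pos.2 (by positivity)).ne'
  have hL3 : L ≤ L ^ 3 := le_self_pow₀ hL1 (by norm_num)
  have hmW : 2 * (8 * (65 * c) ^ 2 * B ^ 2 + 1) * L ^ 3 ≤ W Rn := by
    refine le_trans ?_ hWJ
    rw [Real.div_rpow hJ0.le (by norm_num), le_div_iff₀ (by positivity)]
    linarith
  have hrm : 2 * r ≤ W Rn := by
    have h1 := (Nat.ceil_lt_add_one (by positivity : 0 ≤ 8 * (65 * c) ^ 2 * B ^ 2 * L ^ 3)).le
    have h2 : (2 : ℝ) * r ≤ W Rn := by linarith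
    exact_mod_cast h2
  set r' := ⌈4 * L⌉₊ with hr'
  have hr1' : 4 * L ≤ r' := Nat.le_ceil _
  have hr2' : (r' : ℝ) ≤ 5 * L := by
    have h1 := (Nat.ceil_lt_add_one (by positivity : 0 ≤ 4 * L)).le
    linarith
  have hr0' : r' ≠ 0 := (Nat.ceil_pos.2 (by positivity)).ne'
  have hrm' : 2 * r' ≤ W Rn := by
    have h1 : (10 : ℝ) ≤ 2 * (8 * (65 * c) ^ 2 * B ^ 2 + 1) := by
      have : 1 ≤ c ^ 2 * B ^ 2 := one_le_mul_of_one_le_of_one_le (one_le_pow₀ hc1) (one_le_pow₀ hB)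
      have e : 2 * (8 * (65 * c) ^ 2 * B ^ 2 + 1) = 67600 * (c ^ 2 * B ^ 2) + 2 := by ring
      linarith
    have h3 : 10 * L ≤ 2 * (8 * (65 * c) ^ 2 * B ^ 2 + 1) * L ^ 3 := by gcongr
    have h2 : (2 : ℝ) * r' ≤ W Rn := by linarith
    exact_mod_cast h2
  -- the variance
  have hv1 : (N - δ / 3) ^ 2 ≤ v := by
    have h1 := (abs_le.1 hs.variance).1
    have h2 : C / Rn ≤ N * δ / 3 := by
      rw [div_le_iff₀ (by positivity)] at hRC
      rw [div_le_iff₀ hR0]; linarith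
    have h3 : δ * δ ≤ N * δ := by gcongr
    have h4 : (N - δ / 3) ^ 2 = N ^ 2 - 2 * (N * δ) / 3 + δ * δ / 9 := by ring
    have h5 : 0 < N * δ := by positivity
    linarith
  have hv0 : 0 < v := lt_of_lt_of_le (pow_pos (by linarith) 2) hv1
  have hvB : v ≤ B ^ 2 := hs.moments.variance_le
  -- the Gaussian expectation
  set G := ∫ s, bump K P s₀ s ∂gaussianReal 0 v.toNNReal with hG
  have hGJ : y J ≤ J * G := by
    have h6 : 1 / L / (2 * (3 * B)) * Real.exp (-(ρ * L)) ≤ G :=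
      le_integral_bump_gaussian_of_variance hδ hδf hB hL33 hLδ hv1 hvB (by linarith) hK2
    have h7 : (J : ℝ) * Real.exp (-(ρ * L)) = y J * y J := by
      simp only [hy]
      rw [← Real.rpow_add hJ0, Real.rpow_def_of_pos hJ0, ← hL]
      nth_rewrite 1 [← hexpL]
      rw [← Real.exp_add]; congr 1; ring
    calc y J = (6 * B * L) * y J / (6 * B * L) := by field_simp
      _ ≤ y J * y J / (6 * B * L) := by
          have : 6 * B * L ≤ y J := by simpa [hy] using hGL
          gcongr
      _ = J * (1 / L / (2 * (3 * B)) * Real.exp (-(ρ * L))) := by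
          rw [← h7]; field_simp; norm_num
      _ ≤ J * G := by gcongr
  have hG0 : 0 < G := by
    have : 0 < J * G := by linarith
    exact (mul_pos_iff_of_pos_left hJ0).1 this
  have hGinv : (J : ℝ)⁻¹ ≤ G := by
    rw [inv_le_iff_one_le_mul₀ hJ0]; linarith
  have hKG : Real.exp (-(K / (16 * P ^ 2))) ≤ G / 2 := by
    calc Real.exp (-(K / (16 * P ^ 2))) ≤ Real.exp (-(4 * L)) := by
          rw [Real.exp_le_exp, neg_le_neg_iff, le_div_iff₀ (by positivity), hP2]
          linarith
      _ = ((J : ℝ) ^ 4)⁻¹ := hexp4'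
      _ ≤ (J * 2 : ℝ)⁻¹ := by
          gcongr
          calc (J * 2 : ℝ) ≤ J * J := by gcongr
            _ = (J : ℝ) ^ 2 := by ring
            _ ≤ _ := pow_le_pow_right₀ (by linarith) (by norm_num)
      _ = (J : ℝ)⁻¹ / 2 := by rw [mul_inv]; ring
      _ ≤ _ := by gcongr
  -- the error terms
  have hη := charFun_error_le (X := Rn) hB hc1 hL1 hT0 hT2 hr1 (by
      rw [hexp4]
      calc 12 * B ^ 4 * (65 * c) ^ 4 * L ^ 8 * J ^ 4
          ≤ 12 * B ^ 4 * (65 * c) ^ 4 * J ^ 8 * J ^ 4 := by gcongr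
        _ = 12 * B ^ 4 * (65 * c) ^ 4 * J ^ 12 := by ring
        _ ≤ 1.4 ^ J := hX
        -- The base `1.4` was taken below `√2`.
        _ ≤ √(2 ^ J) := by
            refine Real.le_sqrt_of_sq_le ?_
            rw [← pow_mul, mul_comm, pow_mul]
            gcongr; norm_num
        _ ≤ √Rn := Real.sqrt_le_sqrt hR2) (by linarith)
  have htail : (2 * r' * Real.exp 1 * B ^ 2 / (2 * P) ^ 2) ^ r' ≤ ((J : ℝ) ^ 4)⁻¹ := by
    rw [← hexp4']
    exact tail_error_le hL0 hB (by linarith) hr1' hr2'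
  have : Nonempty (Fin (4 * J)) := ⟨⟨0, by omega⟩⟩
  have hA : ∀ j : Fin (4 * J), (Rn : ℝ) ≤ ((q ^ (4 * J + j + 1) : ℕ) : ℝ) -
      (q ^ (4 * J + j) : ℕ) - (Rn + 1) := by
    intro j
    have h1 : 2 * q ^ (4 * J + j) ≤ q ^ (4 * J + j + 1) := by
      rw [pow_succ, mul_comm]; gcongr
    have h2 : Rn ^ 4 ≤ q ^ (4 * J + j) := by
      rw [hRn, ← pow_mul]; exact Nat.pow_le_pow_right (by omega) (by omega)
    have h1' : (2 : ℝ) * (q ^ (4 * J + j) : ℕ) ≤ (q ^ (4 * J + j + 1) : ℕ) := by exact_mod_cast h1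
    have h2' : (Rn : ℝ) ^ 4 ≤ (q ^ (4 * J + j) : ℕ) := by exact_mod_cast h2
    have h3 : 8 * (Rn : ℝ) ≤ (Rn : ℝ) ^ 4 := by
      calc 8 * (Rn : ℝ) = 2 ^ 3 * Rn := by norm_num
        _ ≤ (Rn : ℝ) ^ 3 * Rn := by gcongr
        _ = _ := by ring
    linarith
  have key := hs.exists_exceptional_set_lower hv0
    (fun j : Fin (4 * J) => q ^ (4 * J + j)) (fun j => q ^ (4 * J + j + 1))
    (fun j => Nat.pow_le_pow_right (by omega) (by omega))
    (fun j => by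
      rw [hRn, ← pow_mul]; exact Nat.pow_le_pow_right (by omega) (by omega))
    (fun j j' hjj => by
      rw [Finset.disjoint_left]
      intro i hi hi'
      rw [Finset.mem_Ico] at hi hi'
      rcases lt_or_gt_of_ne hjj with h | h
      · have : q ^ (4 * J + j + 1) ≤ q ^ (4 * J + (j' : ℕ)) :=
          Nat.pow_le_pow_right (by omega) (by have : (j : ℕ) < j' := h; omega)
        omega
      · have : q ^ (4 * J + j' + 1) ≤ q ^ (4 * J + (j : ℕ)) :=
          Nat.pow_le_pow_right (by omega) (by have : (j' : ℕ) < j := h; omega)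
        omega)
    hR0 hA hK0 hP0 hs₀P hs₀1 hT hr0 hrm hr0' hrm' hG hG0 hKG rfl
  have hset : failureSet f n σ q B (N - δ) J = {x | ∀ j : Fin (4 * J),
      ∑ i ∈ Finset.Ico (q ^ (4 * J + j)) (q ^ (4 * J + j + 1)), f (n (σ i) * x) <
      √(((q ^ (4 * J + j + 1) : ℕ) : ℝ) - (q ^ (4 * J + j) : ℕ) - (Rn + 1)) *
        (s₀ - 1) - ((Rn + 1) * B + 1)} := by
    rw [hs₀, add_sub_cancel_right]; rfl
  rw [hset]
  refine key.trans ?_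
  rw [Fintype.card_fin]
  push_cast
  have hJ4 : (J : ℝ) ^ 2 ≤ (J : ℝ) ^ 4 := pow_le_pow_right₀ (by linarith) (by norm_num)
  have a1 : C / (Rn : ℝ) ^ 8 ≤ C * (J : ℝ)⁻¹ := by
    rw [← div_eq_mul_inv]
    gcongr
    exact hJR.trans (le_self_pow₀ (by linarith) (by norm_num))
  have a2 : 4 * (J : ℝ) * (2 * r' * Real.exp 1 * B ^ 2 / (2 * P) ^ 2) ^ r' ≤ 4 * (J : ℝ)⁻¹ := by
    calc _ ≤ 4 * (J : ℝ) * ((J : ℝ) ^ 4)⁻¹ := by gcongr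
      _ ≤ 4 * (J : ℝ) * ((J : ℝ) ^ 2)⁻¹ := by gcongr
      _ = 4 * (J : ℝ)⁻¹ := by field_simp
  have a3 : 4 / (4 * (J : ℝ) * G) ≤ (y J)⁻¹ := by
    calc 4 / (4 * (J : ℝ) * G) = (J * G)⁻¹ := by field_simp
      _ ≤ _ := by gcongr
  have a4 : ∀ η : ℝ, η ≤ 3 * Real.exp (-(4 * L)) → 12 * η / G ^ 2 ≤ 36 * (J : ℝ)⁻¹ := by
    intro η hη'
    rw [hexp4'] at hη'
    calc 12 * η / G ^ 2 ≤ 12 * (3 * ((J : ℝ) ^ 4)⁻¹) / G ^ 2 := by gcongr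
      _ ≤ 12 * (3 * ((J : ℝ) ^ 4)⁻¹) / ((J : ℝ)⁻¹) ^ 2 := by gcongr
      _ = 36 * ((J : ℝ) ^ 2)⁻¹ := by field_simp; norm_num
      _ ≤ _ := by
          gcongr
          exact le_self_pow₀ (by linarith) (by norm_num)
  exact add_le_add a1 (add_le_add a2 (add_le_add a3 (a4 _ hη)))

/-! ### The lower half of the law of the iterated logarithm. -/

/-- Lying in every `F J` from some point on has measure at most each later `μ (F J)`, hence zero. No
independence between different `J` and no second Borel–Cantelli lemma is needed. -/
lemma ae_frequently_notMem_of_tendsto {α : Type*} [MeasurableSpace α] {μ : Measure α}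
    [IsFiniteMeasure μ] {F : ℕ → Set α} (h : Tendsto (fun J => μ.real (F J)) atTop (𝓝 0)) :
    ∀ᵐ x ∂μ, ∃ᶠ J in atTop, x ∉ F J := by
  have h0 : ∀ J₀, μ {x | ∀ J, J₀ ≤ J → x ∈ F J} = 0 := by
    intro J₀
    rw [← measureReal_eq_zero_iff]
    refine le_antisymm (ge_of_tendsto h ?_) measureReal_nonneg
    filter_upwards [eventually_ge_atTop J₀] with J hJ
    exact measureReal_mono fun x hx => hx J hJ
  have h1 : ∀ᵐ x ∂μ, ∀ J₀, x ∉ {x | ∀ J, J₀ ≤ J → x ∈ F J} :=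
    ae_all_iff.2 fun J₀ => measure_eq_zero_iff_ae_notMem.1 (h0 J₀)
  filter_upwards [h1] with x hx
  refine frequently_atTop.2 fun J₀ => ?_
  have := hx J₀
  push Not at this
  obtain ⟨J, hJ, hJF⟩ := this
  exact ⟨J, hJ, hJF⟩

lemma partialSum_add_sum_Ico (f : ℝ → ℝ) (n : ℕ → ℤ) (σ : Equiv.Perm ℕ) {M N : ℕ} (h : M ≤ N)
    (x : ℝ) : partialSum f (n ∘ σ) M x + ∑ i ∈ Finset.Ico M N, f (n (σ i) * x) =
      partialSum f (n ∘ σ) N x := by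
  unfold partialSum
  exact Finset.sum_range_add_sum_Ico (fun i => f (n (σ i) * x)) h

/-- The passage from one block of positions to the partial sum up to its end. -/
lemma le_add_of_block_bounds {N δ κ q M M' R B LL l S T : ℝ} (hδ : 0 < δ) (hδN : δ < N)
    (hκ0 : 0 ≤ κ) (hκ1 : κ ≤ 1) (hκN : κ * N ≤ δ) (hq : 0 < q) (hqκ : 1 - κ ≤ √(1 - 2 / q))
    (hqδ : N + δ ≤ δ * √q) (hM : 0 < M) (hM' : M' = q * M) (hRM : R + 1 ≤ M) (hR : 1 ≤ R)
    (hB : 0 ≤ B) (hRB : 2 * B + 1 ≤ δ * R) (hRM' : R ^ 4 ≤ M') (hLL : 1 ≤ LL)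
    (hl : LL ≤ (1 + κ) * l) (hS : |S| ≤ (N + δ) * √(2 * M * LL))
    (hT : √(M' - M - (R + 1)) * ((N - δ) * √(2 * l)) - ((R + 1) * B + 1) ≤ T) :
    (N - 5 * δ) * √(2 * M' * LL) ≤ S + T := by
  have hM'0 : 0 < M' := by rw [hM']; positivity
  set X := √(2 * M' * LL) with hX
  have hX0 : 0 ≤ X := Real.sqrt_nonneg _
  have hl0 : 0 < l := by
    by_contra hcon
    push Not at hcon
    nlinarith
  have h1 : (N + δ) * √(2 * M * LL) ≤ δ * X := by
    have e : X = √q * √(2 * M * LL) := by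
      rw [hX, ← Real.sqrt_mul hq.le, hM']; congr 1; ring
    rw [e, ← mul_assoc]
    gcongr
  have h2 : (1 - κ) * √M' ≤ √(M' - M - (R + 1)) := by
    calc (1 - κ) * √M' ≤ √(1 - 2 / q) * √M' := by gcongr
      _ = √((1 - 2 / q) * M') := by rw [Real.sqrt_mul' _ hM'0.le]
      _ ≤ _ := by
          refine Real.sqrt_le_sqrt ?_
          have : (1 - 2 / q) * M' = M' - 2 * M := by rw [hM']; field_simp
          linarith
  have h3 : (1 - κ) * √(2 * LL) ≤ √(2 * l) := by
    rw [← Real.sqrt_sq (by linarith : 0 ≤ 1 - κ), ← Real.sqrt_mul (by positivity)]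
    refine Real.sqrt_le_sqrt ?_
    calc (1 - κ) ^ 2 * (2 * LL) ≤ (1 - κ) ^ 2 * (2 * ((1 + κ) * l)) := by gcongr
      _ = (1 - κ) * (1 - κ ^ 2) * (2 * l) := by ring
      _ ≤ 1 * 1 * (2 * l) := by
          gcongr
          · nlinarith
          · linarith
          · nlinarith
      _ = _ := by ring
  have hXs : X = √M' * √(2 * LL) := by
    rw [hX, ← Real.sqrt_mul hM'0.le]; congr 1; ring
  -- Two factors `1 - κ`, from the block length and from the iterated logarithm, cost at most `2 κ N
  -- ≤ 2 δ`. The initial segment and the additive error account for the remaining two of the five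
  -- `δ`.
  have h4 : (N - 3 * δ) * X ≤ √(M' - M - (R + 1)) * ((N - δ) * √(2 * l)) := by
    calc (N - 3 * δ) * X ≤ ((1 - κ) * (1 - κ) * (N - δ)) * X := by
          refine mul_le_mul_of_nonneg_right ?_ hX0
          nlinarith [mul_nonneg (sq_nonneg κ) (by linarith : 0 ≤ N - δ), mul_nonneg hκ0 hδ.le]
      _ = ((1 - κ) * √M') * ((N - δ) * ((1 - κ) * √(2 * LL))) := by rw [hXs]; ring
      _ ≤ _ := by
          have a1 : 0 ≤ N - δ := by linarith
          have a2 : 0 ≤ 1 - κ := by linarith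
          gcongr
  have h5 : (R + 1) * B + 1 ≤ δ * X := by
    have h6 : R ^ 2 ≤ X := by
      refine Real.le_sqrt_of_sq_le ?_
      have : M' * 1 ≤ M' * LL := by gcongr
      calc (R ^ 2) ^ 2 = R ^ 4 := by ring
        _ ≤ _ := by linarith
    calc (R + 1) * B + 1 ≤ (2 * B + 1) * R := by nlinarith
      _ ≤ (δ * R) * R := by gcongr
      _ = δ * R ^ 2 := by ring
      _ ≤ _ := by gcongr
  have h6 := (abs_le.1 (hS.trans h1)).1
  linarith

lemma eventually_loglog_pow_le {q : ℕ} (hq : 2 ≤ q) {κ : ℝ} (hκ : 0 < κ) :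
    ∀ᶠ J : ℕ in atTop, ∀ k, 1 ≤ k → k ≤ 8 * J →
      Real.log (Real.log (q ^ k : ℕ)) ≤ (1 + κ) * Real.log J := by
  filter_upwards [tendsto_log_natCast.eventually_ge_atTop (Real.log (8 * Real.log q) / κ),
    eventually_ge_atTop 1] with J hJ hJ1 k hk1 hk
  have hJ0 : (0 : ℝ) < J := by exact_mod_cast hJ1
  have hq0 : 0 < Real.log q := Real.log_pos (by exact_mod_cast hq)
  have hk0 : (0 : ℝ) < k := by exact_mod_cast hk1
  have hk' : (k : ℝ) ≤ 8 * J := by exact_mod_cast hk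
  rw [div_le_iff₀ hκ] at hJ
  push_cast
  rw [Real.log_pow]
  calc Real.log (k * Real.log q) ≤ Real.log (J * (8 * Real.log q)) := by
        refine Real.log_le_log (by positivity) ?_
        calc (k : ℝ) * Real.log q ≤ 8 * J * Real.log q := by gcongr
          _ = _ := by ring
    _ = Real.log J + Real.log (8 * Real.log q) := Real.log_mul hJ0.ne' (by positivity)
    _ ≤ _ := by linarith

lemma exists_block_ratio {N δ κ : ℝ} (hδ : 0 < δ) (hκ0 : 0 < κ) (hκ1 : κ ≤ 1) :
    ∃ q : ℕ, 2 ≤ q ∧ 1 - κ ≤ √(1 - 2 / q) ∧ N + δ ≤ δ * √q := by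
  obtain ⟨q, hq⟩ := exists_nat_ge (max 2 (max (2 / κ) (((N + δ) / δ) ^ 2)))
  have h2 : (2 : ℝ) ≤ q := (le_max_left _ _).trans hq
  have h3 : 2 / κ ≤ (q : ℝ) := ((le_max_left _ _).trans (le_max_right _ _)).trans hq
  have h4 : ((N + δ) / δ) ^ 2 ≤ (q : ℝ) := ((le_max_right _ _).trans (le_max_right _ _)).trans hq
  have hq0 : (0 : ℝ) < q := by linarith
  refine ⟨q, by exact_mod_cast h2, ?_, ?_⟩
  · refine Real.le_sqrt_of_sq_le ?_
    have : 2 / (q : ℝ) ≤ κ := by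
      rw [div_le_iff₀ hκ0] at h3
      rw [div_le_iff₀ hq0]; linarith
    nlinarith
  · have h5 := Real.le_sqrt_of_sq_le h4
    rw [div_le_iff₀ hδ] at h5
    linarith

/-- Infinitely often a block `[q ^ k, q ^ (k + 1))` has a large sum. By the upper bound, applied to
absolute values, the preceding `q ^ k` terms contribute a fraction of order `1 / √q`, negligible for
large `q`. -/
theorem ae_frequently_le_partialSum {n : ℕ → ℤ} {W : ℕ → ℕ} (hn : NoRelations n W)
    (hW : Monotone W) (hWlim : Tendsto W atTop atTop) {β : ℝ} (hβ : 0 < β)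
    (hlog : ∀ᶠ k : ℕ in atTop, Real.log k ^ β ≤ W k) {f : ℝ → ℝ} (hf : Admissible f)
    (σ : Equiv.Perm ℕ) {δ : ℝ} (hδ : 0 < δ) (hδf : δ < l2Norm f) :
    ∀ᵐ x ∂unitMeasure, ∃ᶠ N : ℕ in atTop,
      (l2Norm f - 5 * δ) * √(2 * N * Real.log (Real.log N)) ≤ partialSum f (n ∘ σ) N x := by
  have hN0 : 0 < l2Norm f := hδ.trans hδf
  set κ := δ / l2Norm f with hκ
  have hκ0 : 0 < κ := by positivity
  have hκ1 : κ ≤ 1 := by rw [hκ, div_le_one hN0]; exact hδf.le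
  have hκN : κ * l2Norm f ≤ δ := by rw [hκ, div_mul_cancel₀ _ hN0.ne']
  obtain ⟨q, hq, hqκ, hqδ⟩ := exists_block_ratio (N := l2Norm f) hδ hκ0 hκ1
  obtain ⟨B, hB, hlim⟩ :=
    exists_tendsto_measureReal_failureSet hn hW hWlim hβ hlog hf σ hδ hδf hq
  have hqlim : Tendsto (fun J : ℕ => ((q ^ J : ℕ) : ℝ)) atTop atTop :=
    tendsto_natCast_atTop_atTop.comp (tendsto_pow_atTop_atTop_of_one_lt (by omega))
  filter_upwards [ae_eventually_abs_partialSum_le hn hW hWlim hβ hlog hf σ hδ,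
    ae_frequently_notMem_of_tendsto hlim] with x hup hfr
  have hll : Tendsto (fun N : ℕ => Real.log (Real.log N)) atTop atTop :=
    Real.tendsto_log_atTop.comp tendsto_log_natCast
  obtain ⟨N₁, hN₁⟩ := eventually_atTop.1 (hup.and (hll.eventually_ge_atTop 1))
  refine frequently_atTop.2 fun N₀ => ?_
  obtain ⟨J, hJF, hJκ, hJR, hJN, hJ1⟩ := (hfr.and_eventually ((eventually_loglog_pow_le hq hκ0).and
    ((hqlim.eventually_ge_atTop ((2 * B + 1) / δ)).and
      ((eventually_ge_atTop (N₀ + N₁)).and (eventually_ge_atTop 1))))).exists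
  simp only [failureSet, Set.mem_ofPred_eq] at hJF
  push Not at hJF
  obtain ⟨j, hj⟩ := hJF
  have hpow : ∀ k, k < q ^ k := fun k => Nat.lt_pow_self (by omega)
  set M := q ^ (4 * J + j) with hM
  set M' := q ^ (4 * J + j + 1) with hM'
  have hMM' : M ≤ M' := Nat.pow_le_pow_right (by omega) (by omega)
  have hMJ : 4 * J + j < M := hpow _
  refine ⟨M', by omega, ?_⟩
  have hMN := (hN₁ M (by omega)).1
  have hML := (hN₁ M (by omega)).2
  have hLM : Real.log (Real.log M) ≤ Real.log (Real.log M') := by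
    have h1 : 3 ≤ M := by omega
    have h1' : (3 : ℝ) ≤ M := by exact_mod_cast h1
    refine Real.log_le_log (Real.log_pos (by linarith)) (Real.log_le_log (by linarith) ?_)
    exact_mod_cast hMM'
  have hR1 : (q ^ J : ℕ) + 1 ≤ M := by
    have : q ^ J < M := Nat.pow_lt_pow_right (by omega) (by omega)
    omega
  have hR4 : (q ^ J) ^ 4 ≤ M' := by
    rw [← pow_mul]; exact Nat.pow_le_pow_right (by omega) (by omega)
  have hMpos : (0 : ℝ) < M := by
    have : 0 < M := by omega
    exact_mod_cast this
  rw [← partialSum_add_sum_Ico f n σ hMM' x]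
  refine le_add_of_block_bounds (q := q) (R := (q ^ J : ℕ)) hδ hδf hκ0.le hκ1 hκN
    (by positivity) hqκ hqδ hMpos ?_ ?_ ?_ (by linarith : 0 ≤ B) ?_ ?_ (hML.trans hLM) ?_ ?_ hj
  · rw [hM', hM, pow_succ]; push_cast; ring
  · exact_mod_cast hR1
  · exact_mod_cast Nat.one_le_pow _ _ (by omega : 0 < q)
  · rw [div_le_iff₀ hδ] at hJR; linarith
  · exact_mod_cast hR4
  · exact hJκ _ (by omega) (by have := j.2; omega)
  · refine hMN.trans ?_
    gcongr

/-! ### Assembly of the law of the iterated logarithm. -/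

lemma ae_of_ae_unitMeasure_of_periodic {p : ℝ → Prop} (hp : ∀ x (k : ℤ), p (x + k) → p x)
    (h : ∀ᵐ x ∂unitMeasure, p x) : ∀ᵐ x : ℝ, p x := by
  rw [ae_restrict_iff' measurableSet_Ioc] at h
  have h1 : ∀ᵐ x : ℝ, ∀ k : ℤ, x + k ∈ Set.Ioc (0 : ℝ) 1 → p (x + k) :=
    ae_all_iff.2 fun k => (measurePreserving_add_right volume (k : ℝ)).quasiMeasurePreserving.ae h
  filter_upwards [h1] with x hx
  refine hp x (1 - ⌈x⌉) (hx (1 - ⌈x⌉) ?_)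
  push_cast
  constructor <;> linarith [Int.le_ceil x, Int.ceil_lt_add_one x]

lemma partialSum_add_intCast {f : ℝ → ℝ} (hf : Function.Periodic f 1) (n : ℕ → ℤ) (N : ℕ) (x : ℝ)
    (k : ℤ) : partialSum f n N (x + k) = partialSum f n N x := by
  unfold partialSum
  refine Finset.sum_congr rfl fun i _ => ?_
  have := hf.int_mul (n i * k) (n i * x)
  rw [← this]
  congr 1
  push_cast
  ring

lemma limsup_coe_eq_of_forall {u : ℕ → ℝ} {L : ℝ}
    (h1 : ∀ k : ℕ, ∀ᶠ N in atTop, u N ≤ L + 1 / ((k : ℝ) + 1))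
    (h2 : ∀ k : ℕ, ∃ᶠ N in atTop, L - 1 / ((k : ℝ) + 1) ≤ u N) :
    limsup (fun N => (u N : EReal)) atTop = (L : EReal) := by
  have ht := tendsto_one_div_add_atTop_nhds_zero_nat (𝕜 := ℝ)
  refine le_antisymm ?_ ?_
  · have h3 : Tendsto (fun k : ℕ => ((L + 1 / ((k : ℝ) + 1) : ℝ) : EReal)) atTop (𝓝 (L : EReal)) := by
      have := ht.const_add L
      rw [add_zero] at this
      exact (continuous_coe_real_ereal.tendsto L).comp this
    refine ge_of_tendsto' h3 fun k => limsup_le_of_le (h := ?_)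
    filter_upwards [h1 k] with N hN using EReal.coe_le_coe_iff.2 hN
  · have h3 : Tendsto (fun k : ℕ => ((L - 1 / ((k : ℝ) + 1) : ℝ) : EReal)) atTop (𝓝 (L : EReal)) := by
      have := ht.const_sub L
      rw [sub_zero] at this
      exact (continuous_coe_real_ereal.tendsto L).comp this
    refine le_of_tendsto' h3 fun k => le_limsup_of_frequently_le ?_
    exact (h2 k).mono fun N hN => EReal.coe_le_coe_iff.2 hN

theorem satisfiesLIL_of_noRelations {n : ℕ → ℤ} {W : ℕ → ℕ} (hn : NoRelations n W)
    (hW : Monotone W) (hWlim : Tendsto W atTop atTop) {β : ℝ} (hβ : 0 < β)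
    (hlog : ∀ᶠ k : ℕ in atTop, Real.log k ^ β ≤ W k) {f : ℝ → ℝ} (hf : Admissible f)
    (σ : Equiv.Perm ℕ) : SatisfiesLIL f (n ∘ σ) := by
  refine ae_of_ae_unitMeasure_of_periodic (fun x k h => ?_) ?_
  · simpa only [partialSum_add_intCast hf.periodic] using h
  have hnorm : 0 ≤ l2Norm f := Real.sqrt_nonneg _
  have hpos : ∀ᶠ N : ℕ in atTop, 0 < √(2 * N * Real.log (Real.log N)) := by
    filter_upwards [(Real.tendsto_log_atTop.comp tendsto_log_natCast).eventually_gt_atTop 0,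
      eventually_gt_atTop 0] with N h1 h2
    have h2' : (0 : ℝ) < N := by exact_mod_cast h2
    exact Real.sqrt_pos.2 (mul_pos (by positivity) h1)
  have hup : ∀ᵐ x ∂unitMeasure, ∀ k : ℕ, ∀ᶠ N : ℕ in atTop, |partialSum f (n ∘ σ) N x| ≤
      (l2Norm f + 1 / ((k : ℝ) + 1)) * √(2 * N * Real.log (Real.log N)) :=
    ae_all_iff.2 fun k =>
      ae_eventually_abs_partialSum_le hn hW hWlim hβ hlog hf σ Nat.one_div_pos_of_nat
  have hlow : ∀ᵐ x ∂unitMeasure, ∀ k : ℕ, ∃ᶠ N : ℕ in atTop,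
      (l2Norm f - 1 / ((k : ℝ) + 1)) * √(2 * N * Real.log (Real.log N)) ≤
        partialSum f (n ∘ σ) N x := by
    -- When `‖f‖ = 0` the lower bound is contained in the upper bound for the absolute value.
    rcases hnorm.eq_or_lt with h0 | h0
    · filter_upwards [hup] with x hx k
      refine ((hx k).mono fun N hN => ?_).frequently
      rw [← h0] at hN ⊢
      linarith [(abs_le.1 hN).1]
    · refine ae_all_iff.2 fun k => ?_
      set δ := min (l2Norm f / 2) (1 / ((k : ℝ) + 1) / 5) with hδ
      have hδ0 : 0 < δ := by rw [hδ]; positivity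
      have hδ1 : δ ≤ l2Norm f / 2 := min_le_left _ _
      have hδ2 : δ ≤ 1 / ((k : ℝ) + 1) / 5 := min_le_right _ _
      filter_upwards [ae_frequently_le_partialSum hn hW hWlim hβ hlog hf σ hδ0 (by linarith)]
        with x hx
      refine hx.mono fun N hN => le_trans ?_ hN
      exact mul_le_mul_of_nonneg_right (by linarith) (Real.sqrt_nonneg _)
  filter_upwards [hup, hlow] with x h1 h2
  refine limsup_coe_eq_of_forall (fun k => ?_) fun k => ?_
  · filter_upwards [h1 k, hpos] with N hN hN0
    rw [div_le_iff₀ hN0]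
    exact (le_abs_self _).trans hN
  · refine ((h2 k).and_eventually hpos).mono fun N ⟨hN, hN0⟩ => ?_
    rwa [le_div_iff₀ hN0]

end

end RandomLacunary

theorem theorem3 (ω : ℕ → ℝ) (a : ℝ)
    (hω_pos : ∀ k, 1 ≤ k → 0 < ω k)
    (hω_mono : MonotoneOn ω (Set.Ici 1))
    (hω_lim : Tendsto ω atTop atTop)
    (ha_pos : 0 < a)
    (ha : ∀ k, 1 ≤ k → (RandomLacunary.blockIntegers a ω k).Nonempty) :
    ∀ᵐ n ∂(RandomLacunary.randomSeqLaw a ω),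
      ∀ f : ℝ → ℝ, RandomLacunary.Admissible f →
        ∀ σ : Equiv.Perm ℕ,
          RandomLacunary.SatisfiesCLT f (n ∘ σ) ∧
          ((∃ α : ℝ, 0 < α ∧ ∃ k₀ : ℕ, ∀ k, k₀ ≤ k → Real.log k ^ α ≤ ω k) →
            RandomLacunary.SatisfiesLIL f (n ∘ σ)) := by
  -- The exceptional null set is fixed here, before `f` and `σ` are introduced.
  filter_upwards [RandomLacunary.ae_noRelations hω_mono hω_lim ha_pos ha] with n hn f hf σ
  have hW := RandomLacunary.relationOrder_mono hω_mono
  have hWlim := RandomLacunary.tendsto_relationOrder hω_lim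
  refine ⟨RandomLacunary.satisfiesCLT_of_noRelations hn hW hWlim hf σ, ?_⟩
  rintro ⟨α, hα, k₀, hk₀⟩
  exact RandomLacunary.satisfiesLIL_of_noRelations hn hW hWlim
    (lt_min (by positivity) one_pos) (RandomLacunary.log_rpow_le_relationOrder hα hk₀) hf σ
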